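/- Let $\mathfrak g=gl(1|1)$ be the complex Lie superalgebra with even basis elements $E,N$ and odd basis elements $\Psi^{\pm}$ and brackets $[\Psi^+,\Psi^-]=E$, $[N,\Psi^{\pm}]=\pm\Psi^{\pm}$, all other brackets of basis elements (apart from those forced by super-skew-symmetry) being zero, and with the invariant supersymmetric bilinear form $(N,E)=(E,N)=1$, $(\Psi^+,\Psi^-)=-(\Psi^-,\Psi^+)=1$, all other products of basis elements being zero. Let $\widehat{\mathfrak g}=\mathfrak g\otimes\mathbb C[t,t^{-1}]\oplus\mathbb CK$ be its affinization, $[x(n),y(m)]=[x,y](n+m)+n\,(x,y)\,\delta_{n+m,0}K$ with $K$ central. Let $V^1(\mathfrak g)$ be the universal affine vertex superalgebra of level $1$ (the $\widehat{\mathfrak g}$-module generated by a vector $\mathbf 1$ with $x(n)\mathbf 1=0$ for $x\in\mathfrak g$, $n\ge 0$, and $K=1$, with $Y(x(-1)\mathbf 1,z)=\sum_{n\in\mathbb Z}x(n)z^{-n-1}$), and let $V_1(\mathfrak g)$ be its simple quotient, the quotient by the sum of all proper ideals. Let $M$ be the Weyl vertex algebra: the module generated by a vector $\mathbf 1$ with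 $a(n)\mathbf 1=a^*(n+1)\mathbf 1=0$ $(n\ge 0)$ over the algebra with generators $a(n),a^*(n)$, $n\in\mathbb Z$, and relations $[a(n),a^*(m)]=\delta_{n+m,0}$, $[a(n),a(m)]=[a^*(n),a^*(m)]=0$, with the vertex algebra structure for which $Y(a(-1)\mathbf 1,z)=\sum_n a(n)z^{-n-1}$ and $Y(a^*(0)\mathbf 1,z)=\sum_n a^*(n)z^{-n}$. Let $F$ be the Clifford vertex superalgebra: the module generated by a vector $\mathbf 1$ with $\psi(r)\mathbf 1=\psi^*(r)\mathbf 1=0$ $(r>0)$ over the algebra with odd generators $\psi(r),\psi^*(r)$, $r\in\tfrac12+\mathbb Z$, whose only non-zero anticommutators are $[\psi(r),\psi^*(s)]=\delta_{r+s,0}$, with $Y(\psi,z)=\sum_n\psi(n+\tfrac12)z^{-n-1}$ and $Y(\psi^*,z)=\sum_n\psi^*(n+\tfrac12)z^{-n-1}$, where $\psi=\psi(-\tfrac12)\mathbf 1$ and $\psi^*=\psi^*(-\tfrac12)\mathbf 1$. Let $\mathcal U=M\otimes F$ be the tensor product vertex superalgebra, put $\beta=a(-1)a^*(0)\mathbf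 1\in M$ and $\gamma=\psi(-\tfrac12)\psi^*(-\tfrac12)\mathbf 1\in F$, and define in $\mathcal U$ the vectors $$\Psi^+=a(-1)\mathbf 1\otimes\psi,\quad \Psi^-=a^*(0)\mathbf 1\otimes\psi^*,\quad E=\mathbf 1\otimes\gamma+\beta\otimes\mathbf 1,\quad N=\tfrac12(\mathbf 1\otimes\gamma-\beta\otimes\mathbf 1).$$ For $X\in\mathcal U$ write $Y(X,z)=\sum_{n\in\mathbb Z}X(n)z^{-n-1}$. Then $\mathcal U^0=\mathrm{Ker}_{M\otimes F}\,E(0)$ is a vertex subalgebra of $\mathcal U$, and there is an isomorphism of vertex superalgebras $$V_1(gl(1|1))\;\cong\;\mathcal U^0$$ which sends $x(-1)\mathbf 1$ to the vector $x\in\mathcal U^0$ for $x=E,N,\Psi^+,\Psi^-$. -/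

import Mathlib

/-!
# Vertex superalgebras, the Weyl and Clifford vertex superalgebras, affine `gl(1|1)`

* `VertexSuperalgebra V`: vertex superalgebra structures on `V`.
* `GeneratingFields.vertexSuperalgebra`: the vertex superalgebra generated by mutually local
  translation covariant fields; `GeneratingFields.mode_x` says that the generating fields are
  fields of this structure.
* `CurrentData.vertexSuperalgebra`: the special case of the vacuum module of an algebra of modes
  given by commutation relations. It is used for the Weyl algebra, the Clifford algebra and the
  affine Lie superalgebra of `gl(1|1)`.
* `VertexSuperalgebra.tensor`, `restrict`, `quotient`, `simpleQuotient`, `Iso`.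
* `U`: the tensor product of the Weyl and the Clifford vertex superalgebras, with its vectors
  `vecE`, `vecN`, `PsiP`, `PsiM`, and `U0`, the kernel of `E(0)`.
* `simpleAffine k`: the simple affine vertex superalgebra of `gl(1|1)` of level `k`.
-/

noncomputable section

namespace VertexAlg

theorem finite_supp {E : Type*} [AddCommGroup E] {u : ℕ → E} (N : ℤ) (h : ∀ j : ℕ, N ≤ j → u j = 0) :
    (Function.support u).Finite := by
  refine (Set.finite_lt_nat N.toNat).subset fun j hj => ?_
  by_contra hc
  exact hj (h j (by simp only [Set.mem_ofPred_eq, not_lt] at hc; omega))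

theorem finsum_telescope {E : Type*} [AddCommGroup E] {u : ℕ → E} (h : (Function.support u).Finite) :
    ∑ᶠ j, (u j - u (j + 1)) = u 0 := by
  have h' : (Function.support fun j => u (j + 1)).Finite :=
    h.preimage (f := fun j => j + 1) (fun a _ b _ hab => by simpa using hab)
  obtain ⟨N, hN⟩ := h.bddAbove
  have hz : ∀ j, N + 1 ≤ j → u j = 0 := fun j hj => by
    by_contra hc
    exact absurd (hN hc) (by omega)
  rw [finsum_eq_sum_of_support_subset (s := Finset.range (N + 1))]
  · rw [Finset.sum_range_sub', hz (N + 1) le_rfl, sub_zero]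
  · intro j hj
    by_contra hc
    simp only [Finset.coe_range, Set.mem_Iio, not_lt] at hc
    exact hj (by simp only [hz j hc, hz (j + 1) (by omega), sub_zero])

variable {E E' V W : Type*} [AddCommGroup E] [Module ℂ E] [AddCommGroup E'] [Module ℂ E']
  [AddCommGroup V] [Module ℂ V] [AddCommGroup W] [Module ℂ W]

/-- Multiplication by `z - w` on formal distributions `∑ f m n z^(-m-1) w^(-n-1)`,
written on coefficients. -/
def mulSub : Module.End ℂ (ℤ → ℤ → E) where
  toFun f m n := f (m + 1) n - f m (n + 1)
  map_add' f g := by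
    funext m n
    simp only [Pi.add_apply]
    abel
  map_smul' c f := by
    funext m n
    simp only [Pi.smul_apply, RingHom.id_apply, smul_sub]

/-- A formal distribution `∑ A n z^(-n-1)` with values in `End V` is a field if
`A n v = 0` for `n` large, for every `v`. -/
def IsField (A : ℤ → Module.End ℂ V) : Prop :=
  ∀ v, ∃ N : ℤ, ∀ n, N ≤ n → A n v = 0

/-- Mutual locality with sign `ε`:
`(z - w)^N (A(z) B(w) - ε B(w) A(z)) = 0` for some `N`. -/
def Local (ε : ℂ) (A B : ℤ → Module.End ℂ V) : Prop :=
  ∃ N : ℕ, (mulSub ^ N) (fun m n => A m * B n - ε • (B n * A m)) = 0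

/-- The sum of a family of linear maps of which, at each vector, only finitely many are nonzero
(and `0` for other families). -/
def psum {ι : Type*} (f : ι → V →ₗ[ℂ] W) : V →ₗ[ℂ] W :=
  open Classical in
  if h : ∀ v, (Function.support fun i => f i v).Finite then
    { toFun := fun v => ∑ᶠ i, f i v
      map_add' := fun v w => by
        simp only [map_add]
        exact finsum_add_distrib (h v) (h w)
      map_smul' := fun c v => by
        simp only [map_smul, RingHom.id_apply]
        exact (smul_finsum' c (h v)).symm }
  else 0

theorem psum_apply {ι : Type*} {f : ι → V →ₗ[ℂ] W}
    (h : ∀ v, (Function.support fun i => f i v).Finite) (v : V) :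
    psum f v = ∑ᶠ i, f i v := by
  unfold psum
  rw [dif_pos h]
  rfl

/-- Coefficients of `A(z) B(w) (z-w)⁻¹ - ε B(w) A(z) (z-w)⁻¹`, expanded for `|z| > |w|` in the first
term and for `|w| > |z|` in the second. -/
def nprodAux (ε : ℂ) (A B : ℤ → Module.End ℂ V) (p m : ℤ) : Module.End ℂ V :=
  psum fun j : ℕ => A (p - 1 - j) * B (m + j) + ε • (B (m - 1 - j) * A (p + j))

/-- The normally ordered product `:A(z) B(z):` of two fields, with sign `ε`. -/
def nprod (ε : ℂ) (A B : ℤ → Module.End ℂ V) (m : ℤ) : Module.End ℂ V :=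
  nprodAux ε A B 0 m

/-- The derivative of a formal distribution. -/
def fieldDeriv (A : ℤ → Module.End ℂ V) (n : ℤ) : Module.End ℂ V :=
  (-n : ℂ) • A (n - 1)

/-! ### Elementary facts on fields and locality -/

theorem mulSub_pow_map (L : E →ₗ[ℂ] E') (N : ℕ) (f : ℤ → ℤ → E) (m n : ℤ) :
    (mulSub ^ N) (fun m n => L (f m n)) m n = L ((mulSub ^ N) f m n) := by
  induction N generalizing m n with
  | zero => rfl
  | succ N ih =>
    rw [pow_succ', pow_succ', Module.End.mul_apply, Module.End.mul_apply]
    simp only [mulSub, LinearMap.coe_mk, AddHom.coe_mk] at ih ⊢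
    rw [ih, ih, map_sub]

theorem mulSub_pow_mono {N M : ℕ} (h : N ≤ M) {f : ℤ → ℤ → E} (hf : (mulSub ^ N) f = 0) :
    (mulSub ^ M) f = 0 := by
  obtain ⟨k, rfl⟩ := Nat.exists_eq_add_of_le' h
  rw [pow_add, Module.End.mul_apply, hf, map_zero]

theorem finite1 {A B : ℤ → Module.End ℂ V} (hB : IsField B) (p m : ℤ) (v : V) :
    (Function.support fun j : ℕ => A (p - 1 - j) (B (m + j) v)).Finite := by
  obtain ⟨N, hN⟩ := hB v
  exact finite_supp (N - m) fun j hj => by rw [hN _ (by omega), map_zero]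

theorem finite2 {A B : ℤ → Module.End ℂ V} (hA : IsField A) (p m : ℤ) (v : V) :
    (Function.support fun j : ℕ => B (m - 1 - j) (A (p + j) v)).Finite := by
  obtain ⟨N, hN⟩ := hA v
  exact finite_supp (N - p) fun j hj => by rw [hN _ (by omega), map_zero]

theorem finite_smul {u : ℕ → E} (h : (Function.support u).Finite) (c : ℕ → ℂ) :
    (Function.support fun j => c j • u j).Finite :=
  h.subset fun j hj hc => hj (by simp only [hc, smul_zero])

theorem nprodAux_apply {A B : ℤ → Module.End ℂ V} (ε : ℂ) (hA : IsField A) (hB : IsField B)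
    (p m : ℤ) (v : V) :
    nprodAux ε A B p m v = ∑ᶠ j : ℕ, A (p - 1 - j) (B (m + j) v) +
      ε • ∑ᶠ j : ℕ, B (m - 1 - j) (A (p + j) v) := by
  have h2 := fun v => finite_smul (finite2 (B := B) hA p m v) (fun _ => ε)
  have h : ∀ v, (Function.support fun j : ℕ =>
      (A (p - 1 - j) * B (m + j) + ε • (B (m - 1 - j) * A (p + j))) v).Finite := fun v =>
    ((finite1 (A := A) hB p m v).union (h2 v)).subset (Function.support_add _ _)
  rw [nprodAux, psum_apply h, smul_finsum' ε (finite2 hA p m v)]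
  exact finsum_add_distrib (finite1 hB p m v) (h2 v)

theorem isField_nprod {A B : ℤ → Module.End ℂ V} (ε : ℂ) (hA : IsField A) (hB : IsField B) :
    IsField (nprod ε A B) := by
  intro v
  obtain ⟨N, hN⟩ := hB v
  obtain ⟨K, hK⟩ := hA v
  have key : ∀ k : ℕ, ∃ M : ℤ, ∀ m, M ≤ m → ∀ j : ℕ, j < k → B (m - 1 - j) (A (0 + j) v) = 0 := by
    intro k
    induction k with
    | zero => exact ⟨0, fun m _ j hj => absurd hj (by omega)⟩
    | succ k ih =>
      obtain ⟨M, hM⟩ := ih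
      obtain ⟨M', hM'⟩ := hB (A (0 + k) v)
      refine ⟨max M (M' + 1 + k), fun m hm j hj => ?_⟩
      rcases Nat.lt_succ_iff_lt_or_eq.1 hj with h | rfl
      · exact hM m (by omega) j h
      · exact hM' _ (by omega)
  obtain ⟨M, hM⟩ := key K.toNat
  refine ⟨max N M, fun m hm => ?_⟩
  rw [nprod, nprodAux_apply ε hA hB, finsum_eq_zero_of_forall_eq_zero,
    finsum_eq_zero_of_forall_eq_zero, smul_zero, zero_add]
  · intro j
    by_cases hj : j < K.toNat
    · exact hM m (by omega) j hj
    · rw [hK _ (by omega), map_zero]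
  · intro j
    rw [hN _ (by omega), map_zero]

theorem isField_deriv {A : ℤ → Module.End ℂ V} (hA : IsField A) : IsField (fieldDeriv A) := by
  intro v
  obtain ⟨N, hN⟩ := hA v
  exact ⟨N + 1, fun n hn => by
    rw [fieldDeriv, LinearMap.smul_apply, hN _ (by omega), smul_zero]⟩

theorem Local.symm {ε : ℂ} (hε : ε * ε = 1) {A B : ℤ → Module.End ℂ V} (h : Local ε A B) :
    Local ε B A := by
  obtain ⟨N, hN⟩ := h
  refine ⟨N, ?_⟩
  have key : ∀ (N : ℕ) (f : ℤ → ℤ → Module.End ℂ V) (m n : ℤ),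
      (mulSub ^ N) (fun m n => f n m) m n = (-1 : ℂ) ^ N • (mulSub ^ N) f n m := by
    intro N f
    induction N with
    | zero => intro m n; simp
    | succ N ih =>
      intro m n
      simp only [pow_succ' (mulSub (E := Module.End ℂ V)), Module.End.mul_apply]
      simp only [mulSub, LinearMap.coe_mk, AddHom.coe_mk] at ih ⊢
      rw [ih, ih, pow_succ]
      module
  have e : (fun m n => B m * A n - ε • (A n * B m)) =
      fun m n => (LinearMap.lsmul ℂ (Module.End ℂ V) (-ε))
        ((fun m n => A m * B n - ε • (B n * A m)) n m) := by
    funext m n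
    simp only [LinearMap.lsmul_apply, smul_sub, smul_smul, neg_mul, hε]
    module
  funext m n
  rw [e, mulSub_pow_map, key, hN]
  simp

theorem Local.deriv_left {ε : ℂ} {A B : ℤ → Module.End ℂ V} (h : Local ε A B) :
    Local ε (fieldDeriv A) B := by
  obtain ⟨N, hN⟩ := h
  refine ⟨N + 1, ?_⟩
  have key : ∀ (N : ℕ) (f : ℤ → ℤ → Module.End ℂ V) (m n : ℤ),
      (mulSub ^ (N + 1)) (fun m n => (-m : ℂ) • f (m - 1) n) m n =
        (-m : ℂ) • (mulSub ^ (N + 1)) f (m - 1) n - (N + 1 : ℂ) • (mulSub ^ N) f m n := by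
    intro N f
    induction N with
    | zero =>
      intro m n
      simp only [zero_add, pow_one, pow_zero, Module.End.one_apply, mulSub, LinearMap.coe_mk,
        AddHom.coe_mk, add_sub_cancel_right, sub_add_cancel]
      push_cast
      module
    | succ N ih =>
      intro m n
      simp only [pow_succ' (mulSub (E := Module.End ℂ V)), Module.End.mul_apply] at ih ⊢
      simp only [mulSub, LinearMap.coe_mk, AddHom.coe_mk] at ih ⊢
      rw [ih, ih]
      simp only [add_sub_cancel_right, sub_add_cancel]
      push_cast
      module
  have e : (fun m n => fieldDeriv A m * B n - ε • (B n * fieldDeriv A m)) =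
      fun m n : ℤ => (-m : ℂ) •
        (fun m n : ℤ => A m * B n - ε • (B n * A m)) (m - 1) n := by
    funext m n
    simp only [fieldDeriv, smul_mul_assoc, mul_smul_comm]
    module
  funext m n
  rw [e]
  refine (key N (fun m n : ℤ => A m * B n - ε • (B n * A m)) m n).trans ?_
  rw [hN, mulSub_pow_mono (Nat.le_succ N) hN]
  simp

theorem Local.add_left {ε : ℂ} {A B C : ℤ → Module.End ℂ V} (hA : Local ε A C)
    (hB : Local ε B C) : Local ε (A + B) C := by
  obtain ⟨N, hN⟩ := hA
  obtain ⟨M, hM⟩ := hB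
  refine ⟨max N M, ?_⟩
  rw [← add_zero (0 : ℤ → ℤ → Module.End ℂ V)]
  nth_rewrite 1 [← mulSub_pow_mono (le_max_left N M) hN]
  rw [← mulSub_pow_mono (le_max_right N M) hM, ← map_add]
  congr 1
  funext m n
  simp only [Pi.add_apply, add_mul, mul_add, smul_add]
  abel

theorem Local.smul_left {ε c : ℂ} {A C : ℤ → Module.End ℂ V} (hA : Local ε A C) :
    Local ε (c • A) C := by
  obtain ⟨N, hN⟩ := hA
  refine ⟨N, ?_⟩
  rw [← smul_zero c, ← hN, ← map_smul]
  congr 1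
  funext m n
  simp only [Pi.smul_apply, smul_mul_assoc, mul_smul_comm, smul_sub, smul_comm ε c]

theorem Local.zero_left {ε : ℂ} {C : ℤ → Module.End ℂ V} : Local ε 0 C :=
  ⟨0, by funext m n; simp⟩

theorem pow_sub_kill {R : Type*} [AddCommGroup R] [Module ℂ R] {x y : Module.End ℂ R}
    (hxy : Commute x y) (a b : ℕ) (g : R) (hx : (x ^ a) g = 0) (hy : (y ^ b) g = 0) :
    ((x - y) ^ (a + b)) g = 0 := by
  induction a generalizing b g with
  | zero => rw [pow_zero, Module.End.one_apply] at hx; rw [hx, map_zero]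
  | succ a iha =>
    induction b generalizing g with
    | zero => rw [pow_zero, Module.End.one_apply] at hy; rw [hy, map_zero]
    | succ b ihb =>
      have e : a + 1 + (b + 1) = (a + 1 + b) + 1 := by omega
      rw [e, pow_succ, Module.End.mul_apply, LinearMap.sub_apply, map_sub]
      have h1 : ((x - y) ^ (a + 1 + b)) (y g) = 0 := by
        apply ihb
        · rw [← Module.End.mul_apply, (hxy.pow_left (a + 1)).eq, Module.End.mul_apply, hx, map_zero]
        · rwa [← Module.End.mul_apply, ← pow_succ]
      have h2 : ((x - y) ^ (a + 1 + b)) (x g) = 0 := by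
        rw [show a + 1 + b = a + (b + 1) by omega]
        apply iha
        · rwa [← Module.End.mul_apply, ← pow_succ]
        · rw [← Module.End.mul_apply, (hxy.symm.pow_left (b + 1)).eq, Module.End.mul_apply, hy,
            map_zero]
      rw [h1, h2, sub_zero]

/-- Multiplication by `z₁ - z₂` on formal distributions in three variables. -/
def mulSub12 : Module.End ℂ (ℤ → ℤ → ℤ → E) where
  toFun f p m k := f (p + 1) m k - f p (m + 1) k
  map_add' f g := by
    funext p m k
    simp only [Pi.add_apply]
    abel
  map_smul' c f := by
    funext p m k
    simp only [Pi.smul_apply, RingHom.id_apply, smul_sub]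

/-- Multiplication by `z₁ - z₃` on formal distributions in three variables. -/
def mulSub13 : Module.End ℂ (ℤ → ℤ → ℤ → E) where
  toFun f p m k := f (p + 1) m k - f p m (k + 1)
  map_add' f g := by
    funext p m k
    simp only [Pi.add_apply]
    abel
  map_smul' c f := by
    funext p m k
    simp only [Pi.smul_apply, RingHom.id_apply, smul_sub]

/-- Multiplication by `z₂ - z₃` on formal distributions in three variables. -/
def mulSub23 : Module.End ℂ (ℤ → ℤ → ℤ → E) where
  toFun f p m k := f p (m + 1) k - f p m (k + 1)
  map_add' f g := by
    funext p m k
    simp only [Pi.add_apply]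
    abel
  map_smul' c f := by
    funext p m k
    simp only [Pi.smul_apply, RingHom.id_apply, smul_sub]

theorem mulSub12_pow (N : ℕ) (f : ℤ → ℤ → ℤ → E) (p m k : ℤ) :
    (mulSub12 ^ N) f p m k = (mulSub ^ N) (fun p m => f p m k) p m := by
  induction N generalizing p m k with
  | zero => rfl
  | succ N ih =>
    rw [pow_succ', pow_succ', Module.End.mul_apply, Module.End.mul_apply]
    simp only [mulSub, mulSub12, LinearMap.coe_mk, AddHom.coe_mk] at ih ⊢
    rw [ih, ih]

theorem mulSub13_pow (N : ℕ) (f : ℤ → ℤ → ℤ → E) (p m k : ℤ) :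
    (mulSub13 ^ N) f p m k = (mulSub ^ N) (fun p k => f p m k) p k := by
  induction N generalizing p m k with
  | zero => rfl
  | succ N ih =>
    rw [pow_succ', pow_succ', Module.End.mul_apply, Module.End.mul_apply]
    simp only [mulSub, mulSub13, LinearMap.coe_mk, AddHom.coe_mk] at ih ⊢
    rw [ih, ih]

theorem mulSub23_pow (N : ℕ) (f : ℤ → ℤ → ℤ → E) (p m k : ℤ) :
    (mulSub23 ^ N) f p m k = (mulSub ^ N) (fun m k => f p m k) m k := by
  induction N generalizing p m k with
  | zero => rfl
  | succ N ih =>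
    rw [pow_succ', pow_succ', Module.End.mul_apply, Module.End.mul_apply]
    simp only [mulSub, mulSub23, LinearMap.coe_mk, AddHom.coe_mk] at ih ⊢
    rw [ih, ih]

theorem commute_13_12 : Commute (mulSub13 : Module.End ℂ (ℤ → ℤ → ℤ → E)) mulSub12 := by
  refine LinearMap.ext fun f => ?_
  funext p m k
  simp only [Module.End.mul_apply, mulSub12, mulSub13, LinearMap.coe_mk, AddHom.coe_mk]
  abel

theorem commute_13_23 : Commute (mulSub13 : Module.End ℂ (ℤ → ℤ → ℤ → E)) mulSub23 := by
  refine LinearMap.ext fun f => ?_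
  funext p m k
  simp only [Module.End.mul_apply, mulSub23, mulSub13, LinearMap.coe_mk, AddHom.coe_mk]
  abel

theorem commute_12_23 : Commute (mulSub12 : Module.End ℂ (ℤ → ℤ → ℤ → E)) mulSub23 := by
  refine LinearMap.ext fun f => ?_
  funext p m k
  simp only [Module.End.mul_apply, mulSub12, mulSub23, LinearMap.coe_mk, AddHom.coe_mk]
  abel

/-- Sums over `j` of shifts in the first two variables commute with multiplication operators. -/
theorem diag_sum_kill (c d s t : ℤ) {h : ℤ → ℤ → ℤ → E}
    (hfin : ∀ p m k, (Function.support fun j : ℕ => h (p + c + s * j) (m + d + t * j) k).Finite)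
    {a b : ℕ} (hk : (mulSub13 ^ a) ((mulSub23 ^ b) h) = 0) :
    (mulSub13 ^ a) ((mulSub23 ^ b) fun p m k => ∑ᶠ j : ℕ, h (p + c + s * j) (m + d + t * j) k) = 0 := by
  have step13 : ∀ {h : ℤ → ℤ → ℤ → E},
      (∀ p m k, (Function.support fun j : ℕ => h (p + c + s * j) (m + d + t * j) k).Finite) →
      (∀ p m k, (Function.support fun j : ℕ => mulSub13 h (p + c + s * j) (m + d + t * j) k).Finite) ∧
      mulSub13 (fun p m k => ∑ᶠ j : ℕ, h (p + c + s * j) (m + d + t * j) k) =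
        fun p m k => ∑ᶠ j : ℕ, mulSub13 h (p + c + s * j) (m + d + t * j) k := by
    intro h hf
    have e : ∀ (p : ℤ) (j : ℕ), p + c + s * j + 1 = p + 1 + c + s * j := fun p j => by ring
    simp only [mulSub13, LinearMap.coe_mk, AddHom.coe_mk, e]
    refine ⟨fun p m k => ((hf (p + 1) m k).union (hf p m (k + 1))).subset
      (Function.support_sub _ _), ?_⟩
    funext p m k
    exact (finsum_sub_distrib (hf _ _ _) (hf _ _ _)).symm
  have step23 : ∀ {h : ℤ → ℤ → ℤ → E},
      (∀ p m k, (Function.support fun j : ℕ => h (p + c + s * j) (m + d + t * j) k).Finite) →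
      (∀ p m k, (Function.support fun j : ℕ => mulSub23 h (p + c + s * j) (m + d + t * j) k).Finite) ∧
      mulSub23 (fun p m k => ∑ᶠ j : ℕ, h (p + c + s * j) (m + d + t * j) k) =
        fun p m k => ∑ᶠ j : ℕ, mulSub23 h (p + c + s * j) (m + d + t * j) k := by
    intro h hf
    have e : ∀ (p : ℤ) (j : ℕ), p + d + t * j + 1 = p + 1 + d + t * j := fun p j => by ring
    simp only [mulSub23, LinearMap.coe_mk, AddHom.coe_mk, e]
    refine ⟨fun p m k => ((hf p (m + 1) k).union (hf p m (k + 1))).subset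
      (Function.support_sub _ _), ?_⟩
    funext p m k
    exact (finsum_sub_distrib (hf _ _ _) (hf _ _ _)).symm
  have pow23 : ∀ b : ℕ,
      (∀ p m k, (Function.support fun j : ℕ =>
        (mulSub23 ^ b) h (p + c + s * j) (m + d + t * j) k).Finite) ∧
      (mulSub23 ^ b) (fun p m k => ∑ᶠ j : ℕ, h (p + c + s * j) (m + d + t * j) k) =
        fun p m k => ∑ᶠ j : ℕ, (mulSub23 ^ b) h (p + c + s * j) (m + d + t * j) k := by
    intro b
    induction b with
    | zero => exact ⟨hfin, rfl⟩
    | succ b ih =>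
      rw [pow_succ', Module.End.mul_apply, Module.End.mul_apply, ih.2]
      exact step23 ih.1
  have pow13 : ∀ a : ℕ,
      (∀ p m k, (Function.support fun j : ℕ =>
        (mulSub13 ^ a) ((mulSub23 ^ b) h) (p + c + s * j) (m + d + t * j) k).Finite) ∧
      (mulSub13 ^ a) ((mulSub23 ^ b) (fun p m k => ∑ᶠ j : ℕ, h (p + c + s * j) (m + d + t * j) k)) =
        fun p m k => ∑ᶠ j : ℕ, (mulSub13 ^ a) ((mulSub23 ^ b) h) (p + c + s * j) (m + d + t * j) k := by
    intro a
    induction a with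
    | zero => exact pow23 b
    | succ a ih =>
      rw [pow_succ', Module.End.mul_apply, Module.End.mul_apply, ih.2]
      exact step13 ih.1
  rw [(pow13 a).2, hk]
  funext p m k
  exact finsum_eq_zero_of_forall_eq_zero fun _ => rfl

/-- Dong's lemma. -/
theorem Local.nprod_left {ε₁ ε₂ ε₃ : ℂ} {A B C : ℤ → Module.End ℂ V} (hA : IsField A)
    (hB : IsField B) (hAB : Local ε₁ A B) (hAC : Local ε₂ A C) (hBC : Local ε₃ B C) :
    Local (ε₂ * ε₃) (nprod ε₁ A B) C := by
  obtain ⟨N₁, h₁⟩ := hAB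
  obtain ⟨N₂, h₂⟩ := hAC
  obtain ⟨N₃, h₃⟩ := hBC
  set f := nprodAux ε₁ A B with hf
  set G : ℤ → ℤ → ℤ → Module.End ℂ V := fun p m k => f p m * C k - (ε₂ * ε₃) • (C k * f p m)
    with hG
  -- multiplication by a power of `z₁ - z₂`
  have hf12 : mulSub f = fun m n => A m * B n - ε₁ • (B n * A m) := by
    funext p m
    refine LinearMap.ext fun v => ?_
    simp only [mulSub, LinearMap.coe_mk, AddHom.coe_mk, LinearMap.sub_apply,
      LinearMap.smul_apply, Module.End.mul_apply]
    rw [hf, nprodAux_apply ε₁ hA hB, nprodAux_apply ε₁ hA hB]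
    have t1 := finsum_telescope (u := fun j : ℕ => A (p - j) (B (m + j) v)) (by
      have := finite1 (A := A) hB (p + 1) m v
      simpa only [add_sub_cancel_right] using this)
    have t2 := finsum_telescope (u := fun j : ℕ => B (m - j) (A (p + j) v)) (by
      have := finite2 (B := B) hA p (m + 1) v
      simpa only [add_sub_cancel_right] using this)
    have f1 := finite1 (A := A) hB (p + 1) m v
    have f2 := finite1 (A := A) hB p (m + 1) v
    have f3 := finite2 (B := B) hA (p + 1) m v
    have f4 := finite2 (B := B) hA p (m + 1) v
    have e1 := finsum_sub_distrib f1 f2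
    have e2 := finsum_sub_distrib f4 f3
    have e3 : (fun j : ℕ => A (p + 1 - 1 - j) (B (m + j) v) - A (p - 1 - j) (B (m + 1 + j) v)) =
        fun j : ℕ => A (p - j) (B (m + j) v) - A (p - (j + 1 : ℕ)) (B (m + (j + 1 : ℕ)) v) := by
      funext j
      congr 3 <;> push_cast <;> ring_nf
    have e4 : (fun j : ℕ => B (m + 1 - 1 - j) (A (p + j) v) - B (m - 1 - j) (A (p + 1 + j) v)) =
        fun j : ℕ => B (m - j) (A (p + j) v) - B (m - (j + 1 : ℕ)) (A (p + (j + 1 : ℕ)) v) := by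
      funext j
      congr 3 <;> push_cast <;> ring_nf
    rw [e3, t1] at e1
    rw [e4, t2] at e2
    simp only [Nat.cast_zero, sub_zero, add_zero] at e1 e2
    rw [e1, e2]
    module
  have hG12 : (mulSub12 ^ (N₁ + 1)) G = 0 := by
    funext p m k
    rw [mulSub12_pow]
    have := mulSub_pow_map (LinearMap.mulRight ℂ (C k) - (ε₂ * ε₃) • LinearMap.mulLeft ℂ (C k))
      (N₁ + 1) f p m
    simp only [LinearMap.sub_apply, LinearMap.smul_apply, LinearMap.mulLeft_apply,
      LinearMap.mulRight_apply] at this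
    rw [hG]
    simp only []
    rw [this, pow_succ mulSub N₁, Module.End.mul_apply, hf12, h₁]
    simp
  -- multiplication by powers of `z₁ - z₃` and `z₂ - z₃`
  have hG3 : (mulSub13 ^ N₂) ((mulSub23 ^ N₃) G) = 0 := by
    have kill : ∀ (g₁ g₂ : ℤ → ℤ → ℤ → Module.End ℂ V),
        (∀ p, (mulSub ^ N₃) (fun m k => g₁ p m k) = 0) →
        (∀ m, (mulSub ^ N₂) (fun p k => g₂ p m k) = 0) →
        (mulSub13 ^ N₂) ((mulSub23 ^ N₃) (g₁ + g₂)) = 0 := by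
      intro g₁ g₂ k₁ k₂
      have e₁ : (mulSub23 ^ N₃) g₁ = 0 := by
        funext p m k
        rw [mulSub23_pow, k₁]; rfl
      have e₂ : (mulSub13 ^ N₂) g₂ = 0 := by
        funext p m k
        rw [mulSub13_pow, k₂]; rfl
      rw [map_add, e₁, zero_add, ← Module.End.mul_apply, (commute_13_23.pow_pow N₂ N₃).eq,
        Module.End.mul_apply, e₂, map_zero]
    have kAB : (mulSub13 ^ N₂) ((mulSub23 ^ N₃) fun p m k =>
        A p * B m * C k - (ε₂ * ε₃) • (C k * (A p * B m))) = 0 := by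
      have := kill (fun p m k => LinearMap.mulLeft ℂ (A p) (B m * C k - ε₃ • (C k * B m)))
        (fun p m k => (ε₃ • LinearMap.mulRight ℂ (B m)) (A p * C k - ε₂ • (C k * A p)))
        (fun p => by funext m k; rw [mulSub_pow_map, h₃]; simp)
        (fun m => by funext p k; rw [mulSub_pow_map, h₂]; simp)
      rw [← this]
      congr 2
      funext p m k
      simp only [Pi.add_apply, LinearMap.mulLeft_apply, LinearMap.smul_apply,
        LinearMap.mulRight_apply, mul_sub, sub_mul, mul_smul_comm, smul_mul_assoc, mul_assoc]
      module
    have kBA : (mulSub13 ^ N₂) ((mulSub23 ^ N₃) fun p m k =>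
        B m * A p * C k - (ε₂ * ε₃) • (C k * (B m * A p))) = 0 := by
      have := kill (fun p m k => (ε₂ • LinearMap.mulRight ℂ (A p)) (B m * C k - ε₃ • (C k * B m)))
        (fun p m k => LinearMap.mulLeft ℂ (B m) (A p * C k - ε₂ • (C k * A p)))
        (fun p => by funext m k; rw [mulSub_pow_map, h₃]; simp)
        (fun m => by funext p k; rw [mulSub_pow_map, h₂]; simp)
      rw [← this]
      congr 2
      funext p m k
      simp only [Pi.add_apply, LinearMap.mulLeft_apply, LinearMap.smul_apply,
        LinearMap.mulRight_apply, mul_sub, sub_mul, mul_smul_comm, smul_mul_assoc, mul_assoc]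
      module
    have evalAt : ∀ (v : V) (g : ℤ → ℤ → ℤ → Module.End ℂ V),
        (mulSub13 ^ N₂) ((mulSub23 ^ N₃) fun p m k => g p m k v) =
          fun p m k => (mulSub13 ^ N₂) ((mulSub23 ^ N₃) g) p m k v := by
      intro v g
      funext p m k
      have i1 : (mulSub23 ^ N₃) (fun p m k => g p m k v) =
          fun p m k => (mulSub23 ^ N₃) g p m k v := by
        funext p m k
        rw [mulSub23_pow, mulSub23_pow]
        exact mulSub_pow_map (LinearMap.applyₗ v) N₃ (fun m k => g p m k) m k
      rw [i1, mulSub13_pow, mulSub13_pow]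
      exact mulSub_pow_map (LinearMap.applyₗ v) N₂ (fun p k => (mulSub23 ^ N₃) g p m k) p k
    have hv : ∀ v : V, (mulSub13 ^ N₂) ((mulSub23 ^ N₃) fun p m k => G p m k v) = 0 := by
      intro v
      have zAB := evalAt v fun p m k => A p * B m * C k - (ε₂ * ε₃) • (C k * (A p * B m))
      have zBA := evalAt v fun p m k => B m * A p * C k - (ε₂ * ε₃) • (C k * (B m * A p))
      rw [kAB] at zAB
      rw [kBA] at zBA
      have f1 : ∀ p m k : ℤ, (Function.support fun j : ℕ =>
          (A (p + -1 + -1 * j) * B (m + 0 + 1 * j) * C k -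
            (ε₂ * ε₃) • (C k * (A (p + -1 + -1 * j) * B (m + 0 + 1 * j)))) v).Finite := by
        intro p m k
        obtain ⟨N, hN⟩ := hB v
        obtain ⟨M, hM⟩ := hB (C k v)
        refine finite_supp (max N M - m) fun j hj => ?_
        simp only [LinearMap.sub_apply, LinearMap.smul_apply, Module.End.mul_apply]
        rw [hN _ (by omega), hM _ (by omega)]
        simp
      have f2 : ∀ p m k : ℤ, (Function.support fun j : ℕ =>
          (B (m + -1 + -1 * j) * A (p + 0 + 1 * j) * C k -
            (ε₂ * ε₃) • (C k * (B (m + -1 + -1 * j) * A (p + 0 + 1 * j)))) v).Finite := by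
        intro p m k
        obtain ⟨N, hN⟩ := hA v
        obtain ⟨M, hM⟩ := hA (C k v)
        refine finite_supp (max N M - p) fun j hj => ?_
        simp only [LinearMap.sub_apply, LinearMap.smul_apply, Module.End.mul_apply]
        rw [hN _ (by omega), hM _ (by omega)]
        simp
      have s1 := diag_sum_kill (-1) 0 (-1) 1 f1 (zAB.trans rfl)
      have s2 := diag_sum_kill 0 (-1) 1 (-1) f2 (zBA.trans rfl)
      have e : (fun p m k => G p m k v) =
          (fun p m k => ∑ᶠ j : ℕ, (A (p + -1 + -1 * j) * B (m + 0 + 1 * j) * C k -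
            (ε₂ * ε₃) • (C k * (A (p + -1 + -1 * j) * B (m + 0 + 1 * j)))) v) +
          ε₁ • (fun p m k => ∑ᶠ j : ℕ, (B (m + -1 + -1 * j) * A (p + 0 + 1 * j) * C k -
            (ε₂ * ε₃) • (C k * (B (m + -1 + -1 * j) * A (p + 0 + 1 * j)))) v) := by
        funext p m k
        simp only [hG, hf, LinearMap.sub_apply, LinearMap.smul_apply, Module.End.mul_apply,
          nprodAux_apply ε₁ hA hB, Pi.add_apply, Pi.smul_apply, map_add, map_smul]
        have i1 : ∀ j : ℕ, p + -1 + -1 * (j : ℤ) = p - 1 - j := fun j => by ring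
        have i2 : ∀ j : ℕ, m + 0 + 1 * (j : ℤ) = m + j := fun j => by ring
        have i3 : ∀ j : ℕ, m + -1 + -1 * (j : ℤ) = m - 1 - j := fun j => by ring
        have i4 : ∀ j : ℕ, p + 0 + 1 * (j : ℤ) = p + j := fun j => by ring
        simp only [i1, i2, i3, i4]
        have g1 := finite1 (A := A) hB p m v
        have g2 := finite2 (B := B) hA p m v
        have g3 := finite1 (A := A) hB p m (C k v)
        have g4 := finite2 (B := B) hA p m (C k v)
        have g1' : (Function.support fun j : ℕ => C k (A (p - 1 - j) (B (m + j) v))).Finite :=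
          g1.subset (Function.support_comp_subset (map_zero (C k)) _)
        have g2' : (Function.support fun j : ℕ => C k (B (m - 1 - j) (A (p + j) v))).Finite :=
          g2.subset (Function.support_comp_subset (map_zero (C k)) _)
        rw [finsum_sub_distrib g3 (finite_smul g1' fun _ => ε₂ * ε₃),
          finsum_sub_distrib g4 (finite_smul g2' fun _ => ε₂ * ε₃)]
        have m1 := (C k).toAddMonoidHom.map_finsum g1
        have m2 := (C k).toAddMonoidHom.map_finsum g2
        simp only [LinearMap.toAddMonoidHom_coe] at m1 m2
        have n1 := smul_finsum' (ε₂ * ε₃) g1'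
        have n2 := smul_finsum' (ε₂ * ε₃) g2'
        rw [m1, m2, ← n1, ← n2]
        module
      rw [e, map_add, map_add, map_smul, map_smul, s1, s2, smul_zero, add_zero]
    funext p m k
    refine LinearMap.ext fun v => ?_
    have := congrFun (congrFun (congrFun (hv v) p) m) k
    rw [evalAt] at this
    exact this
  refine ⟨N₂ + (N₁ + 1) + N₃, ?_⟩
  have h23 : (mulSub23 : Module.End ℂ (ℤ → ℤ → ℤ → Module.End ℂ V)) = mulSub13 - mulSub12 := by
    refine LinearMap.ext fun g => ?_
    funext p m k
    simp only [mulSub12, mulSub13, mulSub23, LinearMap.coe_mk, AddHom.coe_mk, LinearMap.sub_apply,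
      Pi.sub_apply]
    abel
  have key : (mulSub23 ^ (N₂ + (N₁ + 1) + N₃)) G = 0 := by
    rw [pow_add, Module.End.mul_apply, h23]
    refine pow_sub_kill commute_13_12 _ _ _ ?_ ?_
    · rw [← h23]
      exact hG3
    · rw [← h23, ← Module.End.mul_apply, (commute_12_23.pow_pow (N₁ + 1) N₃).eq,
        Module.End.mul_apply, hG12, map_zero]
  funext m k
  have := congrFun (congrFun (congrFun key 0) m) k
  rw [mulSub23_pow] at this
  exact this


/-- A vertex superalgebra structure on the complex vector space `V`: vacuum vector, `ℤ/2`-grading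
(recorded by its parity involution, which is `1` on the even and `-1` on the odd part) and
state-field correspondence `a ↦ Y(a,z) = ∑ a_(n) z^(-n-1)`, `a_(n) = mode a n`.
The translation operator is `a ↦ a_(-2) 1`. -/
structure VertexSuperalgebra (V : Type*) [AddCommGroup V] [Module ℂ V] where
  /-- the vacuum vector -/
  vac : V
  /-- the parity involution -/
  parity : V →ₗ[ℂ] V
  /-- the modes `a_(n)` -/
  mode : V →ₗ[ℂ] (ℤ → Module.End ℂ V)
  parity_parity : ∀ a, parity (parity a) = a
  parity_vac : parity vac = vac
  parity_mode : ∀ a n b, parity (mode a n b) = mode (parity a) n (parity b)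
  truncation : ∀ a, IsField (mode a)
  vac_mode : ∀ n b, mode vac n b = if n = -1 then b else 0
  mode_vac : ∀ a n, 0 ≤ n → mode a n vac = 0
  mode_neg_one_vac : ∀ a, mode a (-1) vac = a
  translation : ∀ a n b, mode (mode a n b) (-2) vac - mode a n (mode b (-2) vac) =
    (-n : ℂ) • mode a (n - 1) b
  locality : ∀ (a b : V) (p q : ℕ), parity a = (-1 : ℂ) ^ p • a → parity b = (-1 : ℂ) ^ q • b →
    Local ((-1) ^ (p * q)) (mode a) (mode b)

/-! ### The vertex superalgebra generated by mutually local fields -/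

/-- A family of mutually local, translation covariant fields `x i` of parity `par i` which generate
`V` from the vacuum vector. -/
structure GeneratingFields (V : Type*) [AddCommGroup V] [Module ℂ V] where
  /-- index set of the fields -/
  ι : Type
  /-- parity of each field -/
  par : ι → ℕ
  /-- the modes of each field -/
  x : ι → ℤ → Module.End ℂ V
  /-- the vacuum vector -/
  vac : V
  /-- the parity involution -/
  parity : V →ₗ[ℂ] V
  /-- the translation operator -/
  T : V →ₗ[ℂ] V
  isField : ∀ i, IsField (x i)
  isLocal : ∀ i j, Local ((-1) ^ (par i * par j)) (x i) (x j)
  parity_parity : ∀ v, parity (parity v) = v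
  parity_vac : parity vac = vac
  parity_x : ∀ i n v, parity (x i n v) = (-1 : ℂ) ^ par i • x i n (parity v)
  T_vac : T vac = 0
  T_x : ∀ i n v, T (x i n v) - x i n (T v) = (-n : ℂ) • x i (n - 1) v
  x_vac : ∀ i n, 0 ≤ n → x i n vac = 0
  generates : ∀ S : Submodule ℂ V, vac ∈ S → (∀ i n v, n < 0 → v ∈ S → x i n v ∈ S) → S = ⊤

namespace GeneratingFields

variable (G : GeneratingFields V)

/-- A translation covariant field of parity `p` that creates a vector from the vacuum. -/
structure Nice (p : ℕ) (A : ℤ → Module.End ℂ V) : Prop where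
  field : IsField A
  par : ∀ n v, G.parity (A n v) = (-1 : ℂ) ^ p • A n (G.parity v)
  trans : ∀ n v, G.T (A n v) - A n (G.T v) = (-n : ℂ) • A (n - 1) v
  creat : ∀ n, 0 ≤ n → A n G.vac = 0

/-- The identity field. -/
def idField (V : Type*) [AddCommGroup V] [Module ℂ V] (n : ℤ) : Module.End ℂ V :=
  if n = -1 then 1 else 0

/-- Derivatives of the generating fields. -/
def dx (i : G.ι) (k : ℕ) : ℤ → Module.End ℂ V := fieldDeriv^[k] (G.x i)

/-- The iterated normally ordered products of derivatives of the generating fields. -/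
inductive Gen : ℕ → (ℤ → Module.End ℂ V) → Prop
  | one : Gen 0 (idField V)
  | nprod (i : G.ι) (k : ℕ) (p : ℕ) (B : ℤ → Module.End ℂ V) : Gen p B →
      Gen (G.par i + p) (nprod ((-1) ^ (G.par i * p)) (G.dx i k) B)

theorem nice_deriv {p : ℕ} {A : ℤ → Module.End ℂ V} (h : G.Nice p A) :
    G.Nice p (fieldDeriv A) where
  field := isField_deriv h.field
  par n v := by
    simp only [fieldDeriv, LinearMap.smul_apply, map_smul, h.par]
    module
  trans n v := by
    have := h.trans (n - 1) v
    simp only [fieldDeriv, LinearMap.smul_apply, map_smul]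
    rw [← smul_sub, this]
  creat n hn := by
    rw [fieldDeriv, LinearMap.smul_apply]
    rcases eq_or_lt_of_le hn with rfl | hn
    · simp
    · rw [h.creat _ (by omega), smul_zero]

theorem nice_dx (i : G.ι) (k : ℕ) : G.Nice (G.par i) (G.dx i k) := by
  induction k with
  | zero => exact ⟨G.isField i, G.parity_x i, G.T_x i, G.x_vac i⟩
  | succ k ih =>
    rw [dx, Function.iterate_succ', Function.comp_apply]
    exact G.nice_deriv ih

theorem nice_one : G.Nice 0 (idField V) where
  field v := ⟨0, fun n hn => by rw [idField, if_neg (by omega)]; rfl⟩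
  par n v := by
    by_cases h : n = -1 <;> simp [idField, h]
  trans n v := by
    by_cases h : n = -1
    · subst h
      simp [idField]
    · by_cases h0 : n = 0
      · subst h0
        simp [idField]
      · simp [idField, h, show n - 1 ≠ -1 by omega]
  creat n hn := by rw [idField, if_neg (by omega)]; rfl

theorem nice_nprod {p q : ℕ} {A B : ℤ → Module.End ℂ V} (hA : G.Nice p A) (hB : G.Nice q B)
    (ε : ℂ) : G.Nice (p + q) (nprod ε A B) where
  field := isField_nprod ε hA.field hB.field
  par n v := by
    rw [nprod, nprodAux_apply ε hA.field hB.field, nprodAux_apply ε hA.field hB.field, map_add,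
      map_smul]
    have m1 := G.parity.toAddMonoidHom.map_finsum (finite1 (A := A) hB.field 0 n v)
    have m2 := G.parity.toAddMonoidHom.map_finsum (finite2 (B := B) hA.field 0 n v)
    simp only [LinearMap.toAddMonoidHom_coe] at m1 m2
    rw [m1, m2]
    simp only [hA.par, hB.par, map_smul, smul_smul]
    rw [← smul_finsum' _ (finite1 hB.field 0 n _), ← smul_finsum' _ (finite2 hA.field 0 n _),
      pow_add]
    module
  trans n v := by
    rw [nprod, nprod, nprodAux_apply ε hA.field hB.field, nprodAux_apply ε hA.field hB.field,
      nprodAux_apply ε hA.field hB.field, map_add, map_smul]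
    have g1 := finite1 (A := A) hB.field 0 n v
    have g2 := finite2 (B := B) hA.field 0 n v
    have g3 := finite1 (A := A) hB.field 0 n (G.T v)
    have g4 := finite2 (B := B) hA.field 0 n (G.T v)
    have g5 := finite1 (A := A) hB.field 0 (n - 1) v
    have g6 := finite2 (B := B) hA.field 0 (n - 1) v
    have g1' : (Function.support fun j : ℕ => G.T (A (0 - 1 - j) (B (n + j) v))).Finite :=
      g1.subset (Function.support_comp_subset (map_zero G.T) _)
    have g2' : (Function.support fun j : ℕ => G.T (B (n - 1 - j) (A (0 + j) v))).Finite :=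
      g2.subset (Function.support_comp_subset (map_zero G.T) _)
    have m1 := G.T.toAddMonoidHom.map_finsum g1
    have m2 := G.T.toAddMonoidHom.map_finsum g2
    simp only [LinearMap.toAddMonoidHom_coe] at m1 m2
    have u1 := finsum_telescope (finite_smul g5 fun j => (j : ℂ))
    have fu2 : (Function.support fun j : ℕ => (j : ℂ) • B (n - 1 - j) (A (0 + j - 1) v)).Finite := by
      have h := finite2 (B := B) hA.field (-1) n v
      refine (finite_smul h fun j => (j : ℂ)).subset (Eq.subset ?_)
      congr 1
      funext j
      rw [show (0 : ℤ) + j - 1 = -1 + j by ring]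
    have u2 := finsum_telescope fu2
    have fu1 := finite_smul g5 fun j => (j : ℂ)
    have d1 : ∀ j : ℕ, G.T (A (0 - 1 - j) (B (n + j) v)) - A (0 - 1 - j) (B (n + j) (G.T v)) =
        (-n : ℂ) • A (0 - 1 - j) (B (n - 1 + j) v) -
        ((j : ℂ) • A (0 - 1 - j) (B (n - 1 + j) v) - ((j + 1 : ℕ) : ℂ) •
          A (0 - 1 - (j + 1 : ℕ)) (B (n - 1 + (j + 1 : ℕ)) v)) := by
      intro j
      have e1 := hA.trans (0 - 1 - j) (B (n + j) v)
      have e2 := congrArg (A (0 - 1 - j)) (hB.trans (n + j) v)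
      rw [map_sub, map_smul] at e2
      rw [show (0 : ℤ) - 1 - (j + 1 : ℕ) = 0 - 1 - j - 1 by push_cast; ring,
        show n - 1 + ((j + 1 : ℕ) : ℤ) = n + j by push_cast; ring,
        show n - 1 + (j : ℤ) = n + j - 1 by ring, ← sub_add_sub_cancel, e1, e2]
      push_cast
      module
    have d2 : ∀ j : ℕ, G.T (B (n - 1 - j) (A (0 + j) v)) - B (n - 1 - j) (A (0 + j) (G.T v)) =
        (-n : ℂ) • B (n - 1 - 1 - j) (A (0 + j) v) -
        ((j : ℂ) • B (n - 1 - j) (A (0 + j - 1) v) - ((j + 1 : ℕ) : ℂ) •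
          B (n - 1 - (j + 1 : ℕ)) (A (0 + (j + 1 : ℕ) - 1) v)) := by
      intro j
      have e1 := hB.trans (n - 1 - j) (A (0 + j) v)
      have e2 := congrArg (B (n - 1 - j)) (hA.trans (0 + j) v)
      rw [map_sub, map_smul] at e2
      rw [show n - 1 - ((j + 1 : ℕ) : ℤ) = n - 1 - j - 1 by push_cast; ring,
        show (0 : ℤ) + ((j + 1 : ℕ) : ℤ) - 1 = 0 + j by push_cast; ring,
        show n - 1 - 1 - (j : ℤ) = n - 1 - j - 1 by ring, ← sub_add_sub_cancel, e1, e2]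
      push_cast
      module
    have c1 := finsum_congr d1
    have c2 := finsum_congr d2
    have shiftfin : ∀ {u : ℕ → V}, (Function.support u).Finite →
        (Function.support fun j => u j - u (j + 1)).Finite := fun {u} hu =>
      (hu.union (hu.preimage (f := fun j => j + 1)
        (fun a _ b _ hab => by simpa using hab))).subset (Function.support_sub _ _)
    rw [finsum_sub_distrib g1' g3, finsum_sub_distrib (finite_smul g5 fun _ => (-n : ℂ))
      (shiftfin fu1), u1, ← smul_finsum' _ g5] at c1
    rw [finsum_sub_distrib g2' g4, finsum_sub_distrib (finite_smul g6 fun _ => (-n : ℂ))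
      (shiftfin fu2), u2, ← smul_finsum' _ g6] at c2
    simp only [Nat.cast_zero, zero_smul, sub_zero] at c1 c2
    rw [m1, m2, smul_add, smul_comm _ ε, ← c1, ← c2]
    module
  creat n hn := by
    rw [nprod, nprodAux_apply ε hA.field hB.field, finsum_eq_zero_of_forall_eq_zero,
      finsum_eq_zero_of_forall_eq_zero, smul_zero, zero_add]
    · intro j
      rw [hA.creat _ (by omega), map_zero]
    · intro j
      rw [hB.creat _ (by omega), map_zero]

theorem nprod_vac {p q : ℕ} {A B : ℤ → Module.End ℂ V} (hA : G.Nice p A) (hB : G.Nice q B)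
    (ε : ℂ) : nprod ε A B (-1) G.vac = A (-1) (B (-1) G.vac) := by
  rw [nprod, nprodAux_apply ε hA.field hB.field, finsum_eq_single _ 0,
    finsum_eq_zero_of_forall_eq_zero]
  · simp
  · intro j
    rw [hA.creat _ (by omega), map_zero]
  · intro j hj
    rw [hB.creat _ (by omega), map_zero]

theorem Gen.nice {p : ℕ} {A : ℤ → Module.End ℂ V} (h : G.Gen p A) : G.Nice p A := by
  induction h with
  | one => exact G.nice_one
  | nprod i k p B _ ih => exact G.nice_nprod (G.nice_dx i k) ih _

theorem sign_sq (n : ℕ) : ((-1 : ℂ) ^ n) * (-1) ^ n = 1 := by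
  rw [← mul_pow]
  simp

theorem local_dx (i j : G.ι) (k l : ℕ) :
    Local ((-1) ^ (G.par i * G.par j)) (G.dx i k) (G.dx j l) := by
  have h1 : ∀ (i j : G.ι) (k : ℕ), Local ((-1) ^ (G.par i * G.par j)) (G.dx i k) (G.x j) := by
    intro i j k
    induction k with
    | zero => exact G.isLocal i j
    | succ k ih =>
      rw [dx, Function.iterate_succ', Function.comp_apply]
      exact ih.deriv_left
  induction k with
  | zero =>
    have := (h1 j i l).symm (sign_sq _)
    rwa [mul_comm] at this
  | succ k ih =>
    rw [dx, Function.iterate_succ', Function.comp_apply]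
    exact ih.deriv_left

theorem local_one (C : ℤ → Module.End ℂ V) : Local 1 (idField V) C := by
  refine ⟨0, ?_⟩
  funext m n
  by_cases h : m = -1 <;> simp [idField, h]

theorem Gen.local_dx {p : ℕ} {B : ℤ → Module.End ℂ V} (h : G.Gen p B) (i : G.ι) (k : ℕ) :
    Local ((-1) ^ (p * G.par i)) B (G.dx i k) := by
  induction h generalizing i k with
  | one => simpa using local_one _
  | nprod j l p B hB ih =>
    rw [add_mul, pow_add]
    refine Local.nprod_left (G.nice_dx j l).field hB.nice.field ?_ (G.local_dx j i l k) (ih i k)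
    have := (ih j l).symm (sign_sq _)
    rwa [mul_comm] at this

theorem Gen.isLocal {p q : ℕ} {A B : ℤ → Module.End ℂ V} (hA : G.Gen p A) (hB : G.Gen q B) :
    Local ((-1) ^ (p * q)) A B := by
  induction hA with
  | one => simpa using local_one _
  | nprod j l p A hA ih =>
    rw [add_mul, pow_add]
    refine Local.nprod_left (G.nice_dx j l).field hA.nice.field ?_ ?_ ih
    · have := (hA.local_dx G j l).symm (sign_sq _)
      rwa [mul_comm] at this
    · have := (hB.local_dx G j l).symm (sign_sq _)
      rwa [mul_comm] at this

/-- The linear span of the iterated normally ordered products. -/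
def fields : Submodule ℂ (ℤ → Module.End ℂ V) := Submodule.span ℂ {A | ∃ p, G.Gen p A}

/-- The vector that a field creates from the vacuum. -/
def ev : (ℤ → Module.End ℂ V) →ₗ[ℂ] V where
  toFun A := A (-1) G.vac
  map_add' _ _ := rfl
  map_smul' _ _ := rfl

theorem dx_neg_one (A : ℤ → Module.End ℂ V) (k : ℕ) :
    fieldDeriv^[k] A (-1) = (k.factorial : ℂ) • A (-1 - k) := by
  induction k generalizing A with
  | zero => simp
  | succ k ih =>
    rw [Function.iterate_succ, Function.comp_apply, ih, fieldDeriv, smul_smul,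
      show (-1 - ((k + 1 : ℕ) : ℤ)) = -1 - k - 1 by push_cast; ring]
    congr 1
    rw [Nat.factorial_succ]
    push_cast
    ring

theorem map_ev_fields : Submodule.map G.ev G.fields = ⊤ := by
  refine G.generates _ ⟨idField V, Submodule.subset_span ⟨0, .one⟩, by simp [ev, idField]⟩ ?_
  rintro i n _ hn ⟨A, hA, rfl⟩
  obtain ⟨k, rfl⟩ : ∃ k : ℕ, n = -1 - k := ⟨(-1 - n).toNat, by omega⟩
  induction hA using Submodule.span_induction with
  | mem A hA =>
    obtain ⟨p, hA⟩ := hA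
    have h1 : G.ev (nprod ((-1) ^ (G.par i * p)) (G.dx i k) A) =
        (k.factorial : ℂ) • G.x i (-1 - k) (G.ev A) := by
      have := G.nprod_vac (G.nice_dx i k) hA.nice ((-1) ^ (G.par i * p))
      rw [dx, dx_neg_one] at this
      exact this
    have h2 : G.x i (-1 - k) (G.ev A) = (k.factorial : ℂ)⁻¹ •
        G.ev (nprod ((-1) ^ (G.par i * p)) (G.dx i k) A) := by
      rw [h1, smul_smul, inv_mul_cancel₀ (Nat.cast_ne_zero.2 k.factorial_ne_zero), one_smul]
    rw [h2]
    exact Submodule.smul_mem _ _ ⟨_, Submodule.subset_span ⟨_, hA.nprod i k p A⟩, rfl⟩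
  | zero => simp
  | add A B _ _ hA hB =>
    rw [map_add, map_add]
    exact Submodule.add_mem _ hA hB
  | smul c A _ hA =>
    rw [map_smul, map_smul]
    exact Submodule.smul_mem _ _ hA

theorem fields_trans {A : ℤ → Module.End ℂ V} (hA : A ∈ G.fields) (n : ℤ) (v : V) :
    G.T (A n v) - A n (G.T v) = (-n : ℂ) • A (n - 1) v := by
  induction hA using Submodule.span_induction with
  | mem A hA => exact hA.choose_spec.nice.trans n v
  | zero => simp
  | add A B _ _ hA hB =>
    simp only [Pi.add_apply, LinearMap.add_apply, map_add, smul_add, ← hA, ← hB]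
    abel
  | smul c A _ hA =>
    simp only [Pi.smul_apply, LinearMap.smul_apply, map_smul]
    rw [← smul_sub, hA]
    module

theorem fields_creat {A : ℤ → Module.End ℂ V} (hA : A ∈ G.fields) (n : ℤ) (hn : 0 ≤ n) :
    A n G.vac = 0 := by
  induction hA using Submodule.span_induction with
  | mem A hA => exact hA.choose_spec.nice.creat n hn
  | zero => simp
  | add A B _ _ hA hB => simp [hA, hB]
  | smul c A _ hA => simp [hA]

theorem fields_isField {A : ℤ → Module.End ℂ V} (hA : A ∈ G.fields) : IsField A := by
  intro v
  induction hA using Submodule.span_induction with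
  | mem A hA => exact hA.choose_spec.nice.field v
  | zero => exact ⟨0, fun _ _ => rfl⟩
  | add A B _ _ hA hB =>
    obtain ⟨N, hN⟩ := hA
    obtain ⟨M, hM⟩ := hB
    refine ⟨max N M, fun n hn => ?_⟩
    rw [Pi.add_apply, LinearMap.add_apply, hN n (by omega), hM n (by omega), add_zero]
  | smul c A _ hA =>
    obtain ⟨N, hN⟩ := hA
    refine ⟨N, fun n hn => ?_⟩
    rw [Pi.smul_apply, LinearMap.smul_apply, hN n hn, smul_zero]

theorem parity_pow_vec (p q : ℕ) (v : V) (h : G.parity v = (-1 : ℂ) ^ p • v) :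
    (G.parity ^ q) v = (-1 : ℂ) ^ (p * q) • v := by
  induction q with
  | zero => simp
  | succ q ih =>
    rw [pow_succ', Module.End.mul_apply, ih, map_smul, h, smul_smul, mul_add, mul_one, pow_add]

theorem fields_local_vac {q : ℕ} {A B : ℤ → Module.End ℂ V} (hA : A ∈ G.fields)
    (hB : G.Gen q B) : ∃ N : ℕ, (mulSub ^ N)
      (fun m n => A m (B n G.vac) - B n ((G.parity ^ q) (A m G.vac))) = 0 := by
  induction hA using Submodule.span_induction with
  | mem A hA =>
    obtain ⟨p, hA⟩ := hA
    obtain ⟨N, hN⟩ := hA.isLocal G hB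
    refine ⟨N, ?_⟩
    have e : (fun m n => A m (B n G.vac) - B n ((G.parity ^ q) (A m G.vac))) = fun m n =>
        LinearMap.applyₗ G.vac (A m * B n - ((-1 : ℂ) ^ (p * q)) • (B n * A m)) := by
      funext m n
      rw [G.parity_pow_vec p q (A m G.vac) (by rw [hA.nice.par, G.parity_vac])]
      simp
    funext m n
    rw [e, mulSub_pow_map, hN]
    simp
  | zero => exact ⟨0, by funext m n; simp⟩
  | add A A' _ _ h h' =>
    obtain ⟨N, hN⟩ := h
    obtain ⟨M, hM⟩ := h'
    refine ⟨max N M, ?_⟩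
    rw [← add_zero (0 : ℤ → ℤ → V)]
    nth_rewrite 1 [← mulSub_pow_mono (le_max_left N M) hN]
    rw [← mulSub_pow_mono (le_max_right N M) hM, ← map_add]
    congr 1
    funext m n
    simp only [Pi.add_apply, LinearMap.add_apply, map_add]
    abel
  | smul c A _ h =>
    obtain ⟨N, hN⟩ := h
    refine ⟨N, ?_⟩
    rw [← smul_zero c, ← hN, ← map_smul]
    congr 1
    funext m n
    simp only [Pi.smul_apply, LinearMap.smul_apply, map_smul, smul_sub]

theorem mulSub_pow_edge (N : ℕ) (g : ℤ → ℤ → E) (hg : ∀ m n, 0 ≤ n → g m n = 0) (m : ℤ) :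
    (mulSub ^ N) g m (-1) = g (m + N) (-1) := by
  induction N generalizing g with
  | zero => simp
  | succ N ih =>
    rw [pow_succ, Module.End.mul_apply, ih]
    · simp only [mulSub, LinearMap.coe_mk, AddHom.coe_mk]
      rw [hg _ (-1 + 1) (by omega), sub_zero]
      congr 1
      push_cast
      ring
    · intro m n hn
      simp only [mulSub, LinearMap.coe_mk, AddHom.coe_mk]
      rw [hg _ _ hn, hg _ _ (by omega), sub_zero]

/-- A field in the span that creates the zero vector is zero. -/
theorem fields_unique {A : ℤ → Module.End ℂ V} (hA : A ∈ G.fields) (h : G.ev A = 0) : A = 0 := by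
  have hz : ∀ n, A n G.vac = 0 := by
    intro n
    rcases le_or_gt 0 n with hn | hn
    · exact G.fields_creat hA n hn
    · obtain ⟨k, rfl⟩ : ∃ k : ℕ, n = -1 - k := ⟨(-1 - n).toNat, by omega⟩
      clear hn
      induction k with
      | zero => simpa [ev] using h
      | succ k ih =>
        have := G.fields_trans hA (-1 - k) G.vac
        rw [ih, G.T_vac, map_zero, map_zero, sub_zero] at this
        have h2 := (smul_eq_zero.1 this.symm).resolve_left (by
          rw [neg_eq_zero, Int.cast_eq_zero]
          omega)
        rw [← h2]
        congr 2
        push_cast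
        ring
  have hker : ∀ v, ∀ m, A m v = 0 := by
    intro v
    have hv : v ∈ Submodule.map G.ev G.fields := by rw [map_ev_fields]; trivial
    obtain ⟨B, hB, rfl⟩ := hv
    induction hB using Submodule.span_induction with
    | mem B hB =>
      obtain ⟨q, hB⟩ := hB
      obtain ⟨N, hN⟩ := G.fields_local_vac hA hB
      simp only [hz, map_zero, sub_zero] at hN
      intro m
      have := mulSub_pow_edge N (fun m n => A m (B n G.vac))
        (fun m n hn => by rw [hB.nice.creat n hn, map_zero]) (m - N)
      rw [hN, sub_add_cancel] at this
      exact this.symm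
    | zero => simp
    | add B B' _ _ h h' =>
      intro m
      rw [map_add, map_add, h, h', add_zero]
    | smul c B _ h =>
      intro m
      rw [map_smul, map_smul, h, smul_zero]
  funext m
  exact LinearMap.ext fun v => hker v m

/-- The field-state correspondence. -/
def fieldEquiv : G.fields ≃ₗ[ℂ] V :=
  LinearEquiv.ofBijective (G.ev.comp G.fields.subtype) (by
    refine ⟨(injective_iff_map_eq_zero _).2 fun A hA => ?_, fun v => ?_⟩
    · exact Subtype.ext (G.fields_unique A.2 hA)
    · have hv : v ∈ Submodule.map G.ev G.fields := by rw [map_ev_fields]; trivial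
      obtain ⟨B, hB, rfl⟩ := hv
      exact ⟨⟨B, hB⟩, rfl⟩)

/-- The state-field correspondence: `Y a` is the unique field in the span of iterated normally
ordered products which creates `a` from the vacuum. -/
def Y : V →ₗ[ℂ] (ℤ → Module.End ℂ V) := G.fields.subtype.comp G.fieldEquiv.symm.toLinearMap

theorem Y_mem (a : V) : G.Y a ∈ G.fields := (G.fieldEquiv.symm a).2

theorem Y_vac (a : V) : G.Y a (-1) G.vac = a := G.fieldEquiv.apply_symm_apply a

theorem Y_eq {A : ℤ → Module.End ℂ V} (hA : A ∈ G.fields) : G.Y (A (-1) G.vac) = A := by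
  have := G.fieldEquiv.symm_apply_apply ⟨A, hA⟩
  exact congrArg Subtype.val this

/-- Conjugation of a field by the parity involution. -/
def conj : (ℤ → Module.End ℂ V) →ₗ[ℂ] (ℤ → Module.End ℂ V) where
  toFun A n := G.parity * A n * G.parity
  map_add' A B := by
    funext n
    simp only [Pi.add_apply, mul_add, add_mul]
  map_smul' c A := by
    funext n
    simp only [Pi.smul_apply, RingHom.id_apply, mul_smul_comm, smul_mul_assoc]

theorem Gen.conj {p : ℕ} {A : ℤ → Module.End ℂ V} (h : G.Gen p A) :
    G.conj A = (-1 : ℂ) ^ p • A := by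
  funext n
  refine LinearMap.ext fun v => ?_
  simp only [GeneratingFields.conj, LinearMap.coe_mk, AddHom.coe_mk, Module.End.mul_apply,
    Pi.smul_apply, LinearMap.smul_apply]
  rw [h.nice.par, G.parity_parity]

theorem conj_mem {A : ℤ → Module.End ℂ V} (hA : A ∈ G.fields) : G.conj A ∈ G.fields := by
  induction hA using Submodule.span_induction with
  | mem A hA =>
    obtain ⟨p, hA⟩ := hA
    rw [hA.conj]
    exact Submodule.smul_mem _ _ (Submodule.subset_span ⟨p, hA⟩)
  | zero => simp
  | add A B _ _ hA hB =>
    rw [map_add]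
    exact Submodule.add_mem _ hA hB
  | smul c A _ hA =>
    rw [map_smul]
    exact Submodule.smul_mem _ _ hA

theorem Y_parity (a : V) : G.Y (G.parity a) = G.conj (G.Y a) := by
  have := G.Y_eq (G.conj_mem (G.Y_mem a))
  rw [← this]
  congr 1
  simp only [conj, LinearMap.coe_mk, AddHom.coe_mk, Module.End.mul_apply, G.parity_vac, G.Y_vac]

/-- The span of the iterated normally ordered products of parity `p` mod 2. -/
def fieldsPar (p : ℕ) : Submodule ℂ (ℤ → Module.End ℂ V) :=
  Submodule.span ℂ {A | ∃ q, (-1 : ℂ) ^ q = (-1) ^ p ∧ G.Gen q A}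

theorem mem_fieldsPar {p : ℕ} {A : ℤ → Module.End ℂ V} (hA : A ∈ G.fields)
    (h : G.conj A = (-1 : ℂ) ^ p • A) : A ∈ G.fieldsPar p := by
  have key : A + (-1 : ℂ) ^ p • G.conj A ∈ G.fieldsPar p := by
    clear h
    induction hA using Submodule.span_induction with
    | mem A hA =>
      obtain ⟨q, hA⟩ := hA
      rw [hA.conj]
      by_cases hq : (-1 : ℂ) ^ q = (-1) ^ p
      · have hm : A ∈ G.fieldsPar p := Submodule.subset_span ⟨q, hq, hA⟩
        exact Submodule.add_mem _ hm (Submodule.smul_mem _ _ (Submodule.smul_mem _ _ hm))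
      · have : ((-1 : ℂ) ^ p) * (-1) ^ q = -1 := by
          rcases neg_one_pow_eq_or ℂ p with hp | hp <;> rcases neg_one_pow_eq_or ℂ q with hq' | hq'
            <;> rw [hp, hq'] at hq ⊢ <;> simp at hq ⊢
        rw [smul_smul, this, neg_one_smul, add_neg_cancel]
        exact Submodule.zero_mem _
    | zero => simp
    | add A B _ _ hA hB =>
      rw [map_add, smul_add, add_add_add_comm]
      exact Submodule.add_mem _ hA hB
    | smul c A _ hA =>
      rw [map_smul, smul_comm, ← smul_add]
      exact Submodule.smul_mem _ _ hA
  rw [h, smul_smul, sign_sq, one_smul, ← two_smul ℂ] at key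
  have := Submodule.smul_mem _ (2⁻¹ : ℂ) key
  rwa [smul_smul, inv_mul_cancel₀ two_ne_zero, one_smul] at this

theorem sign_mul {p q p' q' : ℕ} (hp : (-1 : ℂ) ^ p' = (-1) ^ p) (hq : (-1 : ℂ) ^ q' = (-1) ^ q) :
    (-1 : ℂ) ^ (p' * q') = (-1) ^ (p * q) := by
  rw [pow_mul, hp, ← pow_mul, mul_comm, pow_mul, hq, ← pow_mul, mul_comm]

theorem local_of_fieldsPar {p q : ℕ} {A B : ℤ → Module.End ℂ V} (hA : A ∈ G.fieldsPar p)
    (hB : B ∈ G.fieldsPar q) : Local ((-1) ^ (p * q)) A B := by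
  induction hA using Submodule.span_induction with
  | mem A hA =>
    obtain ⟨p', hp, hA⟩ := hA
    refine Local.symm (sign_sq _) ?_
    induction hB using Submodule.span_induction with
    | mem B hB =>
      obtain ⟨q', hq, hB⟩ := hB
      have := (hA.isLocal G hB).symm (sign_sq _)
      rwa [sign_mul hp hq] at this
    | zero => exact Local.zero_left
    | add B B' _ _ h h' => exact Local.add_left h h'
    | smul c B _ h => exact Local.smul_left h
  | zero => exact Local.zero_left
  | add A A' _ _ h h' => exact Local.add_left h h'
  | smul c A _ h => exact Local.smul_left h

/-- The vertex superalgebra generated by the fields of the family. -/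
def vertexSuperalgebra : VertexSuperalgebra V where
  vac := G.vac
  parity := G.parity
  mode := G.Y
  parity_parity := G.parity_parity
  parity_vac := G.parity_vac
  parity_mode a n b := by
    rw [Y_parity]
    simp only [conj, LinearMap.coe_mk, AddHom.coe_mk, Module.End.mul_apply, G.parity_parity]
  truncation a := G.fields_isField (G.Y_mem a)
  vac_mode n b := by
    have := G.Y_eq (A := idField V) (Submodule.subset_span ⟨0, .one⟩)
    simp only [idField, if_true, Module.End.one_apply] at this
    rw [this]
    by_cases h : n = -1 <;> simp [idField, h]
  mode_vac a n hn := G.fields_creat (G.Y_mem a) n hn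
  mode_neg_one_vac := G.Y_vac
  translation a n b := by
    have hT : ∀ v, G.Y v (-2) G.vac = G.T v := by
      intro v
      have := G.fields_trans (G.Y_mem v) (-1) G.vac
      rw [G.T_vac, map_zero, sub_zero, G.Y_vac] at this
      rw [this]
      simp
    rw [hT, hT]
    exact G.fields_trans (G.Y_mem a) n b
  locality a b p q ha hb := by
    refine G.local_of_fieldsPar (G.mem_fieldsPar (G.Y_mem a) ?_) (G.mem_fieldsPar (G.Y_mem b) ?_)
    · rw [← Y_parity, ha, map_smul]
    · rw [← Y_parity, hb, map_smul]

/-- The state-field correspondence sends `x i_(-1) 1` to the generating field `x i`. -/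
theorem mode_x (i : G.ι) : G.vertexSuperalgebra.mode (G.x i (-1) G.vac) = G.x i := by
  have h : nprod ((-1) ^ (G.par i * 0)) (G.dx i 0) (idField V) = G.x i := by
    funext m
    refine LinearMap.ext fun v => ?_
    have hx := (G.nice_dx i 0).field
    rw [nprod, nprodAux_apply _ hx G.nice_one.field, mul_zero, pow_zero, one_smul]
    simp only [dx, Function.iterate_zero, id_eq]
    rcases lt_or_ge m 0 with hm | hm
    · rw [finsum_eq_single _ (-1 - m).toNat, finsum_eq_zero_of_forall_eq_zero, add_zero, idField,
        if_pos (by omega), Module.End.one_apply, show (0 : ℤ) - 1 - ((-1 - m).toNat : ℤ) = m by omega]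
      · intro j
        rw [idField, if_neg (by omega), LinearMap.zero_apply]
      · intro j hj
        rw [idField, if_neg (by omega), LinearMap.zero_apply, map_zero]
    · rw [finsum_eq_zero_of_forall_eq_zero, finsum_eq_single _ m.toNat, zero_add, idField,
        if_pos (by omega), Module.End.one_apply, show (0 : ℤ) + (m.toNat : ℤ) = m by omega]
      · intro j hj
        rw [idField, if_neg (by omega), LinearMap.zero_apply]
      · intro j
        rw [idField, if_neg (by omega), LinearMap.zero_apply, map_zero]
  have hmem : G.x i ∈ G.fields := by
    rw [← h]
    exact Submodule.subset_span ⟨_, .nprod i 0 0 _ .one⟩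
  exact G.Y_eq hmem

end GeneratingFields

/-! ### Vacuum modules of mode algebras -/

/-- Finitely many generators `i` of parity `par i` together with the singular parts of their
operator product expansions,
`i(z) j(w) ~ (∑ k, bracket i j k • k(w) + pairing₀ i j) / (z - w) + pairing₁ i j / (z - w)^2`. -/
structure CurrentData where
  /-- the generators -/
  ι : Type
  [fintype : Fintype ι]
  /-- the parities -/
  par : ι → ℕ
  /-- structure constants in the first order pole -/
  bracket : ι → ι → ι → ℂ
  /-- scalar in the first order pole -/
  pairing₀ : ι → ι → ℂ
  /-- scalar in the second order pole -/
  pairing₁ : ι → ι → ℂ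
  par_bracket : ∀ i j k, bracket i j k ≠ 0 → (-1 : ℂ) ^ par k = (-1) ^ (par i + par j)
  par_pairing₀ : ∀ i j, pairing₀ i j ≠ 0 → (-1 : ℂ) ^ (par i + par j) = 1
  par_pairing₁ : ∀ i j, pairing₁ i j ≠ 0 → (-1 : ℂ) ^ (par i + par j) = 1

namespace CurrentData

attribute [instance] CurrentData.fintype

variable (D : CurrentData)

/-- The commutation relations of the modes `i_(n)`, where `i(z) = ∑ i_(n) z^(-n-1)`:
`i_(m) j_(n) - (-1)^(|i||j|) j_(n) i_(m)
  = ∑ k, bracket i j k • k_(m+n) + δ_(m+n,-1) pairing₀ i j + m δ_(m+n,0) pairing₁ i j`. -/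
inductive ModeRel : FreeAlgebra ℂ (D.ι × ℤ) → FreeAlgebra ℂ (D.ι × ℤ) → Prop
  | comm (i j : D.ι) (m n : ℤ) : ModeRel
      (FreeAlgebra.ι ℂ (i, m) * FreeAlgebra.ι ℂ (j, n))
      ((-1 : ℂ) ^ (D.par i * D.par j) • (FreeAlgebra.ι ℂ (j, n) * FreeAlgebra.ι ℂ (i, m)) +
        ∑ k, D.bracket i j k • FreeAlgebra.ι ℂ (k, m + n) +
        (if m + n = -1 then D.pairing₀ i j else 0) • 1 +
        (if m + n = 0 then m * D.pairing₁ i j else 0) • 1)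

/-- The associative algebra generated by the modes, subject to the commutation relations. -/
abbrev ModeAlgebra : Type := RingQuot D.ModeRel

/-- The mode `i_(n)`. -/
def gen (i : D.ι) (n : ℤ) : D.ModeAlgebra :=
  RingQuot.mkAlgHom ℂ D.ModeRel (FreeAlgebra.ι ℂ (i, n))

theorem gen_comm (i j : D.ι) (m n : ℤ) :
    D.gen i m * D.gen j n = (-1 : ℂ) ^ (D.par i * D.par j) • (D.gen j n * D.gen i m) +
      ∑ k, D.bracket i j k • D.gen k (m + n) +
      (if m + n = -1 then D.pairing₀ i j else 0) • 1 +
      (if m + n = 0 then m * D.pairing₁ i j else 0) • 1 := by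
  have := RingQuot.mkAlgHom_rel ℂ (ModeRel.comm i j m n)
  simp only [map_mul, map_add, map_smul, map_sum, map_one] at this
  exact this

/-- The left ideal generated by the modes `i_(n)` with `n ≥ 0`. -/
def vacIdeal : Submodule ℂ D.ModeAlgebra :=
  Submodule.span ℂ {y | ∃ a i n, 0 ≤ n ∧ y = a * D.gen i n}

/-- The vacuum module: the module over the mode algebra generated by a vector which is annihilated
by all `i_(n)` with `n ≥ 0`. -/
abbrev VacModule : Type := D.ModeAlgebra ⧸ D.vacIdeal

/-- The generating vector of the vacuum module. -/
def vac : D.VacModule := D.vacIdeal.mkQ 1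

theorem vacIdeal_mul (a b : D.ModeAlgebra) (hb : b ∈ D.vacIdeal) : a * b ∈ D.vacIdeal := by
  induction hb using Submodule.span_induction with
  | mem b hb =>
    obtain ⟨c, i, n, hn, rfl⟩ := hb
    exact Submodule.subset_span ⟨a * c, i, n, hn, by rw [mul_assoc]⟩
  | zero => rw [mul_zero]; exact Submodule.zero_mem _
  | add b b' _ _ h h' => rw [mul_add]; exact Submodule.add_mem _ h h'
  | smul c b _ h => rw [mul_smul_comm]; exact Submodule.smul_mem _ _ h

/-- The action of the mode algebra on the vacuum module. -/
def act (a : D.ModeAlgebra) : Module.End ℂ D.VacModule :=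
  D.vacIdeal.mapQ D.vacIdeal (LinearMap.mulLeft ℂ a) fun b hb => D.vacIdeal_mul a b hb

/-- The action of the mode `i_(n)` on the vacuum module. -/
def x (i : D.ι) (n : ℤ) : Module.End ℂ D.VacModule := D.act (D.gen i n)

theorem act_mk (a b : D.ModeAlgebra) : D.act a (D.vacIdeal.mkQ b) = D.vacIdeal.mkQ (a * b) := rfl

theorem mk_surjective (v : D.VacModule) : ∃ a, D.vacIdeal.mkQ a = v :=
  Submodule.mkQ_surjective _ v

theorem x_comm (i j : D.ι) (m n : ℤ) (v : D.VacModule) :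
    D.x i m (D.x j n v) = (-1 : ℂ) ^ (D.par i * D.par j) • D.x j n (D.x i m v) +
      ∑ k, D.bracket i j k • D.x k (m + n) v +
      (if m + n = -1 then D.pairing₀ i j else 0) • v +
      (if m + n = 0 then m * D.pairing₁ i j else 0) • v := by
  obtain ⟨a, rfl⟩ := D.mk_surjective v
  simp only [x, act_mk, ← map_smul, ← map_sum, ← map_add]
  congr 1
  rw [← mul_assoc, gen_comm]
  simp only [add_mul, smul_mul_assoc, one_mul, Finset.sum_mul, mul_assoc]

theorem x_vac (i : D.ι) (n : ℤ) (hn : 0 ≤ n) : D.x i n D.vac = 0 := by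
  rw [x, vac, act_mk, mul_one, Submodule.mkQ_apply, Submodule.Quotient.mk_eq_zero]
  exact Submodule.subset_span ⟨1, i, n, hn, (one_mul _).symm⟩

theorem adjoin_gen : Algebra.adjoin ℂ (Set.range fun p : D.ι × ℤ => D.gen p.1 p.2) = ⊤ := by
  have h : (Set.range fun p : D.ι × ℤ => D.gen p.1 p.2) =
      RingQuot.mkAlgHom ℂ D.ModeRel '' Set.range (FreeAlgebra.ι ℂ) := by
    rw [← Set.range_comp]
    rfl
  rw [h, Algebra.adjoin_image, FreeAlgebra.adjoin_range_ι, Algebra.map_top,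
    AlgHom.range_eq_top]
  exact RingQuot.mkAlgHom_surjective ℂ _

theorem generates' (S : Submodule ℂ D.VacModule) (h0 : D.vac ∈ S)
    (h : ∀ i n v, v ∈ S → D.x i n v ∈ S) : S = ⊤ := by
  have key : ∀ a : D.ModeAlgebra, ∀ v ∈ S, D.act a v ∈ S := by
    intro a
    have ha : a ∈ Algebra.adjoin ℂ (Set.range fun p : D.ι × ℤ => D.gen p.1 p.2) := by
      rw [adjoin_gen]; trivial
    induction ha using Algebra.adjoin_induction with
    | mem a ha =>
      obtain ⟨p, rfl⟩ := ha
      exact h p.1 p.2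
    | algebraMap c =>
      intro v hv
      obtain ⟨b, rfl⟩ := D.mk_surjective v
      rw [act_mk, ← Algebra.smul_def, map_smul]
      exact S.smul_mem _ hv
    | add a b _ _ ha hb =>
      intro v hv
      have e : D.act (a + b) v = D.act a v + D.act b v := by
        obtain ⟨c, rfl⟩ := D.mk_surjective v
        rw [act_mk, act_mk, act_mk, add_mul, map_add]
      rw [e]
      exact S.add_mem (ha v hv) (hb v hv)
    | mul a b _ _ ha hb =>
      intro v hv
      have e : D.act (a * b) v = D.act a (D.act b v) := by
        obtain ⟨c, rfl⟩ := D.mk_surjective v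
        rw [act_mk, act_mk, act_mk, mul_assoc]
      rw [e]
      exact ha _ (hb v hv)
  rw [eq_top_iff]
  intro v _
  obtain ⟨a, rfl⟩ := D.mk_surjective v
  have := key a _ h0
  rwa [vac, act_mk, mul_one] at this

theorem generates (S : Submodule ℂ D.VacModule) (h0 : D.vac ∈ S)
    (h : ∀ i n v, n < 0 → v ∈ S → D.x i n v ∈ S) : S = ⊤ := by
  -- the smallest subspace which contains the vacuum and is stable under negative modes
  let S' : Submodule ℂ D.VacModule := sInf {S | D.vac ∈ S ∧ ∀ i n v, n < 0 → v ∈ S → D.x i n v ∈ S}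
  have hvac : D.vac ∈ S' := Submodule.mem_sInf.2 fun S hS => hS.1
  have hneg : ∀ i n v, n < 0 → v ∈ S' → D.x i n v ∈ S' := fun i n v hn hv =>
    Submodule.mem_sInf.2 fun S hS => hS.2 i n v hn (Submodule.mem_sInf.1 hv S hS)
  have hle : ∀ S : Submodule ℂ D.VacModule, D.vac ∈ S →
      (∀ i n v, n < 0 → v ∈ S → D.x i n v ∈ S) → S' ≤ S := fun S h1 h2 => sInf_le ⟨h1, h2⟩
  -- it is stable under all modes
  let P : Submodule ℂ D.VacModule :=
    { carrier := {v | v ∈ S' ∧ ∀ i n, D.x i n v ∈ S'}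
      add_mem' := fun {v w} hv hw => ⟨S'.add_mem hv.1 hw.1, fun i n => by
        rw [map_add]; exact S'.add_mem (hv.2 i n) (hw.2 i n)⟩
      zero_mem' := ⟨S'.zero_mem, fun i n => by rw [map_zero]; exact S'.zero_mem⟩
      smul_mem' := fun c v hv => ⟨S'.smul_mem c hv.1, fun i n => by
        rw [map_smul]; exact S'.smul_mem c (hv.2 i n)⟩ }
  have hP : S' ≤ P := by
    refine hle P ⟨hvac, fun i n => ?_⟩ ?_
    · rcases lt_or_ge n 0 with hn | hn
      · exact hneg i n _ hn hvac
      · rw [D.x_vac i n hn]; exact S'.zero_mem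
    · intro j n v hn hv
      refine ⟨hneg j n v hn hv.1, fun i m => ?_⟩
      rw [x_comm]
      exact S'.add_mem (S'.add_mem (S'.add_mem (S'.smul_mem _ (hneg j n _ hn (hv.2 i m)))
        (S'.sum_mem fun k _ => S'.smul_mem _ (hv.2 k _))) (S'.smul_mem _ hv.1)) (S'.smul_mem _ hv.1)
  have htop : S' = ⊤ := D.generates' S' hvac fun i n v hv => (hP hv).2 i n
  rw [eq_top_iff, ← htop]
  exact hle S h0 h

theorem x_isField (i : D.ι) : IsField (D.x i) := by
  let S : Submodule ℂ D.VacModule :=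
    { carrier := {v | ∃ N : ℤ, ∀ i n, N ≤ n → D.x i n v = 0}
      add_mem' := by
        rintro v w ⟨N, hN⟩ ⟨M, hM⟩
        exact ⟨max N M, fun i n hn => by rw [map_add, hN i n (by omega), hM i n (by omega),
          add_zero]⟩
      zero_mem' := ⟨0, fun i n _ => map_zero _⟩
      smul_mem' := by
        rintro c v ⟨N, hN⟩
        exact ⟨N, fun i n hn => by rw [map_smul, hN i n hn, smul_zero]⟩ }
  have hS : S = ⊤ := by
    refine D.generates' S ⟨0, D.x_vac⟩ ?_
    rintro j n v ⟨N, hN⟩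
    refine ⟨max (max N (N - n)) (1 - n), fun i m hm => ?_⟩
    rw [x_comm, hN i m (by omega), if_neg (by omega), if_neg (by omega),
      Finset.sum_eq_zero fun k _ => by rw [hN k _ (by omega), smul_zero]]
    simp
  intro v
  have hv : v ∈ S := by rw [hS]; trivial
  obtain ⟨N, hN⟩ := hv
  exact ⟨N, hN i⟩

theorem x_isLocal (i j : D.ι) : Local ((-1) ^ (D.par i * D.par j)) (D.x i) (D.x j) := by
  refine ⟨2, ?_⟩
  funext m n
  refine LinearMap.ext fun v => ?_
  have key : ∀ m n : ℤ, D.x i m (D.x j n v) -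
      (-1 : ℂ) ^ (D.par i * D.par j) • D.x j n (D.x i m v) =
      ∑ k, D.bracket i j k • D.x k (m + n) v +
      (if m + n = -1 then D.pairing₀ i j else 0) • v +
      (if m + n = 0 then m * D.pairing₁ i j else 0) • v := by
    intro m n
    rw [x_comm]
    module
  rw [pow_two]
  simp only [Module.End.mul_apply, mulSub, LinearMap.coe_mk, AddHom.coe_mk, LinearMap.sub_apply,
    LinearMap.smul_apply, key, Pi.zero_apply, LinearMap.zero_apply]
  rw [show m + 1 + 1 + n = m + n + 2 by ring, show m + 1 + (n + 1) = m + n + 2 by ring,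
    show m + (n + 1 + 1) = m + n + 2 by ring]
  by_cases h : m + n + 2 = 0
  · simp only [h, if_true]
    push_cast
    module
  · simp only [h, if_false]
    abel

/-- The algebra homomorphism `a ↦ a + ε ∂a` into dual numbers, where `∂` is the derivation of the
mode algebra with `∂ i_(n) = -n i_(n-1)`. -/
def derHom : D.ModeAlgebra →ₐ[ℂ] DualNumber D.ModeAlgebra :=
  RingQuot.liftAlgHom ℂ ⟨FreeAlgebra.lift ℂ fun p : D.ι × ℤ =>
    TrivSqZeroExt.inl (D.gen p.1 p.2) + TrivSqZeroExt.inr ((-p.2 : ℂ) • D.gen p.1 (p.2 - 1)), by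
    rintro _ _ ⟨i, j, m, n⟩
    simp only [map_mul, map_add, map_smul, map_sum, map_one, FreeAlgebra.lift_ι_apply]
    refine TrivSqZeroExt.ext ?_ ?_
    · simp only [TrivSqZeroExt.fst_mul, TrivSqZeroExt.fst_add, TrivSqZeroExt.fst_smul, TrivSqZeroExt.fst_sum, TrivSqZeroExt.fst_one, TrivSqZeroExt.fst_inl, TrivSqZeroExt.fst_inr, add_zero]
      exact D.gen_comm i j m n
    · simp only [TrivSqZeroExt.snd_mul, TrivSqZeroExt.snd_add, TrivSqZeroExt.snd_smul, TrivSqZeroExt.snd_sum, TrivSqZeroExt.snd_one, TrivSqZeroExt.snd_inl, TrivSqZeroExt.snd_inr,TrivSqZeroExt.fst_add, TrivSqZeroExt.fst_inl, TrivSqZeroExt.fst_inr, add_zero, zero_add, smul_zero,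
        smul_eq_mul, MulOpposite.smul_eq_mul_unop, MulOpposite.unop_op, mul_smul_comm, smul_mul_assoc]
      rw [gen_comm D i j m (n - 1), gen_comm D i j (m - 1) n,
        show m + (n - 1) = m + n - 1 by ring, show m - 1 + n = m + n - 1 by ring]
      have hs : ∑ k, D.bracket i j k • (-((m + n : ℤ) : ℂ)) • D.gen k (m + n - 1) =
          (-((m + n : ℤ) : ℂ)) • ∑ k, D.bracket i j k • D.gen k (m + n - 1) := by
        rw [Finset.smul_sum]
        exact Finset.sum_congr rfl fun k _ => smul_comm _ _ _
      rw [hs]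
      by_cases h0 : m + n = 0
      · obtain rfl : n = -m := by omega
        simp only [show m + -m - 1 = -1 by ring, if_true, show ¬ ((-1 : ℤ) = 0) by decide, if_false]
        push_cast
        module
      · by_cases h1 : m + n = 1
        · obtain rfl : n = 1 - m := by omega
          simp only [show m + (1 - m) - 1 = 0 by ring, if_true, show ¬ ((0 : ℤ) = -1) by decide,
            if_false]
          push_cast
          module
        · simp only [show ¬ (m + n - 1 = -1) by omega, show ¬ (m + n - 1 = 0) by omega, if_false]
          push_cast
          module⟩

/-- The derivation `∂` of the mode algebra with `∂ i_(n) = -n i_(n-1)`. -/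
def der : D.ModeAlgebra →ₗ[ℂ] D.ModeAlgebra where
  toFun a := (D.derHom a).snd
  map_add' a b := by rw [map_add, TrivSqZeroExt.snd_add]
  map_smul' c a := by rw [map_smul, TrivSqZeroExt.snd_smul, RingHom.id_apply]

theorem derHom_gen (i : D.ι) (n : ℤ) : D.derHom (D.gen i n) =
    TrivSqZeroExt.inl (D.gen i n) + TrivSqZeroExt.inr ((-n : ℂ) • D.gen i (n - 1)) := by
  rw [derHom, gen, RingQuot.liftAlgHom_mkAlgHom_apply, FreeAlgebra.lift_ι_apply]
  rfl

theorem fst_derHom (a : D.ModeAlgebra) : (D.derHom a).fst = a := by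
  have h : (TrivSqZeroExt.fstHom ℂ D.ModeAlgebra D.ModeAlgebra).comp D.derHom =
      AlgHom.id ℂ D.ModeAlgebra := by
    refine RingQuot.ringQuot_ext' ℂ _ _ (FreeAlgebra.hom_ext ?_)
    funext p
    have := D.derHom_gen p.1 p.2
    simp only [Function.comp_apply, AlgHom.comp_apply, AlgHom.id_apply]
    change (D.derHom (D.gen p.1 p.2)).fst = D.gen p.1 p.2
    rw [this]
    simp
  exact DFunLike.congr_fun h a

theorem der_mul (a b : D.ModeAlgebra) : D.der (a * b) = a * D.der b + D.der a * b := by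
  change (D.derHom (a * b)).snd = a * (D.derHom b).snd + (D.derHom a).snd * b
  rw [map_mul, TrivSqZeroExt.snd_mul, fst_derHom, fst_derHom]
  rfl

theorem der_gen (i : D.ι) (n : ℤ) : D.der (D.gen i n) = (-n : ℂ) • D.gen i (n - 1) := by
  change (D.derHom (D.gen i n)).snd = _
  rw [derHom_gen]
  simp

/-- The parity automorphism of the mode algebra. -/
def parHom : D.ModeAlgebra →ₐ[ℂ] D.ModeAlgebra :=
  RingQuot.liftAlgHom ℂ ⟨FreeAlgebra.lift ℂ fun p : D.ι × ℤ =>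
    (-1 : ℂ) ^ D.par p.1 • D.gen p.1 p.2, by
    rintro _ _ ⟨i, j, m, n⟩
    simp only [map_mul, map_add, map_smul, map_sum, map_one, FreeAlgebra.lift_ι_apply]
    have h0 : (if m + n = -1 then D.pairing₀ i j else 0) =
        (-1 : ℂ) ^ (D.par i + D.par j) * (if m + n = -1 then D.pairing₀ i j else 0) := by
      by_cases h : D.pairing₀ i j = 0
      · simp [h]
      · rw [D.par_pairing₀ i j h, one_mul]
    have h1 : (if m + n = 0 then m * D.pairing₁ i j else 0) =
        (-1 : ℂ) ^ (D.par i + D.par j) * (if m + n = 0 then m * D.pairing₁ i j else 0) := by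
      by_cases h : D.pairing₁ i j = 0
      · simp [h]
      · rw [D.par_pairing₁ i j h, one_mul]
    have h2 : ∀ k, D.bracket i j k • (-1 : ℂ) ^ D.par k • D.gen k (m + n) =
        (-1 : ℂ) ^ (D.par i + D.par j) • D.bracket i j k • D.gen k (m + n) := by
      intro k
      by_cases h : D.bracket i j k = 0
      · simp [h]
      · rw [D.par_bracket i j k h, smul_comm]
    rw [Finset.sum_congr rfl fun k _ => h2 k, ← Finset.smul_sum, h0, h1, smul_mul_smul_comm,
      smul_mul_smul_comm, gen_comm, pow_add]
    module⟩

theorem parHom_gen (i : D.ι) (n : ℤ) : D.parHom (D.gen i n) = (-1 : ℂ) ^ D.par i • D.gen i n := by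
  rw [parHom, gen, RingQuot.liftAlgHom_mkAlgHom_apply, FreeAlgebra.lift_ι_apply]
  rfl

theorem parHom_parHom (a : D.ModeAlgebra) : D.parHom (D.parHom a) = a := by
  have h : D.parHom.comp D.parHom = AlgHom.id ℂ D.ModeAlgebra := by
    refine RingQuot.ringQuot_ext' ℂ _ _ (FreeAlgebra.hom_ext ?_)
    funext p
    change D.parHom (D.parHom (D.gen p.1 p.2)) = D.gen p.1 p.2
    rw [parHom_gen, map_smul, parHom_gen, smul_smul, ← mul_pow]
    simp
  exact DFunLike.congr_fun h a

/-- The translation operator of the vacuum module. -/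
def T : Module.End ℂ D.VacModule :=
  D.vacIdeal.mapQ D.vacIdeal D.der fun b hb => by
    change D.der b ∈ D.vacIdeal
    induction hb using Submodule.span_induction with
    | mem b hb =>
      obtain ⟨a, i, n, hn, rfl⟩ := hb
      rw [der_mul, der_gen, mul_smul_comm]
      refine Submodule.add_mem _ ?_ (Submodule.subset_span ⟨_, i, n, hn, rfl⟩)
      rcases eq_or_lt_of_le hn with rfl | hn
      · simp
      · exact Submodule.smul_mem _ _ (Submodule.subset_span ⟨a, i, n - 1, by omega, rfl⟩)
    | zero => rw [map_zero]; exact Submodule.zero_mem _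
    | add b b' _ _ h h' => rw [map_add]; exact Submodule.add_mem _ h h'
    | smul c b _ h => rw [map_smul]; exact Submodule.smul_mem _ _ h

/-- The parity involution of the vacuum module. -/
def parity : Module.End ℂ D.VacModule :=
  D.vacIdeal.mapQ D.vacIdeal D.parHom.toLinearMap fun b hb => by
    change D.parHom b ∈ D.vacIdeal
    induction hb using Submodule.span_induction with
    | mem b hb =>
      obtain ⟨a, i, n, hn, rfl⟩ := hb
      rw [map_mul, parHom_gen, mul_smul_comm]
      exact Submodule.smul_mem _ _ (Submodule.subset_span ⟨_, i, n, hn, rfl⟩)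
    | zero => rw [map_zero]; exact Submodule.zero_mem _
    | add b b' _ _ h h' => rw [map_add]; exact Submodule.add_mem _ h h'
    | smul c b _ h => rw [map_smul]; exact Submodule.smul_mem _ _ h

theorem T_mk (a : D.ModeAlgebra) : D.T (D.vacIdeal.mkQ a) = D.vacIdeal.mkQ (D.der a) := rfl

theorem parity_mk (a : D.ModeAlgebra) : D.parity (D.vacIdeal.mkQ a) = D.vacIdeal.mkQ (D.parHom a) :=
  rfl

/-- The fields `i(z) = ∑ i_(n) z^(-n-1)` on the vacuum module. -/
def generatingFields : GeneratingFields D.VacModule where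
  ι := D.ι
  par := D.par
  x := D.x
  vac := D.vac
  parity := D.parity
  T := D.T
  isField := D.x_isField
  isLocal := D.x_isLocal
  parity_parity v := by
    obtain ⟨a, rfl⟩ := D.mk_surjective v
    rw [parity_mk, parity_mk, parHom_parHom]
  parity_vac := by rw [vac, parity_mk, map_one]
  parity_x i n v := by
    obtain ⟨a, rfl⟩ := D.mk_surjective v
    rw [x, act_mk, parity_mk, parity_mk, act_mk, map_mul, parHom_gen, smul_mul_assoc, map_smul]
  T_vac := by
    have h := D.der_mul 1 1
    rw [mul_one, one_mul, mul_one, left_eq_add] at h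
    rw [vac, T_mk, h, map_zero]
  T_x i n v := by
    obtain ⟨a, rfl⟩ := D.mk_surjective v
    rw [x, x, act_mk, T_mk, T_mk, act_mk, act_mk, der_mul, map_add, add_sub_cancel_left, der_gen,
      smul_mul_assoc, map_smul]
  x_vac := D.x_vac
  generates := D.generates

/-- The vertex superalgebra structure on the vacuum module, generated by the fields
`i(z) = ∑ i_(n) z^(-n-1)`. -/
def vertexSuperalgebra : VertexSuperalgebra D.VacModule := D.generatingFields.vertexSuperalgebra

/-- The state `i_(-1) 1` of the generator `i`. -/
def state (i : D.ι) : D.VacModule := D.x i (-1) D.vac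

/-- `Y(i_(-1) 1, z) = i(z)`. -/
theorem mode_state (i : D.ι) (n : ℤ) : D.vertexSuperalgebra.mode (D.state i) n = D.x i n :=
  congrFun (D.generatingFields.mode_x i) n

theorem parity_eq_id (h : ∀ i, D.par i = 0) (v : D.VacModule) :
    D.vertexSuperalgebra.parity v = v := by
  have e : D.parHom = AlgHom.id ℂ D.ModeAlgebra := by
    refine RingQuot.ringQuot_ext' ℂ _ _ (FreeAlgebra.hom_ext ?_)
    funext p
    change D.parHom (D.gen p.1 p.2) = D.gen p.1 p.2
    rw [parHom_gen, h, pow_zero, one_smul]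
  obtain ⟨a, rfl⟩ := D.mk_surjective v
  change D.parity _ = _
  rw [parity_mk, e]
  rfl

end CurrentData

/-! ### Tensor products -/

open TensorProduct

/-- Convolution of two-variable distributions: coefficients of the product `f(z,w) ⊗ g(z,w)`. -/
def conv (f : ℤ → ℤ → V) (g : ℤ → ℤ → W) (m n : ℤ) : V ⊗[ℂ] W :=
  ∑ᶠ p : ℤ × ℤ, f p.1 p.2 ⊗ₜ[ℂ] g (m - 1 - p.1) (n - 1 - p.2)

/-- All the sums that define `conv f g` are finite. -/
def ConvFinite (f : ℤ → ℤ → V) (g : ℤ → ℤ → W) : Prop :=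
  ∀ m n : ℤ, {p : ℤ × ℤ | f p.1 p.2 ≠ 0 ∧ g (m - 1 - p.1) (n - 1 - p.2) ≠ 0}.Finite

theorem ConvFinite.support {f : ℤ → ℤ → V} {g : ℤ → ℤ → W} (h : ConvFinite f g) (m n : ℤ) :
    (Function.support fun p : ℤ × ℤ => f p.1 p.2 ⊗ₜ[ℂ] g (m - 1 - p.1) (n - 1 - p.2)).Finite := by
  refine (h m n).subset fun p hp => ⟨fun h0 => hp ?_, fun h0 => hp ?_⟩
  · simp only [h0, zero_tmul]
  · simp only [h0, tmul_zero]

theorem mulSub_conv_right {f : ℤ → ℤ → V} {g : ℤ → ℤ → W} (h : ConvFinite f g) :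
    ConvFinite f (mulSub g) ∧ mulSub (conv f g) = conv f (mulSub g) := by
  constructor
  · intro m n
    refine ((h (m + 1) n).union (h m (n + 1))).subset ?_
    rintro ⟨k, l⟩ ⟨h1, h2⟩
    simp only [mulSub, LinearMap.coe_mk, AddHom.coe_mk] at h1 h2
    by_cases h3 : g (m - 1 - k + 1) (n - 1 - l) = 0
    · refine Or.inr ⟨h1, fun h4 => h2 ?_⟩
      rw [h3, ← h4]
      simp only [show n + 1 - 1 - l = n - 1 - l + 1 by ring] at h4 ⊢
      rw [h4, sub_zero]
    · refine Or.inl ⟨h1, fun h4 => h3 ?_⟩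
      rw [← h4]
      simp only [show m + 1 - 1 - k = m - 1 - k + 1 by ring]
  · funext m n
    simp only [mulSub, LinearMap.coe_mk, AddHom.coe_mk, conv]
    rw [← finsum_sub_distrib (h.support _ _) (h.support _ _)]
    refine finsum_congr fun p => ?_
    rw [tmul_sub, show m + 1 - 1 - p.1 = m - 1 - p.1 + 1 by ring,
      show n + 1 - 1 - p.2 = n - 1 - p.2 + 1 by ring]

theorem mulSub_conv_left {f : ℤ → ℤ → V} {g : ℤ → ℤ → W} (h : ConvFinite f g) :
    ConvFinite (mulSub f) g ∧ mulSub (conv f g) = conv (mulSub f) g := by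
  let e1 : ℤ × ℤ ≃ ℤ × ℤ := (Equiv.addRight 1).prodCongr (Equiv.refl ℤ)
  let e2 : ℤ × ℤ ≃ ℤ × ℤ := (Equiv.refl ℤ).prodCongr (Equiv.addRight 1)
  constructor
  · intro m n
    refine (((h (m + 1) n).preimage e1.injective.injOn).union
      ((h m (n + 1)).preimage e2.injective.injOn)).subset ?_
    rintro ⟨k, l⟩ ⟨h1, h2⟩
    simp only [mulSub, LinearMap.coe_mk, AddHom.coe_mk] at h1 h2
    by_cases h3 : f (k + 1) l = 0
    · refine Or.inr ⟨fun h4 => h1 ?_, ?_⟩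
      · change f k (l + 1) = 0 at h4
        rw [h3, h4, sub_zero]
      · change g (m - 1 - k) (n + 1 - 1 - (l + 1)) ≠ 0
        rwa [show n + 1 - 1 - (l + 1) = n - 1 - l by ring]
    · refine Or.inl ⟨h3, ?_⟩
      change g (m + 1 - 1 - (k + 1)) (n - 1 - l) ≠ 0
      rwa [show m + 1 - 1 - (k + 1) = m - 1 - k by ring]
  · funext m n
    simp only [mulSub, LinearMap.coe_mk, AddHom.coe_mk, conv]
    have s1 := h.support (m + 1) n
    have s2 := h.support m (n + 1)
    rw [← finsum_comp_equiv e1, ← finsum_comp_equiv e2 (f := fun p : ℤ × ℤ =>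
      f p.1 p.2 ⊗ₜ[ℂ] g (m - 1 - p.1) (n + 1 - 1 - p.2)),
      ← finsum_sub_distrib (s1.preimage e1.injective.injOn) (s2.preimage e2.injective.injOn)]
    refine finsum_congr fun p => ?_
    change f (p.1 + 1) p.2 ⊗ₜ[ℂ] g (m + 1 - 1 - (p.1 + 1)) (n - 1 - p.2) -
      f p.1 (p.2 + 1) ⊗ₜ[ℂ] g (m - 1 - p.1) (n + 1 - 1 - (p.2 + 1)) = _
    rw [sub_tmul, show m + 1 - 1 - (p.1 + 1) = m - 1 - p.1 by ring,
      show n + 1 - 1 - (p.2 + 1) = n - 1 - p.2 by ring]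

theorem mulSub_pow_conv (N M : ℕ) {f : ℤ → ℤ → V} {g : ℤ → ℤ → W} (h : ConvFinite f g) :
    (mulSub ^ (N + M)) (conv f g) = conv ((mulSub ^ N) f) ((mulSub ^ M) g) := by
  have h1 : ∀ M : ℕ, ConvFinite f ((mulSub ^ M) g) ∧
      (mulSub ^ M) (conv f g) = conv f ((mulSub ^ M) g) := by
    intro M
    induction M with
    | zero => exact ⟨h, rfl⟩
    | succ M ih =>
      rw [pow_succ', pow_succ', Module.End.mul_apply, Module.End.mul_apply, ih.2]
      exact mulSub_conv_right ih.1
  have h2 : ∀ N : ℕ, ConvFinite ((mulSub ^ N) f) ((mulSub ^ M) g) ∧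
      (mulSub ^ (N + M)) (conv f g) = conv ((mulSub ^ N) f) ((mulSub ^ M) g) := by
    intro N
    induction N with
    | zero => rw [zero_add]; exact h1 M
    | succ N ih =>
      rw [add_right_comm, pow_succ', pow_succ', Module.End.mul_apply, Module.End.mul_apply, ih.2]
      exact mulSub_conv_left ih.1
  exact (h2 N).2

/-- The modes of the product `A(z) ⊗ B(z)` of two fields. -/
def tensorField (A : ℤ → Module.End ℂ V) (B : ℤ → Module.End ℂ W) (n : ℤ) :
    Module.End ℂ (V ⊗[ℂ] W) :=
  psum fun k : ℤ => TensorProduct.map (A k) (B (n - 1 - k))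

theorem tensor_finite' {A : ℤ → Module.End ℂ V} {B : ℤ → Module.End ℂ W} (hA : IsField A)
    (hB : IsField B) (n : ℤ) (v : V) (w : W) :
    (Function.support fun k : ℤ => A k v ⊗ₜ[ℂ] B (n - 1 - k) w).Finite := by
  obtain ⟨N, hN⟩ := hA v
  obtain ⟨M, hM⟩ := hB w
  refine (Set.finite_Icc (n - M) N).subset fun k hk => ?_
  rw [Set.mem_Icc]
  by_contra hc
  rw [not_and_or, not_le, not_le] at hc
  rcases hc with hc | hc
  · exact hk (by simp only [hM _ (show M ≤ n - 1 - k by omega), tmul_zero])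
  · exact hk (by simp only [hN _ hc.le, zero_tmul])

theorem tensor_finite {A : ℤ → Module.End ℂ V} {B : ℤ → Module.End ℂ W} (hA : IsField A)
    (hB : IsField B) (n : ℤ) (t : V ⊗[ℂ] W) :
    (Function.support fun k : ℤ => TensorProduct.map (A k) (B (n - 1 - k)) t).Finite := by
  induction t using TensorProduct.induction_on with
  | zero => simp
  | tmul v w => exact tensor_finite' hA hB n v w
  | add s t hs ht =>
    refine (hs.union ht).subset ?_
    simp only [map_add]
    exact Function.support_add _ _

theorem tensorField_apply {A : ℤ → Module.End ℂ V} {B : ℤ → Module.End ℂ W} (hA : IsField A)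
    (hB : IsField B) (n : ℤ) (t : V ⊗[ℂ] W) :
    tensorField A B n t = ∑ᶠ k : ℤ, TensorProduct.map (A k) (B (n - 1 - k)) t :=
  psum_apply (tensor_finite hA hB n) t

theorem tensorField_tmul {A : ℤ → Module.End ℂ V} {B : ℤ → Module.End ℂ W} (hA : IsField A)
    (hB : IsField B) (n : ℤ) (v : V) (w : W) :
    tensorField A B n (v ⊗ₜ w) = ∑ᶠ k : ℤ, A k v ⊗ₜ[ℂ] B (n - 1 - k) w :=
  tensorField_apply hA hB n _

theorem tensorField_isField {A : ℤ → Module.End ℂ V} {B : ℤ → Module.End ℂ W} (hA : IsField A)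
    (hB : IsField B) : IsField (tensorField A B) := by
  intro t
  induction t using TensorProduct.induction_on with
  | zero => exact ⟨0, fun n _ => map_zero _⟩
  | tmul v w =>
    obtain ⟨N, hN⟩ := hA v
    obtain ⟨M, hM⟩ := hB w
    refine ⟨N + M, fun n hn => ?_⟩
    rw [tensorField_tmul hA hB]
    refine finsum_eq_zero_of_forall_eq_zero fun k => ?_
    rcases le_or_gt N k with hk | hk
    · rw [hN k hk, zero_tmul]
    · rw [hM _ (by omega), tmul_zero]
  | add s t hs ht =>
    obtain ⟨N, hN⟩ := hs
    obtain ⟨M, hM⟩ := ht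
    refine ⟨max N M, fun n hn => ?_⟩
    rw [map_add, hN n (by omega), hM n (by omega), add_zero]

theorem tensorField_comp {A C : ℤ → Module.End ℂ V} {B D : ℤ → Module.End ℂ W} (hA : IsField A)
    (hB : IsField B) (hC : IsField C) (hD : IsField D) (v : V) (w : W) :
    ConvFinite (fun k l => A k (C l v)) (fun k l => B k (D l w)) ∧
    (fun m n => tensorField A B m (tensorField C D n (v ⊗ₜ w))) =
      conv (fun k l => A k (C l v)) (fun k l => B k (D l w)) := by
  have hfin : ConvFinite (fun k l => A k (C l v)) (fun k l => B k (D l w)) := by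
    intro m n
    obtain ⟨N, hN⟩ := hC v
    obtain ⟨M, hM⟩ := hD w
    have hfib : ∀ l : ℤ, {k : ℤ | A k (C l v) ≠ 0 ∧ B (m - 1 - k) (D (n - 1 - l) w) ≠ 0}.Finite := by
      intro l
      obtain ⟨N', hN'⟩ := hA (C l v)
      obtain ⟨M', hM'⟩ := hB (D (n - 1 - l) w)
      refine (Set.finite_Icc (m - M') N').subset ?_
      rintro k ⟨h1, h2⟩
      rw [Set.mem_Icc]
      by_contra hc
      rw [not_and_or, not_le, not_le] at hc
      rcases hc with hc | hc
      · exact h2 (hM' _ (by omega))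
      · exact h1 (hN' _ hc.le)
    refine ((Set.finite_Icc (n - M) N).biUnion fun l _ =>
      (hfib l).image fun k => (k, l)).subset ?_
    rintro ⟨k, l⟩ ⟨h1, h2⟩
    refine Set.mem_biUnion (x := l) ?_ ⟨k, ⟨h1, h2⟩, rfl⟩
    rw [Set.mem_Icc]
    by_contra hc
    rw [not_and_or, not_le, not_le] at hc
    rcases hc with hc | hc
    · exact h2 (by simp only [hM _ (show M ≤ n - 1 - l by omega), map_zero])
    · exact h1 (by simp only [hN _ hc.le, map_zero])
  refine ⟨hfin, ?_⟩
  funext m n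
  have hs := hfin.support m n
  rw [conv, ← finsum_comp_equiv (Equiv.prodComm ℤ ℤ),
    finsum_curry _ (hs.preimage (Equiv.prodComm ℤ ℤ).injective.injOn), tensorField_tmul hC hD]
  have := (tensorField A B m).toAddMonoidHom.map_finsum (tensor_finite' hC hD n v w)
  simp only [LinearMap.toAddMonoidHom_coe] at this
  rw [this]
  exact finsum_congr fun l => tensorField_tmul hA hB m _ _

theorem tensorField_local {A C : ℤ → Module.End ℂ V} {B D : ℤ → Module.End ℂ W} (hA : IsField A)
    (hB : IsField B) (hC : IsField C) (hD : IsField D) {ε : ℂ} (hAC : Local 1 A C)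
    (hBD : Local ε B D) : Local ε (tensorField A B) (tensorField C D) := by
  obtain ⟨N, hN⟩ := hAC
  obtain ⟨M, hM⟩ := hBD
  refine ⟨N + M, ?_⟩
  funext m n
  refine TensorProduct.ext' fun v w => ?_
  have c1 := tensorField_comp hA hB hC hD v w
  have c2 := tensorField_comp hC hD hA hB v w
  have flip : ∀ m n, conv (fun k l => C k (A l v)) (fun k l => D k (B l w)) m n =
      conv (fun k l => C l (A k v)) (fun k l => D l (B k w)) n m := by
    intro m n
    rw [conv, conv, ← finsum_comp_equiv (Equiv.prodComm ℤ ℤ)]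
    rfl
  have hfin : ConvFinite (fun k l => C l (A k v)) (fun k l => D l (B k w)) := by
    intro m n
    exact ((c2.1 n m).preimage (Equiv.prodComm ℤ ℤ).injective.injOn)
  have e : (fun m n => (tensorField A B m * tensorField C D n -
      ε • (tensorField C D n * tensorField A B m)) (v ⊗ₜ w)) =
      conv (fun k l => A k (C l v)) (fun k l => B k (D l w)) -
      ε • conv (fun k l => C l (A k v)) (fun k l => D l (B k w)) := by
    rw [← c1.2]
    funext m n
    simp only [LinearMap.sub_apply, LinearMap.smul_apply, Module.End.mul_apply, Pi.sub_apply,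
      Pi.smul_apply]
    rw [← flip, ← c2.2]
  have l1 := mulSub_pow_map (LinearMap.applyₗ (v ⊗ₜ[ℂ] w)) (N + M) (fun m n =>
    tensorField A B m * tensorField C D n - ε • (tensorField C D n * tensorField A B m)) m n
  simp only [LinearMap.applyₗ_apply_apply] at l1
  rw [← l1, e, map_sub, map_smul, mulSub_pow_conv N M c1.1, mulSub_pow_conv N M hfin]
  have k1 : (mulSub ^ N) (fun k l => A k (C l v)) = (mulSub ^ N) (fun k l => C l (A k v)) := by
    rw [← sub_eq_zero, ← map_sub]
    funext k l
    have := mulSub_pow_map (LinearMap.applyₗ v) N (fun m n => A m * C n - (1 : ℂ) • (C n * A m)) k l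
    rw [hN] at this
    simp only [LinearMap.applyₗ_apply_apply, LinearMap.sub_apply, Module.End.mul_apply,
      one_smul] at this
    exact this
  have k2 : (mulSub ^ M) (fun k l => B k (D l w)) = ε • (mulSub ^ M) (fun k l => D l (B k w)) := by
    rw [← sub_eq_zero, ← map_smul, ← map_sub]
    funext k l
    have := mulSub_pow_map (LinearMap.applyₗ w) M (fun m n => B m * D n - ε • (D n * B m)) k l
    rw [hM] at this
    simp only [LinearMap.applyₗ_apply_apply, LinearMap.sub_apply, LinearMap.smul_apply,
      Module.End.mul_apply] at this
    exact this
  rw [k1, k2]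
  simp only [Pi.sub_apply, Pi.smul_apply, conv, tmul_smul, Pi.zero_apply, LinearMap.zero_apply]
  rw [smul_finsum, sub_self]

theorem tensorField_add_left {A A' : ℤ → Module.End ℂ V} {B : ℤ → Module.End ℂ W}
    (hA : IsField A) (hA' : IsField A') (hB : IsField B) (hs : IsField (A + A')) :
    tensorField (A + A') B = tensorField A B + tensorField A' B := by
  funext n
  refine LinearMap.ext fun t => ?_
  rw [Pi.add_apply, LinearMap.add_apply, tensorField_apply hs hB, tensorField_apply hA hB,
    tensorField_apply hA' hB, ← finsum_add_distrib (tensor_finite hA hB n t)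
      (tensor_finite hA' hB n t)]
  refine finsum_congr fun k => ?_
  rw [Pi.add_apply, TensorProduct.map_add_left, LinearMap.add_apply]

theorem tensorField_add_right {A : ℤ → Module.End ℂ V} {B B' : ℤ → Module.End ℂ W}
    (hA : IsField A) (hB : IsField B) (hB' : IsField B') (hs : IsField (B + B')) :
    tensorField A (B + B') = tensorField A B + tensorField A B' := by
  funext n
  refine LinearMap.ext fun t => ?_
  rw [Pi.add_apply, LinearMap.add_apply, tensorField_apply hA hs, tensorField_apply hA hB,
    tensorField_apply hA hB', ← finsum_add_distrib (tensor_finite hA hB n t)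
      (tensor_finite hA hB' n t)]
  refine finsum_congr fun k => ?_
  rw [Pi.add_apply, TensorProduct.map_add_right, LinearMap.add_apply]

theorem tensorField_smul_left {A : ℤ → Module.End ℂ V} {B : ℤ → Module.End ℂ W} (c : ℂ)
    (hA : IsField A) (hB : IsField B) (hs : IsField (c • A)) :
    tensorField (c • A) B = c • tensorField A B := by
  funext n
  refine LinearMap.ext fun t => ?_
  rw [Pi.smul_apply, LinearMap.smul_apply, tensorField_apply hs hB, tensorField_apply hA hB,
    smul_finsum]
  refine finsum_congr fun k => ?_
  rw [Pi.smul_apply, TensorProduct.map_smul_left, LinearMap.smul_apply]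

theorem tensorField_smul_right {A : ℤ → Module.End ℂ V} {B : ℤ → Module.End ℂ W} (c : ℂ)
    (hA : IsField A) (hB : IsField B) (hs : IsField (c • B)) :
    tensorField A (c • B) = c • tensorField A B := by
  funext n
  refine LinearMap.ext fun t => ?_
  rw [Pi.smul_apply, LinearMap.smul_apply, tensorField_apply hA hs, tensorField_apply hA hB,
    smul_finsum]
  refine finsum_congr fun k => ?_
  rw [Pi.smul_apply, TensorProduct.map_smul_right, LinearMap.smul_apply]

namespace VertexSuperalgebra

/-- The state-field correspondence of the tensor product: `Y(a ⊗ b, z) = Y(a, z) ⊗ Y(b, z)`. -/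
def tensorMode (A : VertexSuperalgebra V) (B : VertexSuperalgebra W) :
    V ⊗[ℂ] W →ₗ[ℂ] (ℤ → Module.End ℂ (V ⊗[ℂ] W)) :=
  TensorProduct.lift (LinearMap.mk₂ ℂ (fun a b => tensorField (A.mode a) (B.mode b))
    (fun a a' b => by
      have h := A.truncation (a + a')
      rw [map_add] at h ⊢
      exact tensorField_add_left (A.truncation a) (A.truncation a') (B.truncation b) h)
    (fun c a b => by
      have h := A.truncation (c • a)
      rw [map_smul] at h ⊢
      exact tensorField_smul_left c (A.truncation a) (B.truncation b) h)
    (fun a b b' => by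
      have h := B.truncation (b + b')
      rw [map_add] at h ⊢
      exact tensorField_add_right (A.truncation a) (B.truncation b) (B.truncation b') h)
    (fun c a b => by
      have h := B.truncation (c • b)
      rw [map_smul] at h ⊢
      exact tensorField_smul_right c (A.truncation a) (B.truncation b) h))

theorem tensorMode_tmul (A : VertexSuperalgebra V) (B : VertexSuperalgebra W) (a : V) (b : W) :
    A.tensorMode B (a ⊗ₜ b) = tensorField (A.mode a) (B.mode b) := by
  rw [tensorMode, TensorProduct.lift.tmul, LinearMap.mk₂_apply]

theorem tensorMode_tmul_tmul (A : VertexSuperalgebra V) (B : VertexSuperalgebra W) (a c : V)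
    (b d : W) (n : ℤ) : A.tensorMode B (a ⊗ₜ b) n (c ⊗ₜ d) =
      ∑ᶠ k : ℤ, A.mode a k c ⊗ₜ[ℂ] B.mode b (n - 1 - k) d := by
  rw [tensorMode_tmul, tensorField_tmul (A.truncation a) (B.truncation b)]

theorem tensorMode_neg_two_vac (A : VertexSuperalgebra V) (B : VertexSuperalgebra W) (a : V)
    (b : W) : A.tensorMode B (a ⊗ₜ b) (-2) (A.vac ⊗ₜ B.vac) =
      A.mode a (-2) A.vac ⊗ₜ b + a ⊗ₜ B.mode b (-2) B.vac := by
  rw [tensorMode_tmul_tmul, finsum_eq_sum_of_support_subset (s := {-2, -1})]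
  · rw [Finset.sum_pair (by decide)]
    norm_num [A.mode_neg_one_vac, B.mode_neg_one_vac]
  · intro k hk
    by_contra hc
    simp only [Finset.coe_insert, Finset.coe_singleton, Set.mem_insert_iff,
      Set.mem_singleton_iff, not_or] at hc
    rcases le_or_gt 0 k with h | h
    · exact hk (by simp only [A.mode_vac a k h, zero_tmul])
    · exact hk (by simp only [B.mode_vac b (-2 - 1 - k) (by omega), tmul_zero])

/-- The tensor product of an (even) vertex algebra and a vertex superalgebra, with
`Y(a ⊗ b, z) = Y(a, z) ⊗ Y(b, z)`, that is
`(a ⊗ b)_(n) (c ⊗ d) = ∑ k, a_(k) c ⊗ b_(n-1-k) d`. Since the first factor is even, no signs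
appear. -/
def tensor (A : VertexSuperalgebra V) (hA : ∀ v, A.parity v = v) (B : VertexSuperalgebra W) :
    VertexSuperalgebra (V ⊗[ℂ] W) where
  vac := A.vac ⊗ₜ B.vac
  parity := TensorProduct.map LinearMap.id B.parity
  mode := A.tensorMode B
  parity_parity t := by
    induction t using TensorProduct.induction_on with
    | zero => simp
    | tmul v w => simp only [TensorProduct.map_tmul, LinearMap.id_apply, B.parity_parity]
    | add s t hs ht => rw [map_add, map_add, hs, ht]
  parity_vac := by simp only [TensorProduct.map_tmul, LinearMap.id_apply, B.parity_vac]
  parity_mode s n t := by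
    induction s using TensorProduct.induction_on with
    | zero => simp
    | add s s' hs hs' => simp only [map_add, Pi.add_apply, LinearMap.add_apply, hs, hs']
    | tmul a b =>
      induction t using TensorProduct.induction_on with
      | zero => simp
      | add t t' ht ht' => simp only [map_add, ht, ht']
      | tmul c d =>
        simp only [TensorProduct.map_tmul, LinearMap.id_apply, tensorMode_tmul_tmul]
        have := (TensorProduct.map (LinearMap.id : V →ₗ[ℂ] V) B.parity).toAddMonoidHom.map_finsum
          (tensor_finite' (A.truncation a) (B.truncation b) n c d)
        simp only [LinearMap.toAddMonoidHom_coe, TensorProduct.map_tmul, LinearMap.id_apply,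
          B.parity_mode] at this
        exact this
  truncation t := by
    induction t using TensorProduct.induction_on with
    | zero =>
      rw [map_zero]
      exact fun v => ⟨0, fun n _ => rfl⟩
    | tmul a b =>
      rw [tensorMode_tmul]
      exact tensorField_isField (A.truncation a) (B.truncation b)
    | add s t hs ht =>
      intro v
      obtain ⟨N, hN⟩ := hs v
      obtain ⟨M, hM⟩ := ht v
      refine ⟨max N M, fun n hn => ?_⟩
      rw [map_add, Pi.add_apply, LinearMap.add_apply, hN n (by omega), hM n (by omega), add_zero]
  vac_mode n t := by
    induction t using TensorProduct.induction_on with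
    | zero => simp
    | add s t hs ht =>
      rw [map_add, hs, ht]
      split <;> simp
    | tmul c d =>
      rw [tensorMode_tmul_tmul, finsum_eq_single _ (-1)]
      · simp only [A.vac_mode, B.vac_mode, if_true]
        by_cases h : n = -1
        · rw [if_pos (by omega), if_pos h]
        · rw [if_neg (by omega), if_neg h, tmul_zero]
      · intro k hk
        rw [A.vac_mode, if_neg hk, zero_tmul]
  mode_vac t n hn := by
    induction t using TensorProduct.induction_on with
    | zero => simp
    | add s t hs ht => rw [map_add, Pi.add_apply, LinearMap.add_apply, hs, ht, add_zero]
    | tmul a b =>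
      rw [tensorMode_tmul_tmul]
      refine finsum_eq_zero_of_forall_eq_zero fun k => ?_
      rcases le_or_gt 0 k with h | h
      · rw [A.mode_vac a k h, zero_tmul]
      · rw [B.mode_vac b _ (by omega), tmul_zero]
  mode_neg_one_vac t := by
    induction t using TensorProduct.induction_on with
    | zero => simp
    | add s t hs ht => rw [map_add, Pi.add_apply, LinearMap.add_apply, hs, ht]
    | tmul a b =>
      rw [tensorMode_tmul_tmul, finsum_eq_single _ (-1)]
      · rw [A.mode_neg_one_vac, show (-1 : ℤ) - 1 - -1 = -1 by norm_num, B.mode_neg_one_vac]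
      · intro k hk
        rcases le_or_gt 0 k with h | h
        · rw [A.mode_vac a k h, zero_tmul]
        · rw [B.mode_vac b _ (by omega), tmul_zero]
  translation s n t := by
    -- the translation operator is `T ⊗ 1 + 1 ⊗ T`
    let TA : V →ₗ[ℂ] V := (LinearMap.applyₗ A.vac).comp ((LinearMap.proj (-2)).comp A.mode)
    let TB : W →ₗ[ℂ] W := (LinearMap.applyₗ B.vac).comp ((LinearMap.proj (-2)).comp B.mode)
    let TT : V ⊗[ℂ] W →ₗ[ℂ] V ⊗[ℂ] W :=
      TensorProduct.map TA LinearMap.id + TensorProduct.map LinearMap.id TB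
    have hT : ∀ t, A.tensorMode B t (-2) (A.vac ⊗ₜ B.vac) = TT t := by
      intro t
      induction t using TensorProduct.induction_on with
      | zero => simp
      | add s t hs ht => rw [map_add, Pi.add_apply, LinearMap.add_apply, hs, ht, map_add]
      | tmul a b => rw [tensorMode_neg_two_vac]; rfl
    rw [hT, hT]
    induction s using TensorProduct.induction_on with
    | zero => simp
    | add s s' hs hs' =>
      simp only [map_add, Pi.add_apply, LinearMap.add_apply, smul_add, ← hs, ← hs']
      abel
    | tmul a b =>
      induction t using TensorProduct.induction_on with
      | zero => simp
      | add t t' ht ht' =>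
        simp only [map_add, smul_add, ← ht, ← ht']
        abel
      | tmul c d =>
        have fA := A.truncation a
        have fB := B.truncation b
        have g0 := tensor_finite' fA fB n c d
        have g1 := tensor_finite' fA fB n (TA c) d
        have g2 := tensor_finite' fA fB n c (TB d)
        have g3 := tensor_finite' fA fB (n - 1) c d
        have g0' : (Function.support fun k : ℤ =>
            TT (A.mode a k c ⊗ₜ[ℂ] B.mode b (n - 1 - k) d)).Finite :=
          g0.subset (Function.support_comp_subset (map_zero TT) _)
        have m0 := TT.toAddMonoidHom.map_finsum g0
        simp only [LinearMap.toAddMonoidHom_coe] at m0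
        have hc : TT (c ⊗ₜ d) = TA c ⊗ₜ d + c ⊗ₜ TB d := rfl
        rw [hc, map_add, tensorMode_tmul_tmul, tensorMode_tmul_tmul, tensorMode_tmul_tmul,
          tensorMode_tmul_tmul, m0, ← finsum_add_distrib g1 g2,
          ← finsum_sub_distrib g0' ((g1.union g2).subset (Function.support_add _ _))]
        -- termwise identity and reindexing
        let u : ℤ → V ⊗[ℂ] W := fun k => (k : ℂ) •
          (A.mode a (k - 1) c ⊗ₜ[ℂ] B.mode b (n - 1 - k) d)
        have hu : (Function.support u).Finite := by
          have g := (g3.preimage (f := fun k : ℤ => k - 1)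
            (fun a _ b _ hab => by simpa using hab))
          refine g.subset fun k hk h0 => hk ?_
          change A.mode a (k - 1) c ⊗ₜ[ℂ] B.mode b (n - 1 - 1 - (k - 1)) d = 0 at h0
          rw [show n - 1 - 1 - (k - 1) = n - 1 - k by ring] at h0
          simp only [u, h0, smul_zero]
        have hu' : (Function.support fun k => u (k + 1)).Finite :=
          hu.preimage (f := fun k : ℤ => k + 1) (fun a _ b _ hab => by simpa using hab)
        have hsum : ∑ᶠ k, u (k + 1) = ∑ᶠ k, u k := finsum_comp_equiv (Equiv.addRight (1 : ℤ))
        have term : ∀ k : ℤ, TT (A.mode a k c ⊗ₜ[ℂ] B.mode b (n - 1 - k) d) -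
            (A.mode a k (TA c) ⊗ₜ[ℂ] B.mode b (n - 1 - k) d +
              A.mode a k c ⊗ₜ[ℂ] B.mode b (n - 1 - k) (TB d)) =
            (-n : ℂ) • (A.mode a k c ⊗ₜ[ℂ] B.mode b (n - 1 - 1 - k) d) + (u (k + 1) - u k) := by
          intro k
          have e1 := A.translation a k c
          have e2 := B.translation b (n - 1 - k) d
          change TA (A.mode a k c) - A.mode a k (TA c) = _ at e1
          change TB (B.mode b (n - 1 - k) d) - B.mode b (n - 1 - k) (TB d) = _ at e2
          have e3 : TT (A.mode a k c ⊗ₜ[ℂ] B.mode b (n - 1 - k) d) =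
            TA (A.mode a k c) ⊗ₜ B.mode b (n - 1 - k) d +
              A.mode a k c ⊗ₜ TB (B.mode b (n - 1 - k) d) := rfl
          rw [e3, eq_add_of_sub_eq e1, eq_add_of_sub_eq e2]
          simp only [u, add_sub_cancel_right, add_tmul, tmul_add, smul_tmul', tmul_smul,
            show n - 1 - (k + 1) = n - 1 - 1 - k by ring, show n - 1 - k - 1 = n - 1 - 1 - k by ring]
          simp only [← smul_tmul']
          push_cast
          module
        rw [finsum_congr term, finsum_add_distrib ?_ ?_, finsum_sub_distrib hu' hu, hsum, sub_self,
          add_zero, smul_finsum]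
        · refine g3.subset fun k hk h0 => hk ?_
          simp only [h0, smul_zero]
        · exact (hu'.union hu).subset (Function.support_sub _ _)
  locality s t p q hs ht := by
    have key : ∀ (p : ℕ) (s : V ⊗[ℂ] W),
        TensorProduct.map LinearMap.id B.parity s = (-1 : ℂ) ^ p • s →
        s ∈ Submodule.span ℂ {s : V ⊗[ℂ] W | ∃ a b, B.parity b = (-1 : ℂ) ^ p • b ∧ s = a ⊗ₜ b} := by
      intro p s hs
      have h : s + (-1 : ℂ) ^ p • TensorProduct.map LinearMap.id B.parity s ∈
          Submodule.span ℂ {s : V ⊗[ℂ] W | ∃ a b, B.parity b = (-1 : ℂ) ^ p • b ∧ s = a ⊗ₜ b} := by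
        clear hs
        induction s using TensorProduct.induction_on with
        | zero => simp
        | add s t hs ht =>
          rw [map_add, smul_add, add_add_add_comm]
          exact Submodule.add_mem _ hs ht
        | tmul a b =>
          refine Submodule.subset_span ⟨a, b + (-1 : ℂ) ^ p • B.parity b, ?_, ?_⟩
          · rw [map_add, map_smul, B.parity_parity, smul_add, smul_smul,
              GeneratingFields.sign_sq, one_smul, add_comm]
          · rw [TensorProduct.map_tmul, LinearMap.id_apply, tmul_add, tmul_smul]
      rw [hs, smul_smul, GeneratingFields.sign_sq, one_smul, ← two_smul ℂ] at h
      have := Submodule.smul_mem _ (2⁻¹ : ℂ) h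
      rwa [smul_smul, inv_mul_cancel₀ two_ne_zero, one_smul] at this
    have hs' := key p s hs
    have ht' := key q t ht
    clear hs ht
    induction hs' using Submodule.span_induction with
    | zero => rw [map_zero]; exact Local.zero_left
    | add s s' _ _ h h' => rw [map_add]; exact Local.add_left h h'
    | smul c s _ h => rw [map_smul]; exact Local.smul_left h
    | mem s hs =>
      obtain ⟨a, b, hb, rfl⟩ := hs
      refine Local.symm (GeneratingFields.sign_sq _) ?_
      induction ht' using Submodule.span_induction with
      | zero => rw [map_zero]; exact Local.zero_left
      | add s s' _ _ h h' => rw [map_add]; exact Local.add_left h h'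
      | smul c s _ h => rw [map_smul]; exact Local.smul_left h
      | mem t ht =>
        obtain ⟨c, d, hd, rfl⟩ := ht
        rw [tensorMode_tmul, tensorMode_tmul]
        have hl := A.locality c a 0 0 (by rw [hA]; simp) (by rw [hA]; simp)
        have hr := B.locality d b q p hd hb
        rw [mul_comm] at hr
        simp only [mul_zero, pow_zero] at hl
        exact tensorField_local (A.truncation c) (B.truncation d) (A.truncation a)
          (B.truncation b) hl hr

/-! ### Subalgebras, ideals, quotients, isomorphisms -/

/-- A vertex subalgebra: a `ℤ/2`-graded subspace which contains the vacuum and is closed under all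
products `a_(n) b`. -/
structure IsSubalgebra (A : VertexSuperalgebra V) (S : Submodule ℂ V) : Prop where
  vac_mem : A.vac ∈ S
  parity_mem : ∀ a ∈ S, A.parity a ∈ S
  mode_mem : ∀ a ∈ S, ∀ n, ∀ b ∈ S, A.mode a n b ∈ S

/-- The induced structure on a vertex subalgebra. -/
def restrict (A : VertexSuperalgebra V) (S : Submodule ℂ V) (hS : A.IsSubalgebra S) :
    VertexSuperalgebra S where
  vac := ⟨A.vac, hS.vac_mem⟩
  parity := A.parity.restrict hS.parity_mem
  mode :=
    { toFun := fun a n => (A.mode a n).restrict fun b hb => hS.mode_mem a a.2 n b hb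
      map_add' := fun a b => by
        funext n
        refine LinearMap.ext fun c => Subtype.ext ?_
        simp
      map_smul' := fun r a => by
        funext n
        refine LinearMap.ext fun c => Subtype.ext ?_
        simp }
  parity_parity a := Subtype.ext (A.parity_parity a)
  parity_vac := Subtype.ext A.parity_vac
  parity_mode a n b := Subtype.ext (A.parity_mode a n b)
  truncation a b := by
    obtain ⟨N, hN⟩ := A.truncation a b
    exact ⟨N, fun n hn => Subtype.ext (hN n hn)⟩
  vac_mode n b := Subtype.ext ((A.vac_mode n b).trans (by split <;> rfl))
  mode_vac a n hn := Subtype.ext (A.mode_vac a n hn)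
  mode_neg_one_vac a := Subtype.ext (A.mode_neg_one_vac a)
  translation a n b := Subtype.ext (A.translation a n b)
  locality a b p q ha hb := by
    obtain ⟨N, hN⟩ := A.locality a b p q (congrArg Subtype.val ha) (congrArg Subtype.val hb)
    refine ⟨N, ?_⟩
    funext m n
    refine LinearMap.ext fun c => Subtype.ext ?_
    have h1 := mulSub_pow_map (LinearMap.applyₗ (c : V)) N
      (fun m n => A.mode a m * A.mode b n - ((-1 : ℂ) ^ (p * q)) • (A.mode b n * A.mode a m)) m n
    rw [hN] at h1
    refine Eq.trans ?_ h1
    exact (mulSub_pow_map (S.subtype.comp (LinearMap.applyₗ c)) N _ m n).symm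

/-- A (two-sided, `ℤ/2`-graded) ideal. -/
structure IsIdeal (A : VertexSuperalgebra V) (I : Submodule ℂ V) : Prop where
  parity_mem : ∀ a ∈ I, A.parity a ∈ I
  mode_mem_right : ∀ a n, ∀ b ∈ I, A.mode a n b ∈ I
  mode_mem_left : ∀ a ∈ I, ∀ n b, A.mode a n b ∈ I

/-- The quotient by an ideal. -/
def quotient (A : VertexSuperalgebra V) (I : Submodule ℂ V) (hI : A.IsIdeal I) :
    VertexSuperalgebra (V ⧸ I) where
  vac := I.mkQ A.vac
  parity := I.mapQ I A.parity hI.parity_mem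
  mode := I.liftQ
    { toFun := fun a n => I.mapQ I (A.mode a n) fun b hb => hI.mode_mem_right a n b hb
      map_add' := fun a b => by
        funext n
        refine Submodule.linearMap_qext _ (LinearMap.ext fun c => ?_)
        simp
      map_smul' := fun r a => by
        funext n
        refine Submodule.linearMap_qext _ (LinearMap.ext fun c => ?_)
        simp }
    (fun a ha => by
      rw [LinearMap.mem_ker]
      funext n
      refine Submodule.linearMap_qext _ (LinearMap.ext fun c => ?_)
      exact (Submodule.Quotient.mk_eq_zero I).2 (hI.mode_mem_left a ha n c))
  parity_parity a := by
    obtain ⟨a, rfl⟩ := I.mkQ_surjective a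
    exact congrArg I.mkQ (A.parity_parity a)
  parity_vac := congrArg I.mkQ A.parity_vac
  parity_mode a n b := by
    obtain ⟨a, rfl⟩ := I.mkQ_surjective a
    obtain ⟨b, rfl⟩ := I.mkQ_surjective b
    exact congrArg I.mkQ (A.parity_mode a n b)
  truncation a b := by
    obtain ⟨a, rfl⟩ := I.mkQ_surjective a
    obtain ⟨b, rfl⟩ := I.mkQ_surjective b
    obtain ⟨N, hN⟩ := A.truncation a b
    exact ⟨N, fun n hn => (congrArg I.mkQ (hN n hn)).trans (map_zero _)⟩
  vac_mode n b := by
    obtain ⟨b, rfl⟩ := I.mkQ_surjective b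
    exact (congrArg I.mkQ (A.vac_mode n b)).trans (by split <;> simp)
  mode_vac a n hn := by
    obtain ⟨a, rfl⟩ := I.mkQ_surjective a
    exact (congrArg I.mkQ (A.mode_vac a n hn)).trans (map_zero _)
  mode_neg_one_vac a := by
    obtain ⟨a, rfl⟩ := I.mkQ_surjective a
    exact congrArg I.mkQ (A.mode_neg_one_vac a)
  translation a n b := by
    obtain ⟨a, rfl⟩ := I.mkQ_surjective a
    obtain ⟨b, rfl⟩ := I.mkQ_surjective b
    exact congrArg I.mkQ (A.translation a n b)
  locality a b p q ha hb := by
    -- lift homogeneous elements to homogeneous elements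
    have key : ∀ (p : ℕ) (a : V ⧸ I), I.mapQ I A.parity hI.parity_mem a = (-1 : ℂ) ^ p • a →
        ∃ a', A.parity a' = (-1 : ℂ) ^ p • a' ∧ I.mkQ a' = a := by
      intro p a ha
      obtain ⟨a, rfl⟩ := I.mkQ_surjective a
      refine ⟨(2⁻¹ : ℂ) • (a + (-1 : ℂ) ^ p • A.parity a), ?_, ?_⟩
      · rw [map_smul, map_add, map_smul, A.parity_parity, smul_comm ((-1 : ℂ) ^ p) (2⁻¹ : ℂ),
          smul_add ((-1 : ℂ) ^ p), smul_smul ((-1 : ℂ) ^ p), GeneratingFields.sign_sq, one_smul,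
          add_comm]
      · have : I.mkQ (A.parity a) = (-1 : ℂ) ^ p • I.mkQ a := ha
        rw [map_smul, map_add, map_smul, this, smul_smul, GeneratingFields.sign_sq, one_smul,
          ← two_smul ℂ, smul_smul, inv_mul_cancel₀ two_ne_zero, one_smul]
    obtain ⟨a, ha', rfl⟩ := key p a ha
    obtain ⟨b, hb', rfl⟩ := key q b hb
    obtain ⟨N, hN⟩ := A.locality a b p q ha' hb'
    refine ⟨N, ?_⟩
    funext m n
    refine Submodule.linearMap_qext _ (LinearMap.ext fun c => ?_)
    have h1 := mulSub_pow_map (I.mkQ.comp (LinearMap.applyₗ c)) N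
      (fun m n => A.mode a m * A.mode b n - ((-1 : ℂ) ^ (p * q)) • (A.mode b n * A.mode a m)) m n
    rw [hN] at h1
    refine Eq.trans ?_ (h1.trans (map_zero (I.mkQ.comp (LinearMap.applyₗ c))))
    exact (mulSub_pow_map (LinearMap.applyₗ (I.mkQ c)) N _ m n).symm

/-- The sum of all proper ideals. -/
def maxIdeal (A : VertexSuperalgebra V) : Submodule ℂ V := sSup {I | A.IsIdeal I ∧ I ≠ ⊤}

theorem isIdeal_maxIdeal (A : VertexSuperalgebra V) : A.IsIdeal A.maxIdeal where
  parity_mem := by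
    change A.maxIdeal ≤ A.maxIdeal.comap A.parity
    exact sSup_le fun I hI a ha => (le_sSup hI : I ≤ A.maxIdeal) (hI.1.parity_mem a ha)
  mode_mem_right a n := by
    change A.maxIdeal ≤ A.maxIdeal.comap (A.mode a n)
    exact sSup_le fun I hI b hb => (le_sSup hI : I ≤ A.maxIdeal) (hI.1.mode_mem_right a n b hb)
  mode_mem_left := by
    intro a ha n b
    have h : A.maxIdeal ≤ A.maxIdeal.comap
        ((LinearMap.applyₗ b).comp ((LinearMap.proj n).comp A.mode)) :=
      sSup_le fun I hI a ha => (le_sSup hI : I ≤ A.maxIdeal) (hI.1.mode_mem_left a ha n b)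
    exact h ha

/-- The quotient of a vertex superalgebra by the sum of its proper ideals. If this sum is itself
proper, it is the unique maximal ideal and the quotient is the simple quotient. -/
def simpleQuotient (A : VertexSuperalgebra V) : VertexSuperalgebra (V ⧸ A.maxIdeal) :=
  A.quotient A.maxIdeal A.isIdeal_maxIdeal

/-- Isomorphisms of vertex superalgebras. -/
structure Iso (A : VertexSuperalgebra V) (B : VertexSuperalgebra W) extends V ≃ₗ[ℂ] W where
  map_vac : toLinearEquiv A.vac = B.vac
  map_parity : ∀ a, toLinearEquiv (A.parity a) = B.parity (toLinearEquiv a)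
  map_mode : ∀ a n b, toLinearEquiv (A.mode a n b) =
    B.mode (toLinearEquiv a) n (toLinearEquiv b)

end VertexSuperalgebra

/-! ### The Weyl vertex algebra, the Clifford vertex superalgebra and their tensor product -/

/-- The generators `a`, `a*` of the Weyl algebra. -/
inductive WeylGen
  | a
  | aStar
  deriving DecidableEq

instance : Fintype WeylGen := ⟨{.a, .aStar}, fun x => by cases x <;> decide⟩

/-- The Weyl algebra: generators `a(n)`, `a*(n)` with `[a(n), a*(m)] = δ_(n+m,0)`, all other
commutators being zero. As fields `a(z) = ∑ a(n) z^(-n-1)` and `a*(z) = ∑ a*(n) z^(-n)`, so that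
`a_(n) = a(n)` and `a*_(n) = a*(n+1)`; hence `[a_(m), a*_(n)] = δ_(m+n,-1)`. -/
abbrev weylData : CurrentData where
  ι := WeylGen
  par _ := 0
  bracket _ _ _ := 0
  pairing₀
    | .a, .aStar => 1
    | .aStar, .a => -1
    | _, _ => 0
  pairing₁ _ _ := 0
  par_bracket _ _ _ h := absurd rfl h
  par_pairing₀ _ _ _ := by simp
  par_pairing₁ _ _ h := absurd rfl h

/-- The space of the Weyl vertex algebra: the module over the Weyl algebra generated by `1` with
`a(n) 1 = a*(n+1) 1 = 0` for `n ≥ 0`. -/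
abbrev M : Type := weylData.VacModule

/-- The Weyl vertex algebra. -/
def weylVA : VertexSuperalgebra M := weylData.vertexSuperalgebra

theorem weylVA_even (v : M) : weylVA.parity v = v := weylData.parity_eq_id (fun _ => rfl) v

/-- The generators `ψ`, `ψ*` of the Clifford algebra. -/
inductive CliffordGen
  | psi
  | psiStar
  deriving DecidableEq

instance : Fintype CliffordGen := ⟨{.psi, .psiStar}, fun x => by cases x <;> decide⟩

/-- The Clifford algebra: odd generators `ψ(r)`, `ψ*(r)`, `r ∈ 1/2 + ℤ`, with anticommutators
`[ψ(r), ψ*(s)] = δ_(r+s,0)`, all other anticommutators being zero. As fields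
`ψ(z) = ∑ ψ(n+1/2) z^(-n-1)` and `ψ*(z) = ∑ ψ*(n+1/2) z^(-n-1)`, so that `ψ_(n) = ψ(n+1/2)` and
`ψ*_(n) = ψ*(n+1/2)`; hence `[ψ_(m), ψ*_(n)] = δ_(m+n,-1)`. -/
abbrev cliffordData : CurrentData where
  ι := CliffordGen
  par _ := 1
  bracket _ _ _ := 0
  pairing₀
    | .psi, .psiStar => 1
    | .psiStar, .psi => 1
    | _, _ => 0
  pairing₁ _ _ := 0
  par_bracket _ _ _ h := absurd rfl h
  par_pairing₀ _ _ _ := by norm_num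
  par_pairing₁ _ _ h := absurd rfl h

/-- The space of the Clifford vertex superalgebra: the module over the Clifford algebra generated
by `1` with `ψ(r) 1 = ψ*(r) 1 = 0` for `r > 0`. -/
abbrev F : Type := cliffordData.VacModule

/-- The Clifford vertex superalgebra. -/
def cliffordVA : VertexSuperalgebra F := cliffordData.vertexSuperalgebra

/-- The vertex superalgebra `𝒰 = M ⊗ F`. -/
def U : VertexSuperalgebra (M ⊗[ℂ] F) := weylVA.tensor weylVA_even cliffordVA

/-- The state `a = a(-1) 1`. -/
def a : M := weylData.state .a

/-- The state `a* = a*(0) 1`. -/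
def aStar : M := weylData.state .aStar

/-- The state `ψ = ψ(-1/2) 1`. -/
def psi : F := cliffordData.state .psi

/-- The state `ψ* = ψ*(-1/2) 1`. -/
def psiStar : F := cliffordData.state .psiStar

/-- The Heisenberg vector `β = a(-1) a*(0) 1` of level `-1`. -/
def beta : M := weylVA.mode a (-1) aStar

/-- The Heisenberg vector `γ = ψ(-1/2) ψ*(-1/2) 1` of level `1`. -/
def gamma : F := cliffordVA.mode psi (-1) psiStar

/-- The vector `Ψ⁺ = a(-1) ψ`. -/
def PsiP : M ⊗[ℂ] F := a ⊗ₜ psi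

/-- The vector `Ψ⁻ = a*(0) ψ*`. -/
def PsiM : M ⊗[ℂ] F := aStar ⊗ₜ psiStar

/-- The vector `E = γ + β`. -/
def vecE : M ⊗[ℂ] F := weylVA.vac ⊗ₜ gamma + beta ⊗ₜ cliffordVA.vac

/-- The vector `N = (γ - β) / 2`. -/
def vecN : M ⊗[ℂ] F := (2⁻¹ : ℂ) • (weylVA.vac ⊗ₜ gamma - beta ⊗ₜ cliffordVA.vac)

/-- The kernel `𝒰⁰` of `E(0)` on `𝒰 = M ⊗ F`. -/
def U0 : Submodule ℂ (M ⊗[ℂ] F) := LinearMap.ker (U.mode vecE 0)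

/-! ### The affine vertex superalgebras of `gl(1|1)` -/

/-- The basis `E`, `N` (even), `Ψ⁺`, `Ψ⁻` (odd) of the Lie superalgebra `gl(1|1)`. -/
inductive Gl11
  | E
  | N
  | PsiP
  | PsiM
  deriving DecidableEq

instance : Fintype Gl11 := ⟨{.E, .N, .PsiP, .PsiM}, fun x => by cases x <;> decide⟩

namespace Gl11

/-- Parity of the basis elements. -/
def par : Gl11 → ℕ
  | .E => 0
  | .N => 0
  | .PsiP => 1
  | .PsiM => 1

/-- Structure constants of `gl(1|1)`: `bracket x y z` is the coefficient of `z` in `[x, y]`, where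
`[Ψ⁺, Ψ⁻] = [Ψ⁻, Ψ⁺] = E`, `[N, Ψ^±] = -[Ψ^±, N] = ±Ψ^±`, all other brackets being zero. -/
def bracket : Gl11 → Gl11 → Gl11 → ℂ
  | .PsiP, .PsiM, .E => 1
  | .PsiM, .PsiP, .E => 1
  | .N, .PsiP, .PsiP => 1
  | .PsiP, .N, .PsiP => -1
  | .N, .PsiM, .PsiM => -1
  | .PsiM, .N, .PsiM => 1
  | _, _, _ => 0

/-- The invariant supersymmetric bilinear form: `(N, E) = (E, N) = 1`,
`(Ψ⁺, Ψ⁻) = -(Ψ⁻, Ψ⁺) = 1`, all other products being zero. -/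
def form : Gl11 → Gl11 → ℂ
  | .N, .E => 1
  | .E, .N => 1
  | .PsiP, .PsiM => 1
  | .PsiM, .PsiP => -1
  | _, _ => 0

end Gl11

/-- The affine Lie superalgebra of `gl(1|1)` with the central element acting as `k`:
`[x_(m), y_(n)] = [x, y]_(m+n) + m δ_(m+n,0) (x, y) k`. -/
abbrev affineData (k : ℂ) : CurrentData where
  ι := Gl11
  par := Gl11.par
  bracket := Gl11.bracket
  pairing₀ _ _ := 0
  pairing₁ x y := k * Gl11.form x y
  par_bracket x y z h := by
    cases x <;> cases y <;> cases z <;> simp [Gl11.bracket, Gl11.par] at h ⊢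
  par_pairing₀ _ _ h := absurd rfl h
  par_pairing₁ x y h := by
    cases x <;> cases y <;> simp [Gl11.form, Gl11.par] at h ⊢

/-- The universal affine vertex superalgebra `V^k(gl(1|1))`, on the vacuum module of level `k`. -/
def universalAffine (k : ℂ) : VertexSuperalgebra (affineData k).VacModule :=
  (affineData k).vertexSuperalgebra

/-- The space of the simple affine vertex superalgebra `V_k(gl(1|1))`. -/
abbrev SimpleAffineSpace (k : ℂ) : Type :=
  (affineData k).VacModule ⧸ (universalAffine k).maxIdeal

/-- The simple affine vertex superalgebra `V_k(gl(1|1))`: the simple quotient of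
`V^k(gl(1|1))`. -/
def simpleAffine (k : ℂ) : VertexSuperalgebra (SimpleAffineSpace k) :=
  (universalAffine k).simpleQuotient

/-- The vector `x(-1) 1` of `V_k(gl(1|1))`, for a basis element `x` of `gl(1|1)`. -/
def simpleAffineState (k : ℂ) (x : Gl11) : SimpleAffineSpace k :=
  (universalAffine k).maxIdeal.mkQ ((affineData k).state x)

/-- The vectors `E`, `N`, `Ψ⁺`, `Ψ⁻` of `𝒰`. -/
def vec : Gl11 → M ⊗[ℂ] F
  | .E => vecE
  | .N => vecN
  | .PsiP => PsiP
  | .PsiM => PsiM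

end VertexAlg

end

noncomputable section

namespace VertexAlg

open TensorProduct

/-! ### Distributions killed by a power of `z - w`, and Dong's lemma for non-negative products -/

section Distributions

variable {E V : Type*} [AddCommGroup E] [Module ℂ E] [AddCommGroup V] [Module ℂ V]

/-! The four vectors `E`, `N`, `Ψ⁺`, `Ψ⁻` of `𝒰` have the operator product expansions of `gl(1|1)`
at level 1 (`hasOPE_vec`), so the universal property of the vacuum module gives a homomorphism
`affineHom` from `V¹(gl(1|1))` to `𝒰`. Its image lies in `𝒰⁰`, because `E` is central in `gl(1|1)`
and `E(0)` is a derivation of all products. It remains to see that the image is all of `𝒰⁰` and that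
the kernel is the sum of all proper ideals. Both rest on `eq_U0_of_preserves`: a non-zero subspace
of `𝒰⁰` stable under the modes of the four vectors is `𝒰⁰` itself.

For this irreducibility, view `𝒰` as a Fock space for the free fields `a`, `a*`, `ψ`, `ψ*`.
Annihilation operators bring any non-zero vector down to a non-zero multiple of the vacuum, so `𝒰`
is irreducible under the free fields (`eq_top_of_letter_mem`). The operator `E(0)` grades `𝒰` by
charge; each generator has charge `1` or `-1`, and `𝒰⁰` is the part of charge zero. If `S ⊆ 𝒰⁰` is
non-zero and stable under products of two modes of opposite charge, then the spaces obtained by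
applying generators to `S` add up to `𝒰`, and comparison in charge zero gives `S = 𝒰⁰`
(`eq_U0_of_pairs_mem`).

So it suffices to recover such pairs of modes from the affine fields. The vector `γ = E/2 + N`
yields all `ψ_(-k) ψ*` by the boson-fermion recursion coming from `∂ψ = :γψ:`. The products `Ψ⁺_(-k)
Ψ⁻` then yield all `a_(-k) a*` (`preserves_aPair`). Their fields are the normally ordered products
of `a*` with derivatives of `a`, and interpolation by polynomials in the mode index isolates the
products `a_(m) a*_(n)` (`mode_mul_mode_mem`). The other pairs follow by (anti)commutators.

The image of `affineHom` is stable and contains the vacuum, which is non-zero by Fock realizations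
on polynomial and exterior algebras (`U_vac_ne_zero`); so it is `𝒰⁰`. The image of a proper ideal
`I` is `0` or `𝒰⁰`. In the second case some `u ∈ I` maps to the vacuum. For the conformal vector
`sugawara`, `L(0)` is diagonalizable with the vacuum spanning weight zero and all other weights
positive, so a polynomial in `L(0)` turns `u` into a non-zero multiple of the vacuum inside `I`, a
contradiction. Hence the kernel is the largest proper ideal (`maxIdeal_eq_ker`).

The calculus of fields behind all this comes from Goddard's uniqueness theorem `eq_mode_of_local`,
which identifies the fields of `a_(n) b` and gives the commutator formula. -/

theorem mulSub_apply (f : ℤ → ℤ → E) (m n : ℤ) : mulSub f m n = f (m + 1) n - f m (n + 1) := rfl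

/-- A property of distributions which is stable under `mulSub` passes to its powers. -/
theorem mulSub_pow_induction {P : (ℤ → ℤ → E) → Prop} (hP : ∀ f, P f → P (mulSub f))
    {f : ℤ → ℤ → E} (hf : P f) (j : ℕ) : P ((mulSub ^ j) f) := by
  induction j with
  | zero => exact hf
  | succ j ih => rw [pow_succ', Module.End.mul_apply]; exact hP _ ih

/-- A distribution killed by a power of `z - w` is a combination of derivatives of the
delta distribution. -/
theorem eq_sum_of_mulSub_pow {N : ℕ} {f : ℤ → ℤ → E} (hf : (mulSub ^ N) f = 0) (m n : ℤ) :
    f m n = ∑ j ∈ Finset.range N,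
      ((Ring.choose m j : ℤ) : ℂ) • (mulSub ^ j) f 0 (m + n - j) := by
  induction N generalizing f m n with
  | zero =>
    rw [pow_zero, Module.End.one_apply] at hf
    simp [hf]
  | succ N ih =>
    set R : ℤ → ℤ → E := fun m n => ∑ j ∈ Finset.range (N + 1),
      ((Ring.choose m j : ℤ) : ℂ) • (mulSub ^ j) f 0 (m + n - j) with hR
    have hg : (mulSub ^ N) (mulSub f) = 0 := by rw [← Module.End.mul_apply, ← pow_succ, hf]
    -- Both sides have the same image under `mulSub`: Pascal's rule turns the difference of the
    -- binomials into the expansion of `mulSub f`, which is the induction hypothesis. As `R` and `f`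
    -- also agree at `m = 0`, they agree for all integers `m`, by moving up and down one step at a
    -- time.
    have step : ∀ m n, R (m + 1) n - R m (n + 1) = f (m + 1) n - f m (n + 1) := by
      intro m n
      rw [← mulSub_apply f, ih hg m n, hR]
      simp only
      rw [← Finset.sum_sub_distrib, Finset.sum_range_succ']
      simp only [Ring.choose_zero_right, Nat.cast_zero, sub_zero, pow_zero, Module.End.one_apply,
        show m + 1 + n = m + (n + 1) by ring, sub_self, add_zero]
      refine Finset.sum_congr rfl fun j _ => ?_
      rw [Ring.choose_succ_succ, ← sub_smul, ← Module.End.mul_apply, ← pow_succ,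
        show m + (n + 1) - ((j + 1 : ℕ) : ℤ) = m + n - j by push_cast; ring]
      congr 1
      push_cast
      ring
    have h0 : ∀ n, R 0 n = f 0 n := by
      intro n
      rw [hR]
      simp only
      rw [Finset.sum_range_succ', Finset.sum_eq_zero]
      · simp
      · intro j _
        rw [Ring.choose_zero_succ]
        simp
    have key : ∀ k : ℕ, ∀ n, R k n = f k n ∧ R (-k) n = f (-k) n := by
      intro k
      induction k with
      | zero => intro n; simp [h0]
      | succ k ihk =>
        intro n
        constructor
        · have h1 := step k n
          rw [(ihk (n + 1)).1] at h1
          have := sub_left_injective h1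
          exact_mod_cast this
        · have h1 := step (-(k : ℤ) - 1) (n - 1)
          rw [sub_add_cancel, sub_add_cancel, (ihk (n - 1)).2] at h1
          have := sub_right_injective h1
          rw [show -((k + 1 : ℕ) : ℤ) = -(k : ℤ) - 1 by push_cast; ring]
          exact this
    rcases Int.eq_nat_or_neg m with ⟨k, rfl | rfl⟩
    · exact (key k n).1.symm
    · exact (key k n).2.symm

/-- The supercommutator of two formal distributions. -/
def superComm (ε : ℂ) (A B : ℤ → Module.End ℂ V) (m n : ℤ) : Module.End ℂ V :=
  A m * B n - ε • (B n * A m)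

/-- The `j`-th product, `j ≥ 0`, of two formal distributions. -/
def natProd (ε : ℂ) (A B : ℤ → Module.End ℂ V) (j : ℕ) (n : ℤ) : Module.End ℂ V :=
  (mulSub ^ j) (superComm ε A B) 0 n

/-- Dong's lemma for the products of non-negative index. -/
theorem Local.natProd_left {ε₁ ε₂ ε₃ : ℂ} {A B C : ℤ → Module.End ℂ V}
    (hAB : Local ε₁ A B) (hAC : Local ε₂ A C) (hBC : Local ε₃ B C) (j : ℕ) :
    Local (ε₂ * ε₃) (natProd ε₁ A B j) C := by
  obtain ⟨N₁, h₁⟩ := hAB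
  obtain ⟨N₂, h₂⟩ := hAC
  obtain ⟨N₃, h₃⟩ := hBC
  set f := superComm ε₁ A B with hf
  let L (k : ℤ) : Module.End ℂ V →ₗ[ℂ] Module.End ℂ V :=
    LinearMap.mulRight ℂ (C k) - (ε₂ * ε₃) • LinearMap.mulLeft ℂ (C k)
  set G : ℤ → ℤ → ℤ → Module.End ℂ V := fun p m k => L k (f p m) with hG
  have hG12 : (mulSub12 ^ N₁) G = 0 := by
    funext p m k
    rw [mulSub12_pow, hG]
    simp only
    rw [mulSub_pow_map, show (mulSub ^ N₁) f = 0 from h₁]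
    exact map_zero _
  have hG3 : (mulSub13 ^ N₂) ((mulSub23 ^ N₃) G) = 0 := by
    have kill : ∀ (g₁ g₂ : ℤ → ℤ → ℤ → Module.End ℂ V),
        (∀ p, (mulSub ^ N₃) (fun m k => g₁ p m k) = 0) →
        (∀ m, (mulSub ^ N₂) (fun p k => g₂ p m k) = 0) →
        (mulSub13 ^ N₂) ((mulSub23 ^ N₃) (g₁ + g₂)) = 0 := by
      intro g₁ g₂ k₁ k₂
      have e₁ : (mulSub23 ^ N₃) g₁ = 0 := by
        funext p m k
        rw [mulSub23_pow, k₁]; rfl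
      have e₂ : (mulSub13 ^ N₂) g₂ = 0 := by
        funext p m k
        rw [mulSub13_pow, k₂]; rfl
      rw [map_add, e₁, zero_add, ← Module.End.mul_apply, (commute_13_23.pow_pow N₂ N₃).eq,
        Module.End.mul_apply, e₂, map_zero]
    -- Super Jacobi identity: `[[A, B], C]` is a combination of a term containing `[B, C]`, killed
    -- by a power of `z₂ - z₃`, and one containing `[A, C]`, killed by a power of `z₁ - z₃`.
    have := kill
      (fun p m k => (LinearMap.mulLeft ℂ (A p) - (ε₁ * ε₂) • LinearMap.mulRight ℂ (A p))
        (B m * C k - ε₃ • (C k * B m)))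
      (fun p m k => (ε₃ • LinearMap.mulRight ℂ (B m) - ε₁ • LinearMap.mulLeft ℂ (B m))
        (A p * C k - ε₂ • (C k * A p)))
      (fun p => by funext m k; rw [mulSub_pow_map, h₃]; exact map_zero _)
      (fun m => by funext p k; rw [mulSub_pow_map, h₂]; exact map_zero _)
    rw [← this]
    congr 2
    funext p m k
    simp only [hG, L, hf, superComm, Pi.add_apply, LinearMap.sub_apply, LinearMap.mulLeft_apply,
      LinearMap.smul_apply, LinearMap.mulRight_apply, mul_sub, sub_mul, mul_smul_comm,
      smul_mul_assoc, mul_assoc, smul_sub, smul_smul]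
    module
  have h23 : (mulSub23 : Module.End ℂ (ℤ → ℤ → ℤ → Module.End ℂ V)) = mulSub13 - mulSub12 := by
    refine LinearMap.ext fun g => ?_
    funext p m k
    simp only [mulSub12, mulSub13, mulSub23, LinearMap.coe_mk, AddHom.coe_mk, LinearMap.sub_apply,
      Pi.sub_apply]
    abel
  -- Since `z₂ - z₃ = (z₁ - z₃) - (z₁ - z₂)`, a high power of it expands into terms with a high
  -- power of one of the two differences.
  have key : (mulSub23 ^ (N₂ + N₁ + N₃)) G = 0 := by
    rw [pow_add, Module.End.mul_apply, h23]
    refine pow_sub_kill commute_13_12 _ _ _ ?_ ?_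
    · rw [← h23]
      exact hG3
    · rw [← h23, ← Module.End.mul_apply, (commute_12_23.pow_pow N₁ N₃).eq,
        Module.End.mul_apply, hG12, map_zero]
  refine ⟨N₂ + N₁ + N₃, ?_⟩
  funext m k
  -- The supercommutator of the `j`-th product with `C` is the residue in `z₁` of `(z₁ - z₂)^j G`;
  -- multiplication by `z₂ - z₃` commutes with both operations.
  have e : (fun m k => natProd ε₁ A B j m * C k - (ε₂ * ε₃) • (C k * natProd ε₁ A B j m)) =
      fun m k => (mulSub12 ^ j) G 0 m k := by
    funext m k
    rw [mulSub12_pow, hG]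
    simp only
    rw [mulSub_pow_map]
    rfl
  rw [e, ← mulSub23_pow, ← Module.End.mul_apply, ← (commute_12_23.pow_pow j _).eq,
    Module.End.mul_apply, key, map_zero]
  rfl

end Distributions

/-! ### Uniqueness of fields, the fields of `a_(n) b`, and the commutator formula -/

namespace VertexSuperalgebra

variable {V : Type} [AddCommGroup V] [Module ℂ V] (A : VertexSuperalgebra V)

/-- `a` is homogeneous of parity `p`. -/
def Homog (p : ℕ) (a : V) : Prop := A.parity a = (-1 : ℂ) ^ p • a

theorem homog_vac : A.Homog 0 A.vac := by
  rw [Homog, A.parity_vac, pow_zero, one_smul]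

theorem exists_homog_add (a : V) : ∃ b c, A.Homog 0 b ∧ A.Homog 1 c ∧ a = b + c := by
  refine ⟨(2⁻¹ : ℂ) • (a + A.parity a), (2⁻¹ : ℂ) • (a - A.parity a), ?_, ?_, ?_⟩
  · rw [Homog, map_smul, map_add, A.parity_parity]
    module
  · rw [Homog, map_smul, map_sub, A.parity_parity]
    module
  · module

variable {A}

theorem Homog.mode {p q : ℕ} {a b : V} (ha : A.Homog p a) (hb : A.Homog q b) (n : ℤ) :
    A.Homog (p + q) (A.mode a n b) := by
  rw [Homog, A.parity_mode, ha, hb, map_smul, map_smul, Pi.smul_apply, LinearMap.smul_apply,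
    smul_smul, pow_add, mul_comm]

theorem Homog.add {p : ℕ} {a b : V} (ha : A.Homog p a) (hb : A.Homog p b) : A.Homog p (a + b) := by
  rw [Homog, map_add, ha, hb, smul_add]

theorem Homog.smul {p : ℕ} {a : V} (ha : A.Homog p a) (c : ℂ) : A.Homog p (c • a) := by
  rw [Homog, map_smul, ha, smul_comm]

theorem Homog.congr {p q : ℕ} {a : V} (ha : A.Homog p a) (h : (-1 : ℂ) ^ p = (-1) ^ q) :
    A.Homog q a := by
  rw [Homog, ha, h]

variable (A)

/-- The translation operator. -/
def transl : Module.End ℂ V := (LinearMap.applyₗ A.vac).comp ((LinearMap.proj (-2)).comp A.mode)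

theorem transl_apply (a : V) : A.transl a = A.mode a (-2) A.vac := rfl

theorem Homog.transl {A : VertexSuperalgebra V} {p : ℕ} {a : V} (ha : A.Homog p a) :
    A.Homog p (A.transl a) :=
  ha.mode A.homog_vac (-2)

theorem transl_mode (a b : V) (n : ℤ) :
    A.transl (A.mode a n b) - A.mode a n (A.transl b) = (-n : ℂ) • A.mode a (n - 1) b :=
  A.translation a n b

theorem transl_vac : A.transl A.vac = 0 := by
  rw [transl_apply, A.vac_mode, if_neg (by norm_num)]

/-- A vertex superalgebra is generated by the fields of all its homogeneous vectors. -/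
def asGeneratingFields : GeneratingFields V where
  ι := {b : ℕ × V // A.Homog b.1 b.2}
  par i := i.1.1
  x i := A.mode i.1.2
  vac := A.vac
  parity := A.parity
  T := A.transl
  isField i := A.truncation i.1.2
  isLocal i j := A.locality _ _ _ _ i.2 j.2
  parity_parity := A.parity_parity
  parity_vac := A.parity_vac
  parity_x i n v := by
    rw [A.parity_mode, i.2, map_smul, Pi.smul_apply, LinearMap.smul_apply]
  T_vac := A.transl_vac
  T_x i n v := A.transl_mode i.1.2 v n
  x_vac i n hn := A.mode_vac _ n hn
  generates S h0 h := by
    rw [eq_top_iff]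
    intro v _
    obtain ⟨b, c, hb, hc, rfl⟩ := A.exists_homog_add v
    have h1 := h ⟨(0, b), hb⟩ (-1) A.vac (by norm_num) h0
    have h2 := h ⟨(1, c), hc⟩ (-1) A.vac (by norm_num) h0
    simp only [A.mode_neg_one_vac] at h1 h2
    exact S.add_mem h1 h2

/-- Translation covariant fields of parity `p` which create a vector from the vacuum. -/
abbrev Nice (p : ℕ) (C : ℤ → Module.End ℂ V) : Prop := A.asGeneratingFields.Nice p C

theorem nice_mode {p : ℕ} {a : V} (ha : A.Homog p a) : A.Nice p (A.mode a) :=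
  A.asGeneratingFields.nice_dx ⟨(p, a), ha⟩ 0

/-- Goddard's uniqueness theorem. -/
theorem eq_mode_of_local {p : ℕ} {C : ℤ → Module.End ℂ V} (hC : A.Nice p C)
    (hloc : ∀ q b, A.Homog q b → Local ((-1) ^ (p * q)) C (A.mode b)) :
    C = A.mode (C (-1) A.vac) := by
  set a := C (-1) A.vac with ha
  have hpa : A.Homog p a := (hC.par (-1) A.vac).trans (by
    change (-1 : ℂ) ^ p • C (-1) (A.parity A.vac) = _
    rw [A.parity_vac])
  set D : ℤ → Module.End ℂ V := C + (-1 : ℂ) • A.mode a with hD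
  have hDv : ∀ n v, D n v = C n v - A.mode a n v := fun n v => by
    simp only [hD, Pi.add_apply, Pi.smul_apply, LinearMap.add_apply, LinearMap.smul_apply]
    module
  have hDloc : ∀ q b, A.Homog q b → Local ((-1) ^ (p * q)) D (A.mode b) := fun q b hb =>
    Local.add_left (hloc q b hb) (Local.smul_left (A.locality a b p q hpa hb))
  -- The difference field creates zero, and translation covariance determines `D_(-1-k) 1`
  -- recursively from `D_(-1) 1`.
  have hz : ∀ n, D n A.vac = 0 := by
    intro n
    rcases le_or_gt 0 n with hn | hn
    · rw [hDv, A.mode_vac a n hn, sub_zero]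
      exact hC.creat n hn
    · obtain ⟨k, rfl⟩ : ∃ k : ℕ, n = -1 - k := ⟨(-1 - n).toNat, by omega⟩
      clear hn
      induction k with
      | zero =>
        rw [hDv, Nat.cast_zero, sub_zero, A.mode_neg_one_vac, sub_self]
      | succ k ih =>
        have h1 : A.transl (C (-1 - k) A.vac) = (-(-1 - k : ℤ) : ℂ) • C (-1 - k - 1) A.vac := by
          have : A.transl (C (-1 - k) A.vac) - C (-1 - k) (A.transl A.vac) =
            (-(-1 - k : ℤ) : ℂ) • C (-1 - k - 1) A.vac := hC.trans (-1 - k) A.vac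
          rwa [A.transl_vac, map_zero, sub_zero] at this
        have h2 := A.transl_mode a A.vac (-1 - k)
        rw [A.transl_vac, map_zero, sub_zero] at h2
        have h3 : (-(-1 - k : ℤ) : ℂ) • D (-1 - k - 1) A.vac = 0 := by
          rw [hDv, smul_sub, ← h1, ← h2, ← map_sub, ← hDv, ih, map_zero]
        have h4 := (smul_eq_zero.1 h3).resolve_left (by
          rw [neg_eq_zero, Int.cast_eq_zero]
          omega)
        rw [← h4]
        congr 2
        push_cast
        ring
  -- In `(z - w)^N D(z) b(w) 1 = 0` only non-negative powers of `w` occur, and the coefficient of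
  -- `w^0` is `z^N D(z) b`.
  have hker : ∀ q b, A.Homog q b → ∀ m, D m b = 0 := by
    intro q b hb m
    obtain ⟨N, hN⟩ := hDloc q b hb
    have e := mulSub_pow_map (LinearMap.applyₗ A.vac) N
      (fun m n => D m * A.mode b n - ((-1 : ℂ) ^ (p * q)) • (A.mode b n * D m)) (m - N) (-1)
    rw [hN] at e
    simp only [LinearMap.applyₗ_apply_apply, LinearMap.sub_apply, LinearMap.smul_apply,
      Module.End.mul_apply, hz, map_zero, smul_zero, sub_zero] at e
    have e2 := GeneratingFields.mulSub_pow_edge N (fun m n => D m (A.mode b n A.vac))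
      (fun m n hn => by rw [A.mode_vac b n hn, map_zero]) (m - N)
    rw [e, sub_add_cancel, A.mode_neg_one_vac] at e2
    exact e2.symm
  funext m
  refine LinearMap.ext fun v => ?_
  obtain ⟨b, c, hb, hc, rfl⟩ := A.exists_homog_add v
  rw [← sub_eq_zero, ← hDv, map_add, hker 0 b hb, hker 1 c hc, add_zero]

/-- The derivative of `Y(a, z)` is again translation covariant and local, and it creates `a_(-2) 1`;
uniqueness does the rest. -/
theorem mode_transl {p : ℕ} {a : V} (ha : A.Homog p a) :
    A.mode (A.transl a) = fieldDeriv (A.mode a) := by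
  have := A.eq_mode_of_local (A.asGeneratingFields.nice_deriv (A.nice_mode ha))
    (fun q b hb => (A.locality a b p q ha hb).deriv_left)
  rw [this]
  congr 1
  rw [fieldDeriv, transl_apply]
  norm_num

/-- `Y(a_(-1) b, z) = :Y(a, z) Y(b, z):`. -/
theorem mode_neg_one_mode {p q : ℕ} {a b : V} (ha : A.Homog p a) (hb : A.Homog q b) :
    A.mode (A.mode a (-1) b) = nprod ((-1) ^ (p * q)) (A.mode a) (A.mode b) := by
  have h := A.eq_mode_of_local
    (A.asGeneratingFields.nice_nprod (A.nice_mode ha) (A.nice_mode hb) ((-1) ^ (p * q)))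
    (fun r c hc => by
      rw [add_mul, pow_add]
      exact Local.nprod_left (A.truncation a) (A.truncation b) (A.locality a b p q ha hb)
        (A.locality a c p r ha hc) (A.locality b c q r hb hc))
  rw [h]
  congr 1
  have := A.asGeneratingFields.nprod_vac (A.nice_mode ha) (A.nice_mode hb) ((-1) ^ (p * q))
  refine Eq.trans ?_ this.symm
  change _ = A.mode a (-1) (A.mode b (-1) A.vac)
  rw [A.mode_neg_one_vac]

/-- Each of the four conditions has a two-variable version which holds for the supercommutator and
survives multiplication by `z - w`; the `j`-th product is the slice `m = 0`. -/
theorem nice_natProd {p q : ℕ} {a b : V} (ha : A.Homog p a) (hb : A.Homog q b) (j : ℕ) :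
    A.Nice (p + q) (natProd ((-1) ^ (p * q)) (A.mode a) (A.mode b) j) where
  field v := by
    refine mulSub_pow_induction (P := fun f : ℤ → ℤ → Module.End ℂ V =>
      ∀ m, ∃ N : ℤ, ∀ n, N ≤ n → f m n v = 0) ?_ ?_ j 0
    · intro f hf m
      obtain ⟨N, hN⟩ := hf (m + 1)
      obtain ⟨M, hM⟩ := hf m
      exact ⟨max N M, fun n hn => by
        rw [mulSub_apply, LinearMap.sub_apply, hN n (by omega), hM _ (by omega), sub_zero]⟩
    · intro m
      obtain ⟨N, hN⟩ := A.truncation b v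
      obtain ⟨M, hM⟩ := A.truncation b (A.mode a m v)
      exact ⟨max N M, fun n hn => by
        rw [superComm, LinearMap.sub_apply, LinearMap.smul_apply, Module.End.mul_apply,
          Module.End.mul_apply, hN n (by omega), hM n (by omega), map_zero, smul_zero, sub_zero]⟩
  par n v := by
    change A.parity _ = _ • natProd _ _ _ _ _ (A.parity v)
    refine mulSub_pow_induction (P := fun f : ℤ → ℤ → Module.End ℂ V => ∀ m n, A.parity (f m n v) =
      (-1 : ℂ) ^ (p + q) • f m n (A.parity v)) ?_ ?_ j 0 n
    · intro f hf m n
      rw [mulSub_apply, LinearMap.sub_apply, LinearMap.sub_apply, map_sub, hf, hf, smul_sub]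
    · intro m n
      have ha' : A.parity a = _ := ha
      have hb' : A.parity b = _ := hb
      simp only [superComm, LinearMap.sub_apply, LinearMap.smul_apply, Module.End.mul_apply,
        map_sub, map_smul, A.parity_mode, ha', hb', Pi.smul_apply]
      rw [pow_add]
      module
  trans n v := by
    -- Translation acts on both indices; the contribution of the first carries the factor `-m` and
    -- drops out at `m = 0`.
    have := mulSub_pow_induction (P := fun f : ℤ → ℤ → Module.End ℂ V => ∀ m n,
      A.transl (f m n v) - f m n (A.transl v) =
      (-m : ℂ) • f (m - 1) n v + (-n : ℂ) • f m (n - 1) v) ?_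
      (f := superComm ((-1) ^ (p * q)) (A.mode a) (A.mode b)) ?_ j 0 n
    · refine Eq.trans this ?_
      rw [Int.cast_zero, neg_zero, zero_smul, zero_add]
      rfl
    · intro f hf m n
      have h1 := hf (m + 1) n
      have h2 := hf m (n + 1)
      rw [add_sub_cancel_right] at h1 h2
      simp only [mulSub_apply, LinearMap.sub_apply, map_sub, sub_add_cancel]
      rw [sub_sub_sub_comm, h1, h2]
      push_cast
      module
    · intro m n
      have h1 := A.transl_mode a (A.mode b n v) m
      have h2 := congrArg (A.mode a m) (A.transl_mode b v n)
      have h3 := A.transl_mode b (A.mode a m v) n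
      have h4 := congrArg (A.mode b n) (A.transl_mode a v m)
      rw [map_sub, map_smul] at h2 h4
      simp only [superComm, LinearMap.sub_apply, LinearMap.smul_apply, Module.End.mul_apply,
        map_sub, map_smul]
      rw [eq_add_of_sub_eq h1, eq_add_of_sub_eq h2, eq_add_of_sub_eq h3, eq_add_of_sub_eq h4]
      module
  creat n hn := by
    refine mulSub_pow_induction (P := fun f : ℤ → ℤ → Module.End ℂ V =>
      ∀ m n, 0 ≤ m → 0 ≤ n → f m n A.vac = 0) ?_ ?_
      j 0 n le_rfl hn
    · intro f hf m n hm hn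
      rw [mulSub_apply, LinearMap.sub_apply, hf _ _ (by omega) hn, hf _ _ hm (by omega), sub_zero]
    · intro m n hm hn
      rw [superComm, LinearMap.sub_apply, LinearMap.smul_apply, Module.End.mul_apply,
        Module.End.mul_apply, A.mode_vac a m hm, A.mode_vac b n hn]
      simp

/-- On the vacuum all coefficients with both indices non-negative vanish, so each factor `z - w`
only raises the first index of the coefficient with `n = -1`. In the end the coefficient `(j, -1)`
of the supercommutator remains, that is `a_(j) b_(-1) 1`. -/
theorem natProd_vac (ε : ℂ) (a b : V) (j : ℕ) :
    natProd ε (A.mode a) (A.mode b) j (-1) A.vac = A.mode a j b := by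
  have key : ∀ (j : ℕ) (f : ℤ → ℤ → Module.End ℂ V),
      (∀ m n, 0 ≤ m → 0 ≤ n → f m n A.vac = 0) → ∀ m, 0 ≤ m →
      (mulSub ^ j) f m (-1) A.vac = f (m + j) (-1) A.vac := by
    intro j
    induction j with
    | zero => intro f _ m _; simp
    | succ j ih =>
      intro f hf m hm
      rw [pow_succ, Module.End.mul_apply, ih _ ?_ m hm, mulSub_apply, LinearMap.sub_apply,
        hf _ (-1 + 1) (by omega) le_rfl, sub_zero]
      · push_cast
        rw [add_assoc]
      · intro m n hm hn
        rw [mulSub_apply, LinearMap.sub_apply, hf _ _ (by omega) hn, hf _ _ hm (by omega), sub_zero]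
  rw [natProd, key j _ ?_ 0 le_rfl, zero_add, superComm, LinearMap.sub_apply,
    LinearMap.smul_apply, Module.End.mul_apply, Module.End.mul_apply, A.mode_vac a _ (by omega),
    A.mode_neg_one_vac, map_zero, smul_zero, sub_zero]
  intro m n hm hn
  rw [superComm, LinearMap.sub_apply, LinearMap.smul_apply, Module.End.mul_apply,
    Module.End.mul_apply, A.mode_vac a m hm, A.mode_vac b n hn]
  simp

/-- Uniqueness again: the `j`-th product of the fields is local by Dong's lemma and creates `a_(j)
b`. -/
theorem mode_natCast_mode {p q : ℕ} {a b : V} (ha : A.Homog p a) (hb : A.Homog q b) (j : ℕ) :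
    A.mode (A.mode a j b) = natProd ((-1) ^ (p * q)) (A.mode a) (A.mode b) j := by
  have h := A.eq_mode_of_local (A.nice_natProd ha hb j) (fun r c hc => by
    rw [add_mul, pow_add]
    exact Local.natProd_left (A.locality a b p q ha hb) (A.locality a c p r ha hc)
      (A.locality b c q r hb hc) j)
  rw [h, natProd_vac]

/-- The commutator formula. -/
theorem commutator {p q : ℕ} {a b : V} (ha : A.Homog p a) (hb : A.Homog q b) {N : ℕ}
    (hN : ∀ j : ℕ, N ≤ j → A.mode a j b = 0) (m n : ℤ) (v : V) :
    A.mode a m (A.mode b n v) = (-1 : ℂ) ^ (p * q) • A.mode b n (A.mode a m v) +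
      ∑ j ∈ Finset.range N, ((Ring.choose m j : ℤ) : ℂ) • A.mode (A.mode a j b) (m + n - j) v := by
  obtain ⟨M, hM⟩ := A.locality a b p q ha hb
  -- The order of locality need not be the given bound `N`; a larger exponent is used, and the
  -- surplus terms vanish because they are fields of `a_(j) b = 0`.
  have hM' : (mulSub ^ (M + N)) (superComm ((-1) ^ (p * q)) (A.mode a) (A.mode b)) = 0 :=
    mulSub_pow_mono (Nat.le_add_right M N) hM
  have h := congrArg (fun L : Module.End ℂ V => L v) (eq_sum_of_mulSub_pow hM' m n)
  simp only [superComm, LinearMap.sub_apply, LinearMap.smul_apply, Module.End.mul_apply,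
    LinearMap.sum_apply] at h
  rw [eq_add_of_sub_eq' h]
  congr 1
  rw [← Finset.sum_subset (Finset.range_subset_range.2 (Nat.le_add_left N M))]
  · refine Finset.sum_congr rfl fun j _ => ?_
    rw [A.mode_natCast_mode ha hb]
    rfl
  · intro j _ hj
    have h0 := A.mode_natCast_mode ha hb j
    rw [hN j (by simpa using hj), map_zero] at h0
    have : natProd ((-1) ^ (p * q)) (A.mode a) (A.mode b) j (m + n - j) v = 0 := by
      rw [← h0]; rfl
    rw [natProd] at this
    exact (congrArg _ this).trans (smul_zero _)

/-- Zero modes of even vectors are derivations. -/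
theorem zero_mode_mode {a : V} (ha : A.Homog 0 a) (b : V) (n : ℤ) (v : V) :
    A.mode a 0 (A.mode b n v) = A.mode b n (A.mode a 0 v) + A.mode (A.mode a 0 b) n v := by
  have key : ∀ q b, A.Homog q b → A.mode a 0 (A.mode b n v) =
      A.mode b n (A.mode a 0 v) + A.mode (A.mode a 0 b) n v := by
    intro q b hb
    obtain ⟨N, hN⟩ := A.truncation a b
    rw [A.commutator ha hb (N := N.toNat + 1) (fun j hj => hN j (by omega)), zero_mul, pow_zero,
      one_smul, Finset.sum_range_succ', Finset.sum_eq_zero]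
    · simp
    · intro j _
      rw [Ring.choose_zero_succ]
      simp
  obtain ⟨b, c, hb, hc, rfl⟩ := A.exists_homog_add b
  simp only [map_add, Pi.add_apply, LinearMap.add_apply, key 0 b hb, key 1 c hc]
  abel

end VertexSuperalgebra

/-! ### Subspaces and linear maps compatible with products -/

section

variable {V W : Type*} [AddCommGroup V] [Module ℂ V] [AddCommGroup W] [Module ℂ W]

theorem finsum_mem_submodule {ι : Type*} (S : Submodule ℂ V) {u : ι → V} (h : ∀ i, u i ∈ S) :
    ∑ᶠ i, u i ∈ S :=
  finsum_induction (· ∈ S) S.zero_mem (fun _ _ => S.add_mem) h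

theorem nprod_mem {ε : ℂ} {A B : ℤ → Module.End ℂ V} (hA : IsField A) (hB : IsField B)
    {S : Submodule ℂ V} (h1 : ∀ n, ∀ v ∈ S, A n v ∈ S) (h2 : ∀ n, ∀ v ∈ S, B n v ∈ S) (n : ℤ)
    {v : V} (hv : v ∈ S) : nprod ε A B n v ∈ S := by
  rw [nprod, nprodAux_apply ε hA hB]
  exact S.add_mem (finsum_mem_submodule S fun j => h1 _ _ (h2 _ _ hv))
    (S.smul_mem _ (finsum_mem_submodule S fun j => h2 _ _ (h1 _ _ hv)))

theorem map_nprod {ε : ℂ} {A B : ℤ → Module.End ℂ V} (hA : IsField A) (hB : IsField B)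
    {A' B' : ℤ → Module.End ℂ W} (hA' : IsField A') (hB' : IsField B') (φ : V →ₗ[ℂ] W)
    (h1 : ∀ n v, φ (A n v) = A' n (φ v)) (h2 : ∀ n v, φ (B n v) = B' n (φ v)) (n : ℤ) (v : V) :
    φ (nprod ε A B n v) = nprod ε A' B' n (φ v) := by
  rw [nprod, nprod, nprodAux_apply ε hA hB, nprodAux_apply ε hA' hB', map_add, map_smul]
  have m1 := φ.toAddMonoidHom.map_finsum (finite1 (A := A) hB 0 n v)
  have m2 := φ.toAddMonoidHom.map_finsum (finite2 (B := B) hA 0 n v)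
  simp only [LinearMap.toAddMonoidHom_coe] at m1 m2
  rw [m1, m2]
  simp only [h1, h2]

end

namespace VertexSuperalgebra

variable {V W : Type} [AddCommGroup V] [Module ℂ V] [AddCommGroup W] [Module ℂ W]
  (A : VertexSuperalgebra V) (B : VertexSuperalgebra W)

variable {A} in
theorem Homog.iterate_transl {p : ℕ} {a : V} (ha : A.Homog p a) (k : ℕ) :
    A.Homog p (A.transl^[k] a) := by
  induction k with
  | zero => exact ha
  | succ k ih => rw [Function.iterate_succ_apply']; exact ih.transl

theorem mode_iterate_transl {p : ℕ} {a : V} (ha : A.Homog p a) (k : ℕ) :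
    A.mode (A.transl^[k] a) = fieldDeriv^[k] (A.mode a) := by
  induction k with
  | zero => rfl
  | succ k ih =>
    rw [Function.iterate_succ_apply', Function.iterate_succ_apply',
      A.mode_transl (ha.iterate_transl k), ih]

/-- Reduces all negative products to the product of index `-1` with derivatives, hence to normally
ordered products. -/
theorem factorial_smul_mode_neg {p : ℕ} {a : V} (ha : A.Homog p a) (k : ℕ) (b : V) :
    (k.factorial : ℂ) • A.mode a (-1 - k) b = A.mode (A.transl^[k] a) (-1) b := by
  rw [A.mode_iterate_transl ha, GeneratingFields.dx_neg_one]
  rfl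

theorem mode_neg_eq {p : ℕ} {a : V} (ha : A.Homog p a) (k : ℕ) (b : V) :
    A.mode a (-1 - k) b = (k.factorial : ℂ)⁻¹ • A.mode (A.transl^[k] a) (-1) b := by
  rw [← A.factorial_smul_mode_neg ha, smul_smul,
    inv_mul_cancel₀ (Nat.cast_ne_zero.2 k.factorial_ne_zero), one_smul]

/-- All modes of `a` preserve `S`. -/
def Preserves (S : Submodule ℂ V) (a : V) : Prop := ∀ n, ∀ v ∈ S, A.mode a n v ∈ S

variable {A} {S : Submodule ℂ V}

theorem Preserves.add {a b : V} (ha : A.Preserves S a) (hb : A.Preserves S b) :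
    A.Preserves S (a + b) := fun n v hv => by
  rw [map_add]
  exact S.add_mem (ha n v hv) (hb n v hv)

theorem Preserves.smul {a : V} (ha : A.Preserves S a) (c : ℂ) : A.Preserves S (c • a) :=
  fun n v hv => by
    rw [map_smul]
    exact S.smul_mem _ (ha n v hv)

theorem Preserves.sub {a b : V} (ha : A.Preserves S a) (hb : A.Preserves S b) :
    A.Preserves S (a - b) := fun n v hv => by
  rw [map_sub]
  exact S.sub_mem (ha n v hv) (hb n v hv)

theorem preserves_zero : A.Preserves S 0 := fun n v _ => by
  rw [map_zero]
  exact S.zero_mem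

theorem preserves_vac : A.Preserves S A.vac := fun n v hv => by
  rw [A.vac_mode]
  split
  · exact hv
  · exact S.zero_mem

theorem Preserves.sum {ι : Type*} (s : Finset ι) {f : ι → V}
    (h : ∀ i ∈ s, A.Preserves S (f i)) : A.Preserves S (∑ i ∈ s, f i) := by
  classical
  induction s using Finset.induction_on with
  | empty => exact preserves_zero
  | insert i s hi ih =>
    rw [Finset.sum_insert hi]
    exact (h i (Finset.mem_insert_self i s)).add
      (ih fun j hj => h j (Finset.mem_insert_of_mem hj))

theorem Preserves.iterate_transl {p : ℕ} {a : V} (ha : A.Homog p a) (h : A.Preserves S a) (k : ℕ) :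
    A.Preserves S (A.transl^[k] a) := by
  induction k with
  | zero => exact h
  | succ k ih =>
    rw [Function.iterate_succ_apply']
    intro n v hv
    rw [A.mode_transl (ha.iterate_transl k), fieldDeriv]
    exact S.smul_mem _ (ih _ v hv)

/-- The field of `a_(n) b` is built from those of `a` and `b`: by supercommutators multiplied by
powers of `z - w` if `n ≥ 0`, and by a normally ordered product with a derivative of `a` if `n < 0`.
A vertex algebra generated by vectors that preserve `S` therefore preserves `S`. -/
theorem Preserves.mode {p q : ℕ} {a b : V} (ha : A.Homog p a) (hb : A.Homog q b)
    (h1 : A.Preserves S a) (h2 : A.Preserves S b) (n : ℤ) : A.Preserves S (A.mode a n b) := by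
  rcases le_or_gt 0 n with hn | hn
  · obtain ⟨j, rfl⟩ := Int.eq_ofNat_of_zero_le hn
    intro m v hv
    rw [A.mode_natCast_mode ha hb]
    refine mulSub_pow_induction (P := fun f : ℤ → ℤ → Module.End ℂ V => ∀ m n, f m n v ∈ S)
      ?_ ?_ j 0 m
    · intro f hf m n
      exact S.sub_mem (hf _ _) (hf _ _)
    · intro m n
      exact S.sub_mem (h1 _ _ (h2 _ _ hv)) (S.smul_mem _ (h2 _ _ (h1 _ _ hv)))
  · obtain ⟨k, rfl⟩ : ∃ k : ℕ, n = -1 - k := ⟨(-1 - n).toNat, by omega⟩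
    rw [A.mode_neg_eq ha]
    refine Preserves.smul (fun m v hv => ?_) _
    rw [A.mode_neg_one_mode (ha.iterate_transl k) hb]
    exact nprod_mem (A.truncation _) (A.truncation _) (h1.iterate_transl ha k) h2 m hv

variable {B}

/-- `φ` intertwines all the modes of `a` and of `φ a`. -/
def Intertwines (A : VertexSuperalgebra V) (B : VertexSuperalgebra W) (φ : V →ₗ[ℂ] W) (a : V) :
    Prop := ∀ n b, φ (A.mode a n b) = B.mode (φ a) n (φ b)

/-- Derivatives and normally ordered products are transported by `φ`. Negative indices are enough
because a vacuum module is spanned by what negative modes create from the vacuum. -/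
theorem Intertwines.mode_neg {φ : V →ₗ[ℂ] W} (hvac : φ A.vac = B.vac)
    (hpar : ∀ a, φ (A.parity a) = B.parity (φ a)) {p q : ℕ} {a b : V} (ha : A.Homog p a)
    (hb : A.Homog q b) (h1 : A.Intertwines B φ a) (h2 : A.Intertwines B φ b) {n : ℤ} (hn : n < 0) :
    A.Intertwines B φ (A.mode a n b) := by
  have hom : ∀ {p a}, A.Homog p a → B.Homog p (φ a) := fun {p a} h => by
    rw [Homog, ← hpar, h, map_smul]
  have htr : ∀ {a}, A.Intertwines B φ a → φ (A.transl a) = B.transl (φ a) := fun {a} h => by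
    rw [transl_apply, h, hvac, transl_apply]
  have key : ∀ k, A.Intertwines B φ (A.transl^[k] a) := by
    intro k
    induction k with
    | zero => exact h1
    | succ k ih =>
      rw [Function.iterate_succ_apply']
      intro n b
      rw [htr ih, A.mode_transl (ha.iterate_transl k), B.mode_transl (hom (ha.iterate_transl k)),
        fieldDeriv, fieldDeriv, LinearMap.smul_apply, LinearMap.smul_apply, map_smul, ih]
  obtain ⟨k, rfl⟩ : ∃ k : ℕ, n = -1 - k := ⟨(-1 - n).toNat, by omega⟩
  rw [A.mode_neg_eq ha]
  intro m c
  have e := map_nprod (ε := (-1) ^ (p * q)) (A.truncation (A.transl^[k] a)) (A.truncation b)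
    (B.truncation (φ (A.transl^[k] a))) (B.truncation (φ b)) φ (key k) h2 m c
  rw [← A.mode_neg_one_mode (ha.iterate_transl k) hb,
    ← B.mode_neg_one_mode (hom (ha.iterate_transl k)) (hom hb)] at e
  simp only [map_smul, Pi.smul_apply, LinearMap.smul_apply, e, key k (-1) b]

end VertexSuperalgebra

/-! ### The universal property of vacuum modules -/

namespace CurrentData

variable {D : CurrentData} {W : Type} [AddCommGroup W] [Module ℂ W]

theorem homog_state (i : D.ι) : D.vertexSuperalgebra.Homog (D.par i) (D.state i) := by
  have h := D.generatingFields.parity_x i (-1) D.vac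
  rw [show D.generatingFields.parity D.vac = D.vac from D.generatingFields.parity_vac] at h
  exact h

/-- The vectors `s i` have the operator product expansions prescribed by `D`. -/
structure HasOPE (D : CurrentData) (B : VertexSuperalgebra W) (s : D.ι → W) : Prop where
  homog : ∀ i, B.Homog (D.par i) (s i)
  zero : ∀ i j, B.mode (s i) 0 (s j) = ∑ k, D.bracket i j k • s k + D.pairing₀ i j • B.vac
  one : ∀ i j, B.mode (s i) 1 (s j) = D.pairing₁ i j • B.vac
  two_le : ∀ i j n, 2 ≤ n → B.mode (s i) n (s j) = 0

variable {B : VertexSuperalgebra W} {s : D.ι → W}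

/-- In the commutator formula only the poles `j = 0` and `j = 1` contribute. The result is exactly
the defining relation of the mode algebra, so `B` becomes a module over it. -/
theorem HasOPE.comm (h : D.HasOPE B s) (i j : D.ι) (m n : ℤ) (v : W) :
    B.mode (s i) m (B.mode (s j) n v) =
      (-1 : ℂ) ^ (D.par i * D.par j) • B.mode (s j) n (B.mode (s i) m v) +
      ∑ k, D.bracket i j k • B.mode (s k) (m + n) v +
      (if m + n = -1 then D.pairing₀ i j else 0) • v +
      (if m + n = 0 then m * D.pairing₁ i j else 0) • v := by
  rw [B.commutator (h.homog i) (h.homog j) (N := 2) (fun l hl => h.two_le i j l (by omega)),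
    Finset.sum_range_succ, Finset.sum_range_one]
  simp only [Nat.cast_zero, Nat.cast_one, h.zero, h.one, Ring.choose_zero_right,
    Ring.choose_one_right, Int.cast_one, one_smul, sub_zero, map_add, map_sum, map_smul,
    Pi.add_apply, Pi.smul_apply, LinearMap.add_apply, LinearMap.smul_apply, Finset.sum_apply,
    LinearMap.sum_apply, B.vac_mode, show m + n - 1 = -1 ↔ m + n = 0 by omega]
  split_ifs <;> module

/-- The action of the mode algebra of `D` on `W`. -/
def HasOPE.modeHom (h : D.HasOPE B s) : D.ModeAlgebra →ₐ[ℂ] Module.End ℂ W :=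
  RingQuot.liftAlgHom ℂ ⟨FreeAlgebra.lift ℂ fun p : D.ι × ℤ => B.mode (s p.1) p.2, by
    rintro _ _ ⟨i, j, m, n⟩
    simp only [map_mul, map_add, map_smul, map_sum, map_one, FreeAlgebra.lift_ι_apply]
    refine LinearMap.ext fun v => ?_
    simp only [Module.End.mul_apply, LinearMap.add_apply, LinearMap.smul_apply,
      LinearMap.sum_apply, Module.End.one_apply]
    exact h.comm i j m n v⟩

theorem HasOPE.modeHom_gen (h : D.HasOPE B s) (i : D.ι) (n : ℤ) :
    h.modeHom (D.gen i n) = B.mode (s i) n := by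
  rw [modeHom, gen, RingQuot.liftAlgHom_mkAlgHom_apply, FreeAlgebra.lift_ι_apply]

/-- The homomorphism from the vacuum module that sends the vacuum to the vacuum and the states
of the generators to the vectors `s i`. -/
def HasOPE.hom (h : D.HasOPE B s) : D.VacModule →ₗ[ℂ] W :=
  D.vacIdeal.liftQ ((LinearMap.applyₗ B.vac).comp h.modeHom.toLinearMap) (by
    rw [vacIdeal, Submodule.span_le]
    rintro _ ⟨a, i, n, hn, rfl⟩
    change h.modeHom (a * D.gen i n) B.vac = 0
    rw [map_mul, modeHom_gen, Module.End.mul_apply, B.mode_vac _ n hn, map_zero])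

theorem HasOPE.hom_mk (h : D.HasOPE B s) (a : D.ModeAlgebra) :
    h.hom (D.vacIdeal.mkQ a) = h.modeHom a B.vac := rfl

theorem HasOPE.hom_vac (h : D.HasOPE B s) : h.hom D.vac = B.vac := by
  rw [vac, hom_mk, map_one, Module.End.one_apply]

theorem HasOPE.hom_x (h : D.HasOPE B s) (i : D.ι) (n : ℤ) (v : D.VacModule) :
    h.hom (D.x i n v) = B.mode (s i) n (h.hom v) := by
  obtain ⟨a, rfl⟩ := D.mk_surjective v
  rw [x, act_mk, hom_mk, hom_mk, map_mul, modeHom_gen, Module.End.mul_apply]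

theorem HasOPE.hom_state (h : D.HasOPE B s) (i : D.ι) : h.hom (D.state i) = s i := by
  rw [state, hom_x, hom_vac, B.mode_neg_one_vac]

theorem HasOPE.hom_parity (h : D.HasOPE B s) (v : D.VacModule) :
    h.hom (D.vertexSuperalgebra.parity v) = B.parity (h.hom v) := by
  let S : Submodule ℂ D.VacModule :=
    LinearMap.eqLocus (h.hom.comp D.parity) (B.parity.comp h.hom)
  have hS : S = ⊤ := by
    refine D.generates S ?_ fun i n v _ hv => ?_
    · change h.hom (D.parity D.vac) = B.parity (h.hom D.vac)
      rw [show D.parity D.vac = D.vac from D.generatingFields.parity_vac, hom_vac, B.parity_vac]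
    · change h.hom (D.parity (D.x i n v)) = B.parity (h.hom (D.x i n v))
      have hv : h.hom (D.parity v) = B.parity (h.hom v) := hv
      rw [show D.parity (D.x i n v) = (-1 : ℂ) ^ D.par i • D.x i n (D.parity v) from
        D.generatingFields.parity_x i n v, map_smul, hom_x, hom_x, B.parity_mode, hv,
        show B.parity (s i) = _ from h.homog i, map_smul]
      rfl
  have hv : v ∈ S := by rw [hS]; trivial
  exact hv

/-- By construction `hom` intertwines the fields of the generators; this spreads to all vectors by
closure under negative products. -/
theorem HasOPE.hom_mode (h : D.HasOPE B s) (a : D.VacModule) (n : ℤ) (b : D.VacModule) :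
    h.hom (D.vertexSuperalgebra.mode a n b) = B.mode (h.hom a) n (h.hom b) := by
  let A := D.vertexSuperalgebra
  have hst : ∀ i, A.Intertwines B h.hom (D.state i) := fun i n b => by
    rw [D.mode_state, hom_x, hom_state]
  have hvac : A.Intertwines B h.hom A.vac := fun n b => by
    rw [show h.hom A.vac = B.vac from h.hom_vac, A.vac_mode, B.vac_mode]
    split <;> simp
  -- Homogeneity is carried along because the normally ordered product formula needs parities.
  let S : Submodule ℂ D.VacModule :=
    Submodule.span ℂ {a | A.Intertwines B h.hom a ∧ ∃ p, A.Homog p a}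
  have hS : S = ⊤ := by
    refine D.generates S (Submodule.subset_span ⟨hvac, 0, A.homog_vac⟩) fun i n v hn hv => ?_
    induction hv using Submodule.span_induction with
    | mem v hv =>
      obtain ⟨hv, p, hp⟩ := hv
      rw [← D.mode_state]
      exact Submodule.subset_span ⟨VertexSuperalgebra.Intertwines.mode_neg (A := A)
        (φ := h.hom) h.hom_vac h.hom_parity
        (D.homog_state i) hp (hst i) hv hn, _, (D.homog_state i).mode hp n⟩
    | zero => rw [map_zero]; exact S.zero_mem
    | add v w _ _ h1 h2 => rw [map_add]; exact S.add_mem h1 h2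
    | smul c v _ h1 => rw [map_smul]; exact S.smul_mem _ h1
  have ha : a ∈ S := by rw [hS]; trivial
  induction ha using Submodule.span_induction with
  | mem v hv => exact hv.1 n b
  | zero => simp
  | add v w _ _ h1 h2 => simp only [map_add, Pi.add_apply, LinearMap.add_apply, h1, h2]
  | smul c v _ h1 => simp only [map_smul, Pi.smul_apply, LinearMap.smul_apply, h1]

end CurrentData

namespace CurrentData

variable (D : CurrentData)

theorem hasOPE_state : D.HasOPE D.vertexSuperalgebra D.state where
  homog := D.homog_state
  zero i j := by
    rw [mode_state, state, x_comm, D.x_vac i 0 le_rfl]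
    simp [state]
    rfl
  one i j := by
    rw [mode_state, state, x_comm, D.x_vac i 1 (by norm_num), map_zero, smul_zero, zero_add,
      Finset.sum_eq_zero fun k _ => by rw [D.x_vac k _ (by norm_num), smul_zero]]
    simp
    rfl
  two_le i j n hn := by
    rw [mode_state, state, x_comm, D.x_vac i n (by omega), map_zero, smul_zero, zero_add,
      Finset.sum_eq_zero fun k _ => by rw [D.x_vac k _ (by omega), smul_zero], if_neg (by omega),
      if_neg (by omega)]
    simp

end CurrentData

/-! ### The free fields which generate `𝒰`, and their quadratic vectors -/

namespace VertexSuperalgebra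

variable {V W : Type*} [AddCommGroup V] [Module ℂ V] [AddCommGroup W] [Module ℂ W]
  (A : VertexSuperalgebra V) (hA : ∀ v, A.parity v = v) (B : VertexSuperalgebra W)

theorem tensor_mode_tmul_vac (a c : V) (d : W) (n : ℤ) :
    (A.tensor hA B).mode (a ⊗ₜ B.vac) n (c ⊗ₜ d) = A.mode a n c ⊗ₜ d := by
  change A.tensorMode B _ _ _ = _
  rw [tensorMode_tmul_tmul, finsum_eq_single _ n]
  · rw [B.vac_mode, if_pos (by ring)]
  · intro k hk
    rw [B.vac_mode, if_neg (by omega), tmul_zero]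

theorem tensor_mode_vac_tmul (b : W) (c : V) (d : W) (n : ℤ) :
    (A.tensor hA B).mode (A.vac ⊗ₜ b) n (c ⊗ₜ d) = c ⊗ₜ B.mode b n d := by
  change A.tensorMode B _ _ _ = _
  rw [tensorMode_tmul_tmul, finsum_eq_single _ (-1)]
  · rw [A.vac_mode, if_pos rfl, show n - 1 - -1 = n by ring]
  · intro k hk
    rw [A.vac_mode, if_neg hk, zero_tmul]

end VertexSuperalgebra

/-- The generators `a`, `a*`, `ψ`, `ψ*` of `𝒰`. -/
abbrev Letter : Type := WeylGen ⊕ CliffordGen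

namespace Letter

/-- Parity of the generators. -/
def par : Letter → ℕ
  | .inl _ => 0
  | .inr _ => 1

/-- The pairing `ω(k, l)` in `[k_(m), l_(n)] = δ_(m+n,-1) ω(k, l)`. -/
def pairing : Letter → Letter → ℂ
  | .inl i, .inl j => weylData.pairing₀ i j
  | .inr i, .inr j => cliffordData.pairing₀ i j
  | _, _ => 0

/-- The charge of the generators: their eigenvalue under `E(0)`. -/
def charge : Letter → ℤ
  | .inl .a => -1
  | .inl .aStar => 1
  | .inr .psi => 1
  | .inr .psiStar => -1

end Letter

/-- The commutation relations of the free fields which generate `𝒰`. -/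
abbrev freeData : CurrentData where
  ι := Letter
  par := Letter.par
  bracket _ _ _ := 0
  pairing₀ := Letter.pairing
  pairing₁ _ _ := 0
  par_bracket _ _ _ h := absurd rfl h
  par_pairing₀ i j h := by
    rcases i with i | i <;> rcases j with j | j <;> simp [Letter.par, Letter.pairing] at h ⊢
  par_pairing₁ _ _ h := absurd rfl h

/-- The states of the generators of `𝒰`. -/
def letter : Letter → M ⊗[ℂ] F
  | .inl i => weylData.state i ⊗ₜ cliffordVA.vac
  | .inr j => weylVA.vac ⊗ₜ cliffordData.state j

theorem letter_inl (i : WeylGen) : letter (.inl i) = weylData.state i ⊗ₜ cliffordVA.vac := rfl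

theorem letter_inr (i : CliffordGen) : letter (.inr i) = weylVA.vac ⊗ₜ cliffordData.state i := rfl

theorem letter_inl_mode (i : WeylGen) (n : ℤ) (c : M) (d : F) :
    U.mode (letter (.inl i)) n (c ⊗ₜ d) = weylData.x i n c ⊗ₜ d := by
  rw [← weylData.mode_state]
  exact weylVA.tensor_mode_tmul_vac weylVA_even cliffordVA _ _ _ _

theorem letter_inr_mode (i : CliffordGen) (n : ℤ) (c : M) (d : F) :
    U.mode (letter (.inr i)) n (c ⊗ₜ d) = c ⊗ₜ cliffordData.x i n d := by
  rw [← cliffordData.mode_state]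
  exact weylVA.tensor_mode_vac_tmul weylVA_even cliffordVA _ _ _ _

theorem U_vac : U.vac = weylVA.vac ⊗ₜ cliffordVA.vac := rfl

/-- Within one factor the expansions are those of the Weyl or Clifford fields, and fields of
different factors commute. This makes it possible to treat `𝒰` as one system of free fields instead
of a tensor product. -/
theorem hasOPE_letter : freeData.HasOPE U letter where
  homog i := by
    rcases i with i | i
    · change TensorProduct.map LinearMap.id cliffordVA.parity (_ ⊗ₜ _) = (-1 : ℂ) ^ 0 • _
      rw [TensorProduct.map_tmul, cliffordVA.parity_vac, pow_zero, one_smul]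
      rfl
    · change TensorProduct.map LinearMap.id cliffordVA.parity (_ ⊗ₜ _) = (-1 : ℂ) ^ 1 • _
      rw [TensorProduct.map_tmul,
        show cliffordVA.parity (cliffordData.state i) = _ from cliffordData.homog_state i,
        tmul_smul]
      rfl
  zero i j := by
    rcases i with i | i <;> rcases j with j | j
    · have := weylData.hasOPE_state.zero i j
      rw [weylData.mode_state] at this
      rw [letter_inl j, letter_inl_mode, this]
      simp [Letter.pairing, U_vac, smul_tmul']
      rfl
    · rw [letter_inr j, letter_inl_mode, show weylVA.vac = weylData.vac from rfl,
        weylData.x_vac i 0 le_rfl]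
      simp [Letter.pairing]
    · rw [letter_inl j, letter_inr_mode, show cliffordVA.vac = cliffordData.vac from rfl,
        cliffordData.x_vac i 0 le_rfl]
      simp [Letter.pairing]
    · have := cliffordData.hasOPE_state.zero i j
      rw [cliffordData.mode_state] at this
      rw [letter_inr j, letter_inr_mode, this]
      simp [Letter.pairing, U_vac, tmul_smul]
      rfl
  one i j := by
    rcases i with i | i <;> rcases j with j | j
    · have := weylData.hasOPE_state.one i j
      rw [weylData.mode_state] at this
      rw [letter_inl j, letter_inl_mode, this]
      simp
    · rw [letter_inr j, letter_inl_mode, show weylVA.vac = weylData.vac from rfl,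
        weylData.x_vac i 1 (by norm_num)]
      simp
    · rw [letter_inl j, letter_inr_mode, show cliffordVA.vac = cliffordData.vac from rfl,
        cliffordData.x_vac i 1 (by norm_num)]
      simp
    · have := cliffordData.hasOPE_state.one i j
      rw [cliffordData.mode_state] at this
      rw [letter_inr j, letter_inr_mode, this]
      simp
  two_le i j n hn := by
    rcases i with i | i <;> rcases j with j | j
    · have := weylData.hasOPE_state.two_le i j n hn
      rw [weylData.mode_state] at this
      rw [letter_inl j, letter_inl_mode, this, zero_tmul]
    · rw [letter_inr j, letter_inl_mode, show weylVA.vac = weylData.vac from rfl,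
        weylData.x_vac i n (by omega), zero_tmul]
    · rw [letter_inl j, letter_inr_mode, show cliffordVA.vac = cliffordData.vac from rfl,
        cliffordData.x_vac i n (by omega), tmul_zero]
    · have := cliffordData.hasOPE_state.two_le i j n hn
      rw [cliffordData.mode_state] at this
      rw [letter_inr j, letter_inr_mode, this, tmul_zero]

theorem letter_comm (k l : Letter) (m n : ℤ) (v : M ⊗[ℂ] F) :
    U.mode (letter k) m (U.mode (letter l) n v) =
      (-1 : ℂ) ^ (k.par * l.par) • U.mode (letter l) n (U.mode (letter k) m v) +
      (if m + n = -1 then k.pairing l else 0) • v := by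
  rw [hasOPE_letter.comm k l m n v]
  simp

theorem letter_zero_letter (k l : Letter) :
    U.mode (letter k) 0 (letter l) = k.pairing l • U.vac := by
  rw [hasOPE_letter.zero k l]
  simp

theorem letter_pos_letter (k l : Letter) {n : ℤ} (hn : 0 < n) :
    U.mode (letter k) n (letter l) = 0 := by
  rcases (show n = 1 ∨ 2 ≤ n by omega) with rfl | hn
  · rw [hasOPE_letter.one k l, zero_smul]
  · exact hasOPE_letter.two_le k l n hn

/-- The quadratic vector `k_(-1) l`. -/
def quad (k l : Letter) : M ⊗[ℂ] F := U.mode (letter k) (-1) (letter l)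

theorem homog_quad (k l : Letter) : U.Homog (k.par + l.par) (quad k l) :=
  (hasOPE_letter.homog k).mode (hasOPE_letter.homog l) _

/-- Two modes of index `-1` supercommute, since `δ_(m+n,-1)` vanishes there. -/
theorem quad_swap (k l : Letter) : quad l k = (-1 : ℂ) ^ (k.par * l.par) • quad k l := by
  have h := letter_comm l k (-1) (-1) U.vac
  rw [U.mode_neg_one_vac, U.mode_neg_one_vac, if_neg (by norm_num), zero_smul, add_zero,
    mul_comm] at h
  exact h

/-- Wick's theorem for one contraction: `j_(0)` contracts `j` with either factor of `k_(-1) l`, and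
all higher products vanish. -/
theorem letter_comm_quad (j k l : Letter) (m n : ℤ) (v : M ⊗[ℂ] F) :
    U.mode (letter j) m (U.mode (quad k l) n v) =
      (-1 : ℂ) ^ (j.par * (k.par + l.par)) • U.mode (quad k l) n (U.mode (letter j) m v) +
      j.pairing k • U.mode (letter l) (m + n) v +
      ((-1 : ℂ) ^ (j.par * k.par) * j.pairing l) • U.mode (letter k) (m + n) v := by
  have h0 : U.mode (letter j) 0 (quad k l) =
      j.pairing k • letter l + ((-1 : ℂ) ^ (j.par * k.par) * j.pairing l) • letter k := by
    rw [quad, letter_comm, if_pos (by norm_num), letter_zero_letter, map_smul, U.mode_neg_one_vac]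
    module
  have h1 : ∀ n : ℕ, 1 ≤ n → U.mode (letter j) n (quad k l) = 0 := by
    intro n hn
    rw [quad, letter_comm, if_neg (by omega), letter_pos_letter j l (by omega), map_zero, smul_zero,
      zero_smul, add_zero]
  rw [U.commutator (hasOPE_letter.homog j) (homog_quad k l) h1, Finset.sum_range_one,
    Nat.cast_zero, h0]
  simp [add_assoc]

/-- Obtained without skew-symmetry: the commutator with `j_(-1)`, applied to the vacuum, has
left-hand side zero because the mode `0` of the quadratic vector kills the vacuum. -/
theorem quad_zero_letter (k l j : Letter) : U.mode (quad k l) 0 (letter j) =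
    -((-1 : ℂ) ^ (j.par * (k.par + l.par)) • (j.pairing k • letter l +
      ((-1 : ℂ) ^ (j.par * k.par) * j.pairing l) • letter k)) := by
  have h := letter_comm_quad j k l (-1) 0 U.vac
  rw [U.mode_vac _ 0 le_rfl, map_zero, U.mode_neg_one_vac, add_zero, U.mode_neg_one_vac,
    U.mode_neg_one_vac, add_assoc] at h
  have h2 := congrArg (fun v => (-1 : ℂ) ^ (j.par * (k.par + l.par)) • v)
    (eq_neg_of_add_eq_zero_left h.symm)
  simp only [smul_smul, GeneratingFields.sign_sq, one_smul, smul_neg] at h2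
  exact h2

theorem quad_pos_letter (k l j : Letter) {n : ℤ} (hn : 0 < n) :
    U.mode (quad k l) n (letter j) = 0 := by
  have h := letter_comm_quad j k l (-1) n U.vac
  rw [U.mode_vac _ n hn.le, map_zero, U.mode_neg_one_vac, U.mode_vac _ (-1 + n) (by omega),
    U.mode_vac _ (-1 + n) (by omega), smul_zero, smul_zero, add_zero, add_zero] at h
  exact (smul_eq_zero.1 h.symm).resolve_left (pow_ne_zero _ (by norm_num))

/-- Moving `X_(n)` past `k_(-1)` leaves only the first order pole, as `X_(j) k = 0` for `j > 0`.
Products with quadratic vectors thus reduce to the action of `X` on the generators. -/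
theorem mode_quad {p : ℕ} {X : M ⊗[ℂ] F} (hX : U.Homog p X)
    (h : ∀ j n, 0 < n → U.mode X n (letter j) = 0) (k l : Letter) (n : ℤ) :
    U.mode X n (quad k l) =
      (-1 : ℂ) ^ (p * k.par) • U.mode (letter k) (-1) (U.mode X n (letter l)) +
      U.mode (U.mode X 0 (letter k)) (n - 1) (letter l) := by
  rw [quad, U.commutator hX (hasOPE_letter.homog k) (N := 1) (fun j hj => h k j (by omega)),
    Finset.sum_range_one, Ring.choose_zero_right, Int.cast_one, one_smul, Nat.cast_zero, sub_zero,
    ← sub_eq_add_neg]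

/-! ### The operator product expansions of `E`, `N`, `Ψ⁺`, `Ψ⁻` in `𝒰` -/

theorem PsiP_eq : PsiP = quad (.inl .a) (.inr .psi) := by
  rw [quad, show letter (.inr .psi) = weylVA.vac ⊗ₜ cliffordData.state .psi from rfl,
    letter_inl_mode]
  rfl

theorem PsiM_eq : PsiM = quad (.inl .aStar) (.inr .psiStar) := by
  rw [quad, show letter (.inr .psiStar) = weylVA.vac ⊗ₜ cliffordData.state .psiStar from rfl,
    letter_inl_mode]
  rfl

theorem beta_tmul_vac : beta ⊗ₜ[ℂ] cliffordVA.vac = quad (.inl .a) (.inl .aStar) := by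
  rw [quad, show letter (.inl .aStar) = weylData.state .aStar ⊗ₜ cliffordVA.vac from rfl,
    letter_inl_mode, ← weylData.mode_state]
  rfl

theorem vac_tmul_gamma : weylVA.vac ⊗ₜ[ℂ] gamma = quad (.inr .psi) (.inr .psiStar) := by
  rw [quad, show letter (.inr .psiStar) = weylVA.vac ⊗ₜ cliffordData.state .psiStar from rfl,
    letter_inr_mode, ← cliffordData.mode_state]
  rfl

theorem vecE_eq : vecE = quad (.inr .psi) (.inr .psiStar) + quad (.inl .a) (.inl .aStar) := by
  rw [vecE, beta_tmul_vac, vac_tmul_gamma]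

theorem vecN_eq : vecN =
    (2⁻¹ : ℂ) • (quad (.inr .psi) (.inr .psiStar) - quad (.inl .a) (.inl .aStar)) := by
  rw [vecN, beta_tmul_vac, vac_tmul_gamma]

theorem vec_eq (x : Gl11) : vec x = match x with
    | .E => quad (.inr .psi) (.inr .psiStar) + quad (.inl .a) (.inl .aStar)
    | .N => (2⁻¹ : ℂ) • (quad (.inr .psi) (.inr .psiStar) - quad (.inl .a) (.inl .aStar))
    | .PsiP => quad (.inl .a) (.inr .psi)
    | .PsiM => quad (.inl .aStar) (.inr .psiStar) := by
  cases x
  exacts [vecE_eq, vecN_eq, PsiP_eq, PsiM_eq]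

theorem homog_vec (x : Gl11) : U.Homog x.par (vec x) := by
  have hg : U.Homog 0 (quad (.inr .psi) (.inr .psiStar)) := (homog_quad _ _).congr (by
    norm_num [Letter.par])
  have hb : U.Homog 0 (quad (.inl .a) (.inl .aStar)) := homog_quad _ _
  cases x
  · rw [vec, vecE_eq]
    exact hg.add hb
  · rw [vec, vecN_eq, sub_eq_add_neg, ← neg_one_smul ℂ]
    exact (hg.add (hb.smul _)).smul _
  · rw [vec, PsiP_eq]
    exact homog_quad _ _
  · rw [vec, PsiM_eq]
    exact homog_quad _ _

theorem vec_pos_letter (x : Gl11) (j : Letter) (n : ℤ) (hn : 0 < n) :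
    U.mode (vec x) n (letter j) = 0 := by
  cases x <;> simp [vec, vecE_eq, vecN_eq, PsiP_eq, PsiM_eq, quad_pos_letter _ _ _ hn]

/-- Together with the next three tables this describes the zero modes on the generators: `a`, `ψ*`
span a two-dimensional `gl(1|1)`-module on which `E` is `-1`, and `a*`, `ψ` one on which `E` is `1`.
-/
theorem vecE_zero_letter (j : Letter) : U.mode vecE 0 (letter j) = (j.charge : ℂ) • letter j := by
  rw [vecE_eq, map_add, Pi.add_apply, LinearMap.add_apply, quad_zero_letter, quad_zero_letter]
  rcases j with (_ | _) | (_ | _) <;>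
    simp [Letter.pairing, Letter.par, Letter.charge] <;> module

theorem vecN_zero_letter (j : Letter) : U.mode vecN 0 (letter j) =
    ((2⁻¹ : ℂ) * (if j = .inl .a ∨ j = .inr .psi then 1 else -1)) • letter j := by
  rw [vecN_eq, map_smul, Pi.smul_apply, LinearMap.smul_apply, map_sub, Pi.sub_apply,
    LinearMap.sub_apply, quad_zero_letter, quad_zero_letter]
  rcases j with (_ | _) | (_ | _) <;>
    simp [Letter.pairing, Letter.par] <;> module

theorem PsiP_zero_letter (j : Letter) : U.mode PsiP 0 (letter j) =
    match j with
    | .inl .aStar => letter (.inr .psi)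
    | .inr .psiStar => letter (.inl .a)
    | _ => 0 := by
  rw [PsiP_eq, quad_zero_letter]
  rcases j with (_ | _) | (_ | _) <;>
    simp [Letter.pairing, Letter.par] <;> module

theorem PsiM_zero_letter (j : Letter) : U.mode PsiM 0 (letter j) =
    match j with
    | .inl .a => -letter (.inr .psiStar)
    | .inr .psi => letter (.inl .aStar)
    | _ => 0 := by
  rw [PsiM_eq, quad_zero_letter]
  rcases j with (_ | _) | (_ | _) <;>
    simp [Letter.pairing, Letter.par]
  all_goals module

theorem Gl11.sum_univ {E : Type*} [AddCommMonoid E] (f : Gl11 → E) :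
    ∑ x, f x = f .E + (f .N + (f .PsiP + f .PsiM)) := by
  rw [show (Finset.univ : Finset Gl11) = {.E, .N, .PsiP, .PsiM} from rfl]
  simp

/-- All sixteen pairs reduce, by `mode_quad`, to the zero-mode tables on the generators. The first
order poles are then quadratic vectors, compared up to reordering by `quad_swap`; the second order
poles are single contractions. -/
theorem hasOPE_vec : (affineData 1).HasOPE U vec where
  homog := homog_vec
  zero x y := by
    have hq := fun k l => mode_quad (homog_vec x) (vec_pos_letter x) k l 0
    have s1 := quad_swap (.inr .psi) (.inr .psiStar)
    have s2 := quad_swap (.inl .a) (.inl .aStar)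
    have s3 := quad_swap (.inl .a) (.inr .psi)
    have s4 := quad_swap (.inl .aStar) (.inr .psiStar)
    simp only [Letter.par, mul_one, mul_zero, pow_zero, one_smul, pow_one] at s1 s2 s3 s4
    rw [zero_smul, add_zero, Gl11.sum_univ, vec_eq y]
    cases x <;> cases y <;>
    simp only [hq, map_add, map_sub, map_smul] <;>
    simp only [vec, vecE_zero_letter, vecN_zero_letter, PsiP_zero_letter, PsiM_zero_letter] <;>
    simp [Letter.par, Gl11.par, Gl11.bracket, vecE_eq, vecN_eq, PsiP_eq, PsiM_eq, Letter.charge,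
      ← quad.eq_1, s1, s2, s3, s4] <;>
    module
  one x y := by
    have hq := fun k l => mode_quad (homog_vec x) (vec_pos_letter x) k l 1
    simp only [vec_pos_letter _ _ 1 one_pos, map_zero, smul_zero, zero_add, sub_self] at hq
    rw [vec_eq y]
    cases x <;> cases y <;>
    simp only [hq, map_add, map_sub, map_smul] <;>
    simp only [vec, vecE_zero_letter, vecN_zero_letter, PsiP_zero_letter, PsiM_zero_letter] <;>
    simp [Gl11.form, Letter.charge, letter_zero_letter, Letter.pairing] <;>
    module
  two_le x y n hn := by
    have hq : ∀ k l, U.mode (vec x) n (quad k l) = 0 := fun k l => by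
      rw [mode_quad (homog_vec x) (vec_pos_letter x) k l n,
        vec_pos_letter x _ n (by omega), map_zero, smul_zero, zero_add]
      cases x <;>
        simp only [vec, vecE_zero_letter, vecN_zero_letter, PsiP_zero_letter, PsiM_zero_letter]
      · simp [letter_pos_letter _ _ (show 0 < n - 1 by omega)]
      · rw [map_smul, Pi.smul_apply, LinearMap.smul_apply,
          letter_pos_letter _ _ (show 0 < n - 1 by omega), smul_zero]
      · rcases k with (_ | _) | (_ | _) <;> simp [letter_pos_letter _ _ (show 0 < n - 1 by omega)]
      · rcases k with (_ | _) | (_ | _) <;> simp [letter_pos_letter _ _ (show 0 < n - 1 by omega)]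
    rw [vec_eq y]
    cases y <;> simp only [hq, map_add, map_sub, map_smul, add_zero, sub_zero, smul_zero]

/-! ### Spaces generated from a vector of weight zero -/

/-- If operators which raise the eigenvalues of `L` by positive integers generate the space from a
vector in the kernel of `L`, then every vector is, up to a multiple of that vector, killed by
a polynomial in `L` with non-zero constant term. -/
theorem exists_aeval_sub_smul_eq_zero {V ι : Type*} [AddCommGroup V] [Module ℂ V]
    {L : Module.End ℂ V} {vac : V} {c : ι → Module.End ℂ V} {wt : ι → ℕ} (hwt : ∀ i, 0 < wt i)
    (h0 : L vac = 0) (hL : ∀ i v, L (c i v) = c i (L v) + (wt i : ℂ) • c i v)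
    (hgen : ∀ S : Submodule ℂ V, vac ∈ S → (∀ i v, v ∈ S → c i v ∈ S) → S = ⊤) (v : V) :
    ∃ (r : ℂ) (p : Polynomial ℂ), p.eval 0 ≠ 0 ∧ Polynomial.aeval L p (v - r • vac) = 0 := by
  -- `P` is the span of the eigenvectors with positive integer eigenvalue. Creation operators map
  -- both `vac` and `P` into `P`, and each element of `P` is killed by a product of factors `X - n`
  -- with `n > 0`.
  let P : Submodule ℂ V := Submodule.span ℂ {v | ∃ n : ℕ, 0 < n ∧ L v = (n : ℂ) • v}
  have hS : (ℂ ∙ vac) ⊔ P = ⊤ := by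
    refine hgen _ (Submodule.mem_sup_left (Submodule.mem_span_singleton_self vac)) fun i v hv => ?_
    obtain ⟨x, hx, y, hy, rfl⟩ := Submodule.mem_sup.1 hv
    refine Submodule.mem_sup_right ?_
    clear hv
    rw [map_add]
    refine P.add_mem ?_ ?_
    · obtain ⟨r, rfl⟩ := Submodule.mem_span_singleton.1 hx
      refine Submodule.subset_span ⟨wt i, hwt i, ?_⟩
      rw [hL, map_smul, h0, smul_zero, map_zero, zero_add]
    · induction hy using Submodule.span_induction with
      | mem y hy =>
        obtain ⟨n, hn, hy⟩ := hy
        refine Submodule.subset_span ⟨n + wt i, by omega, ?_⟩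
        rw [hL, hy, map_smul]
        push_cast
        module
      | zero => rw [map_zero]; exact P.zero_mem
      | add y z _ _ h1 h2 => rw [map_add]; exact P.add_mem h1 h2
      | smul c y _ h1 => rw [map_smul]; exact P.smul_mem _ h1
  have hP : ∀ y ∈ P, ∃ p : Polynomial ℂ, p.eval 0 ≠ 0 ∧ Polynomial.aeval L p y = 0 := by
    intro y hy
    induction hy using Submodule.span_induction with
    | mem y hy =>
      obtain ⟨n, hn, hy⟩ := hy
      refine ⟨Polynomial.X - Polynomial.C (n : ℂ), by simp [hn.ne'], ?_⟩
      rw [map_sub, Polynomial.aeval_X, Polynomial.aeval_C, Algebra.algebraMap_eq_smul_one,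
        LinearMap.sub_apply, LinearMap.smul_apply, Module.End.one_apply, hy, sub_self]
    | zero => exact ⟨1, by simp, by simp⟩
    | add y z _ _ h1 h2 =>
      obtain ⟨p, hp, hy⟩ := h1
      obtain ⟨q, hq, hz⟩ := h2
      refine ⟨p * q, by simp [hp, hq], ?_⟩
      rw [map_add]
      nth_rewrite 1 [mul_comm]
      rw [map_mul, map_mul, Module.End.mul_apply, Module.End.mul_apply, hy, hz, map_zero, map_zero,
        add_zero]
    | smul c y _ h1 =>
      obtain ⟨p, hp, hy⟩ := h1
      exact ⟨p, hp, by rw [map_smul, hy, smul_zero]⟩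
  have hv : v ∈ (ℂ ∙ vac) ⊔ P := by rw [hS]; trivial
  obtain ⟨x, hx, y, hy, rfl⟩ := Submodule.mem_sup.1 hv
  obtain ⟨r, rfl⟩ := Submodule.mem_span_singleton.1 hx
  obtain ⟨p, hp, hpy⟩ := hP y hy
  exact ⟨r, p, hp, by rw [add_sub_cancel_left, hpy]⟩

theorem aeval_of_map_eq_zero {V : Type*} [AddCommGroup V] [Module ℂ V] {L : Module.End ℂ V}
    {v : V} (h : L v = 0) (p : Polynomial ℂ) : Polynomial.aeval L p v = p.eval 0 • v := by
  induction p using Polynomial.induction_on' with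
  | add p q hp hq => rw [map_add, LinearMap.add_apply, hp, hq, Polynomial.eval_add, add_smul]
  | monomial n a =>
    rw [Polynomial.aeval_monomial, Algebra.algebraMap_eq_smul_one, smul_one_mul,
      LinearMap.smul_apply, Polynomial.eval_monomial]
    cases n with
    | zero => simp
    | succ n => rw [pow_succ, Module.End.mul_apply, h]; simp

/-- Clifford modes applied to the vacuum give `1 ⊗ F`, and Weyl modes then give all pure tensors. -/
theorem generates_U (S : Submodule ℂ (M ⊗[ℂ] F)) (h0 : U.vac ∈ S)
    (h : ∀ j n v, n < 0 → v ∈ S → U.mode (letter j) n v ∈ S) : S = ⊤ := by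
  have h1 : ∀ d : F, weylVA.vac ⊗ₜ d ∈ S := by
    intro d
    have := cliffordData.generates (S.comap (TensorProduct.mk ℂ M F weylVA.vac)) h0
      fun i n v hn hv => by
        have := h (.inr i) n _ hn hv
        rwa [TensorProduct.mk_apply, letter_inr_mode] at this
    have hd : d ∈ S.comap (TensorProduct.mk ℂ M F weylVA.vac) := by rw [this]; trivial
    exact hd
  have h2 : ∀ (c : M) (d : F), c ⊗ₜ d ∈ S := by
    intro c d
    have := weylData.generates (S.comap ((TensorProduct.mk ℂ M F).flip d)) (h1 d)
      fun i n v hn hv => by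
        have := h (.inl i) n _ hn hv
        rwa [LinearMap.flip_apply, TensorProduct.mk_apply, letter_inl_mode] at this
    have hd : c ∈ S.comap ((TensorProduct.mk ℂ M F).flip d) := by rw [this]; trivial
    exact hd
  rw [eq_top_iff, ← TensorProduct.span_tmul_eq_top, Submodule.span_le]
  rintro _ ⟨c, d, rfl⟩
  exact h2 c d

/-! ### Irreducibility of `𝒰` under the free fields -/

namespace Letter

/-- The generator dual to `k`. -/
def dual : Letter → Letter
  | .inl .a => .inl .aStar
  | .inl .aStar => .inl .a
  | .inr .psi => .inr .psiStar
  | .inr .psiStar => .inr .psi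

end Letter

/-- The creation operators on `𝒰`. -/
def creation (p : Letter × ℕ) : Module.End ℂ (M ⊗[ℂ] F) := U.mode (letter p.1) (-1 - p.2)

/-- The annihilation operators on `𝒰`, normalized to be dual to the creation operators. -/
def annihilation (p : Letter × ℕ) : Module.End ℂ (M ⊗[ℂ] F) :=
  p.1.dual.pairing p.1 • U.mode (letter p.1.dual) p.2

theorem creation_comm (p q : Letter × ℕ) (v : M ⊗[ℂ] F) : creation p (creation q v) =
    (-1 : ℂ) ^ (p.1.par * q.1.par) • creation q (creation p v) := by
  rw [creation, creation, letter_comm, if_neg (by omega), zero_smul, add_zero]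

/-- The scalar in `annihilation` compensates the antisymmetry of the Weyl pairing, so that every
contraction is exactly `1`. -/
theorem annihilation_creation (p q : Letter × ℕ) (v : M ⊗[ℂ] F) :
    annihilation p (creation q v) =
      (-1 : ℂ) ^ (p.1.par * q.1.par) • creation q (annihilation p v) +
        (if p = q then v else 0) := by
  obtain ⟨k, i⟩ := p
  obtain ⟨l, j⟩ := q
  simp only [annihilation, creation, LinearMap.smul_apply, map_smul]
  have hc : (i : ℤ) + (-1 - j) = -1 ↔ i = j := by omega
  rw [letter_comm]
  simp only [hc]
  by_cases hij : i = j
  · rcases k with (_ | _) | (_ | _) <;> rcases l with (_ | _) | (_ | _) <;>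
      simp [hij, Letter.dual, Letter.pairing, Letter.par] <;> module
  · rcases k with (_ | _) | (_ | _) <;> rcases l with (_ | _) | (_ | _) <;>
      simp [hij, Letter.dual, Letter.pairing, Letter.par] <;> module

theorem annihilation_vac (p : Letter × ℕ) : annihilation p U.vac = 0 := by
  rw [annihilation, LinearMap.smul_apply, U.mode_vac _ _ (by omega), smul_zero]

theorem annihilation_finite (v : M ⊗[ℂ] F) :
    (Function.support fun p => annihilation p v).Finite := by
  have h : ∀ k : Letter, ∃ N : ℕ, ∀ i : ℕ, N ≤ i → annihilation (k, i) v = 0 := by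
    intro k
    obtain ⟨N, hN⟩ := U.truncation (letter k.dual) v
    exact ⟨N.toNat, fun i hi => by
      rw [annihilation, LinearMap.smul_apply, hN _ (by simp only; omega), smul_zero]⟩
  choose N hN using h
  refine (Set.finite_univ.biUnion fun (k : Letter) _ =>
    (Set.finite_lt_nat (N k)).image fun i => (k, i)).subset ?_
  rintro ⟨k, i⟩ hp
  refine Set.mem_biUnion (Set.mem_univ k) ⟨i, ?_, rfl⟩
  by_contra hc
  exact hp (hN k i (by simpa using hc))

/-- The particle number operator. -/
def number : Module.End ℂ (M ⊗[ℂ] F) := psum fun p => creation p * annihilation p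

theorem number_finite (v : M ⊗[ℂ] F) :
    (Function.support fun p => creation p (annihilation p v)).Finite :=
  (annihilation_finite v).subset fun p hp h0 => hp (by
    change annihilation p v = 0 at h0
    simp only [h0, map_zero])

theorem number_apply (v : M ⊗[ℂ] F) : number v = ∑ᶠ p, creation p (annihilation p v) :=
  psum_apply (f := fun p => creation p * annihilation p) number_finite v

/-- Moving `creation q` to the left through `creation p` and `annihilation p` produces the same sign
twice, so the particle number rises by exactly one for bosons and fermions alike. -/
theorem number_creation (q : Letter × ℕ) (v : M ⊗[ℂ] F) :
    number (creation q v) = creation q (number v) + creation q v := by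
  have e : ∀ p, creation p (annihilation p (creation q v)) =
      creation q (creation p (annihilation p v)) + (if p = q then creation p v else 0) := by
    intro p
    rw [annihilation_creation, map_add, map_smul, creation_comm p q, smul_smul,
      GeneratingFields.sign_sq, one_smul]
    split <;> simp
  have hf := number_finite v
  have m1 := (creation q).toAddMonoidHom.map_finsum hf
  simp only [LinearMap.toAddMonoidHom_coe] at m1
  have hf' : (Function.support fun p => creation q (creation p (annihilation p v))).Finite :=
    hf.subset (Function.support_comp_subset (map_zero (creation q)) _)
  rw [number_apply, number_apply, m1, finsum_congr e, finsum_add_distrib hf'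
    ((Set.finite_singleton q).subset fun p hp => by
      by_contra hc
      exact hp (if_neg hc)), finsum_eq_single (fun p => if p = q then creation p v else 0) q
        fun p hp => if_neg hp, if_pos rfl]

theorem generates_creation (S : Submodule ℂ (M ⊗[ℂ] F)) (h0 : U.vac ∈ S)
    (h : ∀ p v, v ∈ S → creation p v ∈ S) : S = ⊤ :=
  generates_U S h0 fun j n v hn hv => by
    have := h (j, (-1 - n).toNat) v hv
    rwa [creation, show -1 - (((-1 - n).toNat : ℕ) : ℤ) = n by omega] at this

/-- Such a vector has particle number zero, while modulo the vacuum it is killed by a polynomial in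
`number` with non-zero constant term. -/
theorem eq_smul_vac_of_annihilation {v : M ⊗[ℂ] F} (h : ∀ p, annihilation p v = 0) :
    ∃ r : ℂ, v = r • U.vac := by
  have hn : ∀ v, (∀ p, annihilation p v = 0) → number v = 0 := fun v h => by
    rw [number_apply]
    exact finsum_eq_zero_of_forall_eq_zero fun p => by rw [h, map_zero]
  obtain ⟨r, p, hp, hv⟩ := exists_aeval_sub_smul_eq_zero (L := number) (vac := U.vac)
    (c := creation) (wt := fun _ => 1) (fun _ => one_pos) (hn _ annihilation_vac)
    (fun q v => by rw [number_creation, Nat.cast_one, one_smul]) generates_creation v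
  rw [aeval_of_map_eq_zero (by rw [map_sub, map_smul, hn v h, hn _ annihilation_vac, smul_zero,
    sub_zero])] at hv
  exact ⟨r, sub_eq_zero.1 ((smul_eq_zero.1 hv).resolve_left hp)⟩

/-- The vectors killed by all products of `n` annihilation operators. -/
def killed : ℕ → Submodule ℂ (M ⊗[ℂ] F)
  | 0 => ⊥
  | n + 1 => ⨅ p, (killed n).comap (annihilation p)

theorem mem_killed_succ {n : ℕ} {v : M ⊗[ℂ] F} :
    v ∈ killed (n + 1) ↔ ∀ p, annihilation p v ∈ killed n := by
  simp [killed]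

theorem killed_le_succ (n : ℕ) : killed n ≤ killed (n + 1) := by
  induction n with
  | zero => exact bot_le
  | succ n ih => exact fun v hv => mem_killed_succ.2 fun p => ih (mem_killed_succ.1 hv p)

theorem creation_mem_killed {n : ℕ} (q : Letter × ℕ) {v : M ⊗[ℂ] F} (hv : v ∈ killed n) :
    creation q v ∈ killed (n + 1) := by
  induction n generalizing v with
  | zero =>
    rw [show v = 0 from hv, map_zero]
    exact Submodule.zero_mem _
  | succ n ih =>
    refine mem_killed_succ.2 fun p => ?_
    rw [annihilation_creation]
    refine Submodule.add_mem _ (Submodule.smul_mem _ _ (ih (mem_killed_succ.1 hv p))) ?_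
    split
    · exact hv
    · exact Submodule.zero_mem _

/-- A creation operator raises the level of the filtration by at most one, so the union of the
levels contains everything created from the vacuum. Hence repeated annihilation always terminates.
-/
theorem exists_mem_killed (v : M ⊗[ℂ] F) : ∃ n, v ∈ killed n := by
  have hmono : Monotone killed := monotone_nat_of_le_succ killed_le_succ
  have htop : ⨆ n, killed n = ⊤ := by
    refine generates_creation _ (Submodule.mem_iSup_of_mem 1 (mem_killed_succ.2 fun p => ?_))
      fun p v hv => ?_
    · rw [annihilation_vac]
      exact Submodule.zero_mem _
    · obtain ⟨n, hn⟩ := (Submodule.mem_iSup_of_directed _ hmono.directed_le).1 hv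
      exact Submodule.mem_iSup_of_mem (n + 1) (creation_mem_killed p hn)
  have hv : v ∈ ⨆ n, killed n := by rw [htop]; trivial
  exact (Submodule.mem_iSup_of_directed _ hmono.directed_le).1 hv

/-- `𝒰` is irreducible under the modes of its generators. -/
theorem eq_top_of_letter_mem {S : Submodule ℂ (M ⊗[ℂ] F)} (hS : S ≠ ⊥)
    (h : ∀ j n v, v ∈ S → U.mode (letter j) n v ∈ S) : S = ⊤ := by
  -- Annihilate as long as the result is non-zero; when every annihilation operator gives zero, the
  -- vector is a non-zero multiple of the vacuum.
  have key : ∀ n, ∀ v ∈ killed n, v ∈ S → v ≠ 0 → U.vac ∈ S := by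
    intro n
    induction n with
    | zero => exact fun v hv _ h0 => absurd hv h0
    | succ n ih =>
      intro v hv hvS h0
      by_cases hp : ∀ p, annihilation p v = 0
      · obtain ⟨r, rfl⟩ := eq_smul_vac_of_annihilation hp
        have := S.smul_mem r⁻¹ hvS
        rwa [smul_smul, inv_mul_cancel₀ (fun hr => h0 (by rw [hr, zero_smul])), one_smul] at this
      · push Not at hp
        obtain ⟨p, hp⟩ := hp
        exact ih _ (mem_killed_succ.1 hv p) (S.smul_mem _ (h _ _ _ hvS)) hp
  obtain ⟨v, hv, h0⟩ := Submodule.exists_mem_ne_zero_of_ne_bot hS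
  obtain ⟨n, hn⟩ := exists_mem_killed v
  exact generates_U S (key n v hn hv h0) fun j n v _ hv => h j n v hv

/-! ### The charge -/

theorem homog_vecE : U.Homog 0 vecE := homog_vec .E

theorem charge_letter (j : Letter) (n : ℤ) (v : M ⊗[ℂ] F) : U.mode vecE 0 (U.mode (letter j) n v) =
    U.mode (letter j) n (U.mode vecE 0 v) + (j.charge : ℂ) • U.mode (letter j) n v := by
  rw [U.zero_mode_mode homog_vecE, vecE_zero_letter, map_smul]
  rfl

/-- The kernel of a zero mode of an even vector, which is a derivation of all products and commutes
with parity. -/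
theorem isSubalgebra_U0 : U.IsSubalgebra U0 where
  vac_mem := U.mode_vac _ 0 le_rfl
  parity_mem v hv := by
    have hv : U.mode vecE 0 v = 0 := hv
    have hE : U.parity vecE = vecE := by
      have := homog_vecE
      rwa [VertexSuperalgebra.Homog, pow_zero, one_smul] at this
    have := U.parity_mode vecE 0 v
    rw [hv, map_zero, hE] at this
    exact this.symm
  mode_mem v hv n w hw := by
    have hv : U.mode vecE 0 v = 0 := hv
    have hw : U.mode vecE 0 w = 0 := hw
    change U.mode vecE 0 _ = 0
    rw [U.zero_mode_mode homog_vecE, hv, hw]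
    simp

theorem Letter.charge_eq_or (j : Letter) : j.charge = 1 ∨ j.charge = -1 := by
  rcases j with (_ | _) | (_ | _) <;> simp [Letter.charge]

/-- The vectors obtained from `S` by `n` generators of charge `ε`. -/
def charged (S : Submodule ℂ (M ⊗[ℂ] F)) (ε : ℤ) : ℕ → Submodule ℂ (M ⊗[ℂ] F)
  | 0 => S
  | n + 1 => Submodule.span ℂ
      {w | ∃ j m v, Letter.charge j = ε ∧ v ∈ charged S ε n ∧ w = U.mode (letter j) m v}

/-- Only `charged S ε 0 = S` has charge zero if `ε ≠ 0`; this allows `S` to be separated from the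
rest. -/
theorem charged_le_eigenspace {S : Submodule ℂ (M ⊗[ℂ] F)} (hS : S ≤ U0) (ε : ℤ) (n : ℕ) :
    charged S ε n ≤ Module.End.eigenspace (U.mode vecE 0) ((ε * n : ℤ) : ℂ) := by
  induction n with
  | zero =>
    intro v hv
    rw [Module.End.mem_eigenspace_iff]
    have h : U.mode vecE 0 v = 0 := hS hv
    simp [h]
  | succ n ih =>
    rw [charged, Submodule.span_le]
    rintro _ ⟨j, m, v, hj, hv, rfl⟩
    have := Module.End.mem_eigenspace_iff.1 (ih hv)
    refine Module.End.mem_eigenspace_iff.2 ?_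
    rw [charge_letter, this, hj, map_smul]
    push_cast
    module

/-- A generator of charge `-ε` supercommutes, up to a scalar, with those of charge `ε`. It can be
moved inwards until it meets the innermost one, and the resulting pair of opposite charge preserves
`S`. -/
theorem letter_mem_charged {S : Submodule ℂ (M ⊗[ℂ] F)}
    (hS : ∀ k l, Letter.charge k + Letter.charge l = 0 → ∀ m n, ∀ v ∈ S,
      U.mode (letter k) m (U.mode (letter l) n v) ∈ S) (ε : ℤ) (n : ℕ) (j : Letter)
    (hj : j.charge = -ε) (m : ℤ) {v : M ⊗[ℂ] F} (hv : v ∈ charged S ε (n + 1)) :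
    U.mode (letter j) m v ∈ charged S ε n := by
  induction n generalizing v with
  | zero =>
    change v ∈ Submodule.span ℂ _ at hv
    change U.mode (letter j) m v ∈ S
    induction hv using Submodule.span_induction with
    | mem v hv =>
      obtain ⟨k, l, v, hk, hv, rfl⟩ := hv
      exact hS j k (by omega) m l v hv
    | zero => rw [map_zero]; exact Submodule.zero_mem _
    | add v w _ _ h1 h2 => rw [map_add]; exact Submodule.add_mem _ h1 h2
    | smul c v _ h1 => rw [map_smul]; exact Submodule.smul_mem _ _ h1
  | succ n ih =>
    change v ∈ Submodule.span ℂ _ at hv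
    induction hv using Submodule.span_induction with
    | mem v hv =>
      obtain ⟨k, l, v, hk, hv, rfl⟩ := hv
      rw [letter_comm]
      exact Submodule.add_mem _ (Submodule.smul_mem _ _
        (Submodule.subset_span ⟨k, l, _, hk, ih hv, rfl⟩)) (Submodule.smul_mem _ _ hv)
    | zero => rw [map_zero]; exact Submodule.zero_mem _
    | add v w _ _ h1 h2 => rw [map_add]; exact Submodule.add_mem _ h1 h2
    | smul c v _ h1 => rw [map_smul]; exact Submodule.smul_mem _ _ h1

/-- `𝒰⁰` is irreducible under the products of two generators of opposite charge. -/
theorem eq_U0_of_pairs_mem {S : Submodule ℂ (M ⊗[ℂ] F)} (hS0 : S ≤ U0) (hne : S ≠ ⊥)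
    (hS : ∀ k l, Letter.charge k + Letter.charge l = 0 → ∀ m n, ∀ v ∈ S,
      U.mode (letter k) m (U.mode (letter l) n v) ∈ S) : S = U0 := by
  -- The two towers over `S`, of positive and negative charge, together are stable under all
  -- generators. A generator of charge opposite to a tower descends in it, and from the bottom level
  -- it starts the other tower.
  have htop : (⨆ n, charged S 1 n) ⊔ (⨆ n, charged S (-1) n) = ⊤ := by
    refine eq_top_of_letter_mem (fun h => hne ?_) fun j m v hv => ?_
    · rw [← le_bot_iff, ← h]
      exact (le_iSup (charged S 1) 0).trans le_sup_left
    · have up : ∀ ε n, j.charge = ε → ∀ v ∈ charged S ε n, U.mode (letter j) m v ∈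
          ⨆ n, charged S ε n := fun ε n hj v hv =>
        Submodule.mem_iSup_of_mem (n + 1) (Submodule.subset_span ⟨j, m, v, hj, hv, rfl⟩)
      have all : ∀ ε n, j.charge = ε ∨ j.charge = -ε → ∀ v ∈ charged S ε n,
          U.mode (letter j) m v ∈ (⨆ n, charged S ε n) ⊔ ⨆ n, charged S (-ε) n := by
        rintro ε n (hj | hj) v hv
        · exact Submodule.mem_sup_left (up ε n hj v hv)
        · cases n with
          | zero => exact Submodule.mem_sup_right (up (-ε) 0 hj v hv)
          | succ n =>
            exact Submodule.mem_sup_left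
              (Submodule.mem_iSup_of_mem n (letter_mem_charged hS ε n j hj m hv))
      let T : Submodule ℂ (M ⊗[ℂ] F) := (⨆ n, charged S 1 n) ⊔ (⨆ n, charged S (-1) n)
      have key : T ≤ T.comap (U.mode (letter j) m) := by
        refine sup_le (iSup_le fun n v hv => ?_) (iSup_le fun n v hv => ?_)
        · exact all 1 n j.charge_eq_or v hv
        · have h' := all (-1) n (by have := j.charge_eq_or; omega) v hv
          rw [neg_neg, sup_comm] at h'
          exact h'
      exact key hv
  refine le_antisymm hS0 fun v hv => ?_
  -- All levels but the lowest lie in eigenspaces of `E(0)` with non-zero eigenvalue. By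
  -- independence of eigenspaces, a vector of `𝒰⁰` has no component there and so lies in `S`.
  have hle : ∀ ε : ℤ, ε ≠ 0 → ∀ n, charged S ε n ≤ S ⊔ ⨆ c : ℂ, ⨆ (_ : c ≠ 0),
      Module.End.eigenspace (U.mode vecE 0) c := by
    intro ε hε n
    cases n with
    | zero => exact le_sup_left
    | succ n =>
      refine (charged_le_eigenspace hS0 ε (n + 1)).trans (le_trans ?_ le_sup_right)
      exact le_iSup₂_of_le (f := fun (c : ℂ) (_ : c ≠ 0) =>
        Module.End.eigenspace (U.mode vecE 0) c) _
        (Int.cast_ne_zero.2 (mul_ne_zero hε (by omega))) le_rfl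
  have hv' : v ∈ S ⊔ ⨆ c : ℂ, ⨆ (_ : c ≠ 0), Module.End.eigenspace (U.mode vecE 0) c := by
    have : (⊤ : Submodule ℂ (M ⊗[ℂ] F)) ≤ _ := htop ▸
      sup_le (iSup_le (hle 1 one_ne_zero)) (iSup_le (hle (-1) (by norm_num)))
    exact this trivial
  obtain ⟨s, hs, w, hw, rfl⟩ := Submodule.mem_sup.1 hv'
  have hw0 : w ∈ Module.End.eigenspace (U.mode vecE 0) 0 := by
    rw [Module.End.mem_eigenspace_iff, zero_smul]
    have h1 : U.mode vecE 0 (s + w) = 0 := hv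
    rwa [map_add, show U.mode vecE 0 s = 0 from hS0 hs, zero_add] at h1
  have := Submodule.disjoint_def.1 (Module.End.eigenspaces_iSupIndep (U.mode vecE 0) 0) w hw0 hw
  rw [this, add_zero]
  exact hs

/-! ### Isolating products of modes inside normally ordered products -/

section Isolation

variable {E : Type*} [AddCommGroup E]

/-- Joins the two halves of a normally ordered product into one sum over `ℤ`; the cut `c` absorbs
the index shift caused by derivatives. -/
theorem finsum_int_split {f : ℤ → E} (hf : (Function.support f).Finite) (c : ℤ) :
    ∑ᶠ j : ℕ, f (-1 - j + c) + ∑ᶠ j : ℕ, f (j + c) = ∑ᶠ r, f r := by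
  let g₁ : ℕ → ℤ := fun j => -1 - j + c
  let g₂ : ℕ → ℤ := fun j => j + c
  have h₁ : Function.Injective g₁ := fun i j h => by simp only [g₁] at h; omega
  have h₂ : Function.Injective g₂ := fun i j h => by simp only [g₂] at h; omega
  have hd : Disjoint (Set.range g₁) (Set.range g₂) := by
    rw [Set.disjoint_left]
    rintro _ ⟨i, rfl⟩ ⟨j, h⟩
    simp only [g₁, g₂] at h
    omega
  have hu : Set.range g₁ ∪ Set.range g₂ = Set.univ := by
    refine Set.eq_univ_of_forall fun r => ?_
    rcases lt_or_ge r c with h | h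
    · exact Or.inl ⟨(-1 - r + c).toNat, by simp only [g₁]; omega⟩
    · exact Or.inr ⟨(r - c).toNat, by simp only [g₂]; omega⟩
  rw [← finsum_mem_univ f, ← hu, finsum_mem_union' hd (hf.subset Set.inter_subset_right)
    (hf.subset Set.inter_subset_right), finsum_mem_range h₁, finsum_mem_range h₂]

variable [Module ℂ E]

/-- The polynomial `(-X - 1) ⋯ (-X - k)`. -/
def fallPoly (k : ℕ) : Polynomial ℂ :=
  ∏ l ∈ Finset.range k, (-Polynomial.X - Polynomial.C ((l : ℂ) + 1))

theorem fallPoly_succ (k : ℕ) :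
    fallPoly (k + 1) = fallPoly k * (-Polynomial.X - Polynomial.C ((k : ℂ) + 1)) :=
  Finset.prod_range_succ _ _

/-- These are the indices at which the normal orderings of `:A B:` and `:(∂^k A) B:` disagree. -/
theorem fallPoly_eval_eq_zero {k : ℕ} {r : ℤ} (h1 : r < 0) (h2 : -(k : ℤ) ≤ r) :
    (fallPoly k).eval (r : ℂ) = 0 := by
  rw [fallPoly, Polynomial.eval_prod]
  refine Finset.prod_eq_zero (i := (-1 - r).toNat) (by rw [Finset.mem_range]; omega) ?_
  have : (((-1 - r).toNat : ℕ) : ℂ) = ((-1 - r : ℤ) : ℂ) := by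
    rw [← Int.cast_natCast, Int.toNat_of_nonneg (by omega)]
  simp only [Polynomial.eval_sub, Polynomial.eval_neg, Polynomial.eval_X, Polynomial.eval_C, this]
  push_cast
  ring

/-- The span contains `1 = fallPoly 0` and is closed under multiplication by `X`, by the recursion
`X fallPoly k = -fallPoly (k+1) - (k+1) fallPoly k`. -/
theorem span_fallPoly : Submodule.span ℂ (Set.range fallPoly) = ⊤ := by
  rw [eq_top_iff]
  have hX : ∀ p ∈ Submodule.span ℂ (Set.range fallPoly),
      p * Polynomial.X ∈ Submodule.span ℂ (Set.range fallPoly) := by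
    intro p hp
    induction hp using Submodule.span_induction with
    | mem p hp =>
      obtain ⟨k, rfl⟩ := hp
      have e : fallPoly k * Polynomial.X = (-1 : ℂ) • fallPoly (k + 1) +
          (-((k : ℂ) + 1)) • fallPoly k := by
        rw [fallPoly_succ, Polynomial.smul_eq_C_mul, Polynomial.smul_eq_C_mul, map_neg, map_neg,
          map_one]
        ring
      rw [e]
      exact Submodule.add_mem _ (Submodule.smul_mem _ _ (Submodule.subset_span ⟨_, rfl⟩))
        (Submodule.smul_mem _ _ (Submodule.subset_span ⟨_, rfl⟩))
    | zero => rw [zero_mul]; exact Submodule.zero_mem _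
    | add p q _ _ h1 h2 => rw [add_mul]; exact Submodule.add_mem _ h1 h2
    | smul c p _ h1 => rw [smul_mul_assoc]; exact Submodule.smul_mem _ _ h1
  intro p _
  induction p using Polynomial.induction_on' with
  | add p q hp hq => exact Submodule.add_mem _ (hp trivial) (hq trivial)
  | monomial n a =>
    rw [← Polynomial.C_mul_X_pow_eq_monomial, ← Polynomial.smul_eq_C_mul]
    refine Submodule.smul_mem _ _ ?_
    induction n with
    | zero => exact Submodule.subset_span ⟨0, by simp [fallPoly]⟩
    | succ n ih => rw [pow_succ]; exact hX _ (ih trivial)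

/-- If all polynomial moments of a finitely supported family lie in a subspace, then so do its
members. -/
theorem mem_of_moments_mem {S : Submodule ℂ E} {u : ℤ → E} (hu : (Function.support u).Finite)
    (h : ∀ k, ∑ᶠ r : ℤ, (fallPoly k).eval (r : ℂ) • u r ∈ S) (r : ℤ) : u r ∈ S := by
  classical
  have hsum : ∀ p : Polynomial ℂ, ∑ᶠ r : ℤ, p.eval (r : ℂ) • u r =
      ∑ r ∈ hu.toFinset, p.eval (r : ℂ) • u r := fun p =>
    finsum_eq_sum_of_support_subset _ fun r hr => by
      rw [Set.Finite.coe_toFinset]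
      intro h0
      exact hr (by simp only [h0, smul_zero])
  let L : Polynomial ℂ →ₗ[ℂ] E :=
    { toFun := fun p => ∑ r ∈ hu.toFinset, p.eval (r : ℂ) • u r
      map_add' := fun p q => by
        simp only [Polynomial.eval_add, add_smul, Finset.sum_add_distrib]
      map_smul' := fun c p => by
        simp only [Polynomial.eval_smul, smul_eq_mul, mul_smul, Finset.smul_sum, RingHom.id_apply] }
  have hL : ∀ p, L p ∈ S := by
    intro p
    have hle : Submodule.span ℂ (Set.range fallPoly) ≤ S.comap L := by
      rw [Submodule.span_le]
      rintro _ ⟨k, rfl⟩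
      have := h k
      rwa [hsum] at this
    rw [span_fallPoly] at hle
    exact hle trivial
  by_cases hr : r ∈ hu.toFinset
  -- The Lagrange interpolation polynomial, up to scaling: it vanishes on the support except at `r`.
  · let p : Polynomial ℂ := ∏ t ∈ hu.toFinset.erase r, (Polynomial.X - Polynomial.C (t : ℂ))
    have hp : p.eval (r : ℂ) ≠ 0 := by
      rw [Polynomial.eval_prod, Finset.prod_ne_zero_iff]
      intro t ht
      rw [Polynomial.eval_sub, Polynomial.eval_X, Polynomial.eval_C, sub_ne_zero]
      exact fun h => (Finset.mem_erase.1 ht).1 (Int.cast_injective h).symm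
    have e : L p = p.eval (r : ℂ) • u r := by
      refine Finset.sum_eq_single_of_mem r hr fun t ht htr => ?_
      rw [Polynomial.eval_prod, Finset.prod_eq_zero (Finset.mem_erase.2 ⟨htr, ht⟩) (by simp),
        zero_smul]
    have := S.smul_mem (p.eval (r : ℂ))⁻¹ (hL p)
    rwa [e, smul_smul, inv_mul_cancel₀ hp, one_smul] at this
  · have : u r = 0 := by simpa using hr
    rw [this]
    exact S.zero_mem

variable {V : Type*} [AddCommGroup V] [Module ℂ V]

theorem iterate_fieldDeriv (A : ℤ → Module.End ℂ V) (k : ℕ) (r : ℤ) :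
    fieldDeriv^[k] A (r + k) = (fallPoly k).eval (r : ℂ) • A r := by
  induction k with
  | zero => simp [fallPoly]
  | succ k ih =>
    rw [Function.iterate_succ_apply', fieldDeriv,
      show r + ((k + 1 : ℕ) : ℤ) - 1 = r + k by push_cast; ring, ih, smul_smul, fallPoly_succ,
      Polynomial.eval_mul]
    congr 1
    simp only [Polynomial.eval_sub, Polynomial.eval_neg, Polynomial.eval_X, Polynomial.eval_C]
    push_cast
    ring

/-- If the normally ordered products of `B` with all derivatives of `A` preserve a subspace, then
so do the products of their modes. -/
theorem mode_mul_mode_mem {A B : ℤ → Module.End ℂ V} (hA : IsField A) (hB : IsField B) {ε : ℂ}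
    (hA' : ∀ k, IsField (fieldDeriv^[k] A)) {S : Submodule ℂ V}
    (h : ∀ k n, ∀ v ∈ S, nprod ε (fieldDeriv^[k] A) B n v ∈ S) (m r : ℤ) {v : V} (hv : v ∈ S) :
    (if r < 0 then A r (B (m - 1 - r) v) else ε • B (m - 1 - r) (A r v)) ∈ S := by
  -- The summands of the coefficient `m` of `:A B:`, indexed by the mode `r` of `A`.
  set u : ℤ → V := fun r => if r < 0 then A r (B (m - 1 - r) v) else ε • B (m - 1 - r) (A r v)
    with hu
  have hfin : (Function.support u).Finite := by
    obtain ⟨N, hN⟩ := hA v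
    obtain ⟨K, hK⟩ := hB v
    refine (Set.finite_Icc (min 0 (m - 1 - K)) (max 0 N)).subset fun r hr => ?_
    rw [Set.mem_Icc]
    by_contra hc
    refine hr ?_
    simp only [hu]
    split
    · rw [hK _ (by omega), map_zero]
    · rw [hN _ (by omega), map_zero, smul_zero]
  refine mem_of_moments_mem hfin (fun k => ?_) r
  -- The mode `r + k` of `∂^k A` is `fallPoly k` at `r` times `A r`, so the coefficient `m + k` of
  -- `:(∂^k A) B:` is the `k`-th moment of the summands `u`.
  have hk := h k (m + k) v hv
  rw [nprod, nprodAux_apply ε (hA' k) hB] at hk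
  have hf : (Function.support fun r : ℤ => (fallPoly k).eval (r : ℂ) • u r).Finite :=
    hfin.subset fun r hr h0 => hr (by simp only [h0, smul_zero])
  rw [← finsum_int_split hf (-k)]
  convert hk using 2
  · refine finsum_congr fun j => ?_
    have e := iterate_fieldDeriv A k (-1 - j + -k)
    rw [show (-1 - (j : ℤ) + -k) + k = 0 - 1 - j by ring] at e
    simp only [hu]
    rw [e, if_pos (by omega), LinearMap.smul_apply,
      show m - 1 - (-1 - (j : ℤ) + -k) = m + k + j by ring]
  · rw [smul_finsum]
    refine finsum_congr fun j => ?_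
    have e := iterate_fieldDeriv A k (j + -k)
    rw [show ((j : ℤ) + -k) + k = 0 + j by ring] at e
    simp only [hu]
    rw [e, LinearMap.smul_apply, map_smul, show m - 1 - ((j : ℤ) + -k) = m + k - 1 - j by ring]
    -- For `-k ≤ r < 0` the derivative is ordered to the right of `B`, whereas `u` has `A` on the
    -- left; the coefficient vanishes there.
    by_cases hj : (j : ℤ) + -k < 0
    · rw [fallPoly_eval_eq_zero hj (by omega)]
      simp
    · rw [if_neg hj, smul_comm]

end Isolation

/-! ### Subspaces stable under the affine fields -/

section Stable

variable {S : Submodule ℂ (M ⊗[ℂ] F)}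

/-- The identity `:γψ: = ∂ψ` of the boson-fermion correspondence, on states. It comes from `ψ_(-1)
ψ_(-1) ψ* = 0`: commuting `ψ_(-1)` with `γ_(-1)` leaves a contraction equal to `ψ_(-2) 1`. -/
theorem quad_psi_neg_one_psi : U.mode (quad (.inr .psi) (.inr .psiStar)) (-1) (letter (.inr .psi)) =
    U.transl (letter (.inr .psi)) := by
  have h := letter_comm_quad (.inr .psi) (.inr .psi) (.inr .psiStar) (-1) (-1) U.vac
  have h2 : (2 : ℂ) • U.mode (letter (.inr .psi)) (-1) (quad (.inr .psi) (.inr .psiStar)) = 0 := by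
    have := letter_comm (.inr .psi) (.inr .psi) (-1) (-1) (letter (.inr .psiStar))
    rw [if_neg (by norm_num), zero_smul, add_zero] at this
    rw [two_smul, quad]
    nth_rewrite 1 [this]
    simp only [Letter.par, mul_one, pow_one]
    module
  rw [U.mode_neg_one_vac, (smul_eq_zero.1 h2).resolve_left two_ne_zero, U.mode_neg_one_vac] at h
  simp only [Letter.par, Letter.pairing] at h
  rw [U.transl_apply]
  rw [eq_comm, ← sub_eq_zero]
  refine Eq.trans ?_ (neg_eq_zero.2 h.symm)
  rw [show (-1 : ℤ) + -1 = -2 by norm_num]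
  module

/-- The vectors `ψ_(-k) ψ*`. -/
def psiPair (k : ℕ) : M ⊗[ℂ] F := U.mode (letter (.inr .psi)) (-k) (letter (.inr .psiStar))

/-- The vectors `a_(-k) a*`. -/
def aPair (k : ℕ) : M ⊗[ℂ] F := U.mode (letter (.inl .a)) (-k) (letter (.inl .aStar))

theorem homog_psiPair (k : ℕ) : U.Homog 0 (psiPair k) :=
  ((hasOPE_letter.homog _).mode (hasOPE_letter.homog _) _).congr (by norm_num [Letter.par])

theorem homog_aPair (k : ℕ) : U.Homog 0 (aPair k) :=
  (hasOPE_letter.homog _).mode (hasOPE_letter.homog _) _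

/-- The recursion behind the boson-fermion correspondence. -/
theorem succ_smul_psiPair (k : ℕ) : ((k : ℂ) + 1) • psiPair (k + 1) =
    ∑ j ∈ Finset.range (k + 1),
      U.mode (quad (.inr .psi) (.inr .psiStar)) (-1 - j) (psiPair (k - j)) := by
  have hq : U.Homog 2 (quad (.inr .psi) (.inr .psiStar)) := homog_quad _ _
  have hp : U.Homog 1 (letter (.inr .psi)) := hasOPE_letter.homog (.inr .psi)
  have h1 := U.mode_neg_one_mode hq hp
  rw [quad_psi_neg_one_psi, U.mode_transl hp] at h1
  have h2 := congrArg (fun f => f (-k) (letter (.inr .psiStar))) h1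
  simp only [fieldDeriv, nprod] at h2
  -- The coefficient `-k` of `∂ψ = :γψ:`, applied to `ψ*`. In the first half `ψ_(j-k) ψ*` vanishes
  -- for `j > k`; in the second only `γ_(0) ψ* = -ψ*` survives, and it turns the factor `k` from the
  -- derivative into `k + 1`.
  rw [nprodAux_apply _ (U.truncation _) (U.truncation _), finsum_eq_sum_of_support_subset
      (s := Finset.range (k + 1)) _ fun j hj => by
        by_contra hc
        rw [Finset.coe_range, Set.mem_Iio] at hc
        exact hj (by simp only [letter_pos_letter _ _ (show 0 < -(k : ℤ) + j by omega), map_zero]),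
    finsum_eq_single _ 0 fun j hj => by rw [quad_pos_letter _ _ _ (by omega), map_zero],
    Nat.cast_zero, add_zero, quad_zero_letter] at h2
  have e : ∀ j ∈ Finset.range (k + 1),
      U.mode (quad (.inr .psi) (.inr .psiStar)) (0 - 1 - j)
        (U.mode (letter (.inr .psi)) (-k + j) (letter (.inr .psiStar))) =
      U.mode (quad (.inr .psi) (.inr .psiStar)) (-1 - j) (psiPair (k - j)) := by
    intro j hj
    rw [Finset.mem_range] at hj
    rw [psiPair, Nat.cast_sub (by omega), zero_sub, neg_sub, neg_add_eq_sub]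
  rw [Finset.sum_congr rfl e] at h2
  rw [← sub_eq_iff_eq_add.2 h2]
  simp only [psiPair, Letter.par, Letter.pairing]
  rw [show (-((k + 1 : ℕ) : ℤ)) = -k - 1 by push_cast; ring]
  simp
  module

/-- The recursion expresses `ψ_(-k) ψ*` through `γ` alone, starting from `ψ_(0) ψ* = 1`; dividing by
`k + 1` uses characteristic zero. -/
theorem preserves_psiPair
    (hg : U.Preserves S (quad (.inr .psi) (.inr .psiStar))) (k : ℕ) :
    U.Preserves S (psiPair k) := by
  induction k using Nat.strong_induction_on with
  | _ k ih =>
    cases k with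
    | zero =>
      rw [psiPair, Nat.cast_zero, neg_zero, letter_zero_letter]
      exact VertexSuperalgebra.preserves_vac.smul _
    | succ k =>
      have h0 : (k : ℂ) + 1 ≠ 0 := by exact_mod_cast k.succ_ne_zero
      rw [← one_smul ℂ (psiPair (k + 1)), ← inv_mul_cancel₀ h0, mul_smul, succ_smul_psiPair]
      exact (VertexSuperalgebra.Preserves.sum _ fun j _ =>
        hg.mode (homog_quad _ _) (homog_psiPair _) (ih _ (by omega)) _).smul _

/-- Expand `Y(a ⊗ ψ, z) = Y(a, z) ⊗ Y(ψ, z)` on `a* ⊗ ψ*`. Only the modes `a_(-p)` with `0 ≤ p ≤ k +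
1` contribute, and for `p = k + 1` the Clifford factor is `ψ_(0) ψ* = 1`. The result is a triangular
system for the vectors `a_(-p) a*`. -/
theorem PsiP_mode_PsiM (k : ℕ) : U.mode PsiP (-k) PsiM =
    aPair (k + 1) + ∑ p ∈ Finset.range (k + 1), U.mode (aPair p) (-1) (psiPair (k + 1 - p)) := by
  have hψ : ∀ q : ℕ, psiPair q = weylVA.vac ⊗ₜ cliffordData.x .psi (-q) psiStar := fun q =>
    letter_inr_mode _ _ _ _
  have ha : ∀ p : ℕ, aPair p = weylData.x .a (-p) aStar ⊗ₜ cliffordVA.vac := fun p =>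
    letter_inl_mode _ _ _ _
  have hm : ∀ p q : ℕ, U.mode (aPair p) (-1) (psiPair q) =
      weylData.x .a (-p) aStar ⊗ₜ cliffordData.x .psi (-q) psiStar := fun p q => by
    rw [ha, hψ, U, VertexSuperalgebra.tensor_mode_tmul_vac, weylVA.mode_neg_one_vac]
  have hw : ∀ i : ℤ, 0 < i → weylData.x .a i aStar = 0 := fun i hi => by
    rw [← weylData.mode_state]
    rcases (show i = 1 ∨ 2 ≤ i by omega) with rfl | hi
    · exact (weylData.hasOPE_state.one _ _).trans (zero_smul _ _)
    · exact weylData.hasOPE_state.two_le _ _ i hi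
  have hc : ∀ i : ℤ, 0 < i → cliffordData.x .psi i psiStar = 0 := fun i hi => by
    rw [← cliffordData.mode_state]
    rcases (show i = 1 ∨ 2 ≤ i by omega) with rfl | hi
    · exact (cliffordData.hasOPE_state.one _ _).trans (zero_smul _ _)
    · exact cliffordData.hasOPE_state.two_le _ _ i hi
  have hc0 : cliffordData.x .psi 0 psiStar = cliffordVA.vac := by
    rw [← cliffordData.mode_state]
    refine (cliffordData.hasOPE_state.zero _ _).trans ?_
    simp
    rfl
  have e : U.mode PsiP (-k) PsiM =
      ∑ᶠ i : ℤ, weylData.x .a i aStar ⊗ₜ cliffordData.x .psi (-k - 1 - i) psiStar := by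
    simp only [← weylData.mode_state, ← cliffordData.mode_state]
    exact VertexSuperalgebra.tensorMode_tmul_tmul _ _ _ _ _ _ _
  rw [e, ← finsum_comp_equiv (Equiv.neg ℤ), finsum_eq_sum_of_support_subset
      (s := (Finset.range (k + 2)).map Nat.castEmbedding) _ fun i hi => by
        by_contra h
        rcases lt_or_ge i 0 with h0 | h0
        · exact hi (by simp only [Equiv.neg_apply, hw (-i) (by omega), zero_tmul])
        · obtain ⟨i, rfl⟩ := Int.eq_ofNat_of_zero_le h0
          have : ¬ i < k + 2 := fun hk => h (by simpa using hk)
          exact hi (by simp only [Equiv.neg_apply, hc (-k - 1 - -(i : ℤ)) (by omega), tmul_zero]),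
    Finset.sum_map, Finset.sum_range_succ, add_comm]
  congr 1
  · rw [ha]
    simp only [Nat.castEmbedding_apply, Equiv.neg_apply]
    rw [show -(k : ℤ) - 1 - -((k + 1 : ℕ) : ℤ) = 0 by push_cast; ring, hc0]
  · refine Finset.sum_congr rfl fun p hp => ?_
    rw [Finset.mem_range] at hp
    simp only [Nat.castEmbedding_apply, Equiv.neg_apply]
    rw [hm, show -(k : ℤ) - 1 - -(p : ℤ) = -((k + 1 - p : ℕ) : ℤ) by omega]

/-- Since `γ = E/2 + N`, all `ψ_(-k) ψ*` preserve `S`, and the triangular system is solved for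
`a_(-k-1) a*`. -/
theorem preserves_aPair (h : ∀ x, U.Preserves S (vec x)) (k : ℕ) : U.Preserves S (aPair k) := by
  have hg : U.Preserves S (quad (.inr .psi) (.inr .psiStar)) := by
    have e : quad (.inr .psi) (.inr .psiStar) = (2⁻¹ : ℂ) • vec .E + vec .N := by
      rw [vec_eq .E, vec_eq .N]
      module
    rw [e]
    exact ((h .E).smul _).add (h .N)
  induction k using Nat.strong_induction_on with
  | _ k ih =>
    cases k with
    | zero =>
      rw [aPair, Nat.cast_zero, neg_zero, letter_zero_letter]
      exact VertexSuperalgebra.preserves_vac.smul _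
    | succ k =>
      rw [eq_sub_of_add_eq (PsiP_mode_PsiM k).symm]
      refine ((h .PsiP).mode (homog_vec .PsiP) (homog_vec .PsiM) (h .PsiM) _).sub
        (VertexSuperalgebra.Preserves.sum _ fun p hp => ?_)
      exact (ih p (by simpa using hp)).mode (homog_aPair p) (homog_psiPair _)
        (preserves_psiPair hg _) _

/-- All products of modes of `k` and `l` preserve `S`. -/
def PairStable (S : Submodule ℂ (M ⊗[ℂ] F)) (k l : Letter) : Prop :=
  ∀ m n, ∀ v ∈ S, U.mode (letter k) m (U.mode (letter l) n v) ∈ S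

theorem PairStable.symm {k l : Letter} (h : PairStable S k l) : PairStable S l k := by
  intro m n v hv
  rw [letter_comm]
  exact S.add_mem (S.smul_mem _ (h _ _ v hv)) (S.smul_mem _ hv)

/-- Up to `k!`, the field of `a_(-k-1) a*` is `:(∂^k a) a*:`, so all these normally ordered products
preserve `S` and their individual summands can be isolated. -/
theorem pairStable_a_aStar (h : ∀ x, U.Preserves S (vec x)) :
    PairStable S (.inl .a) (.inl .aStar) := by
  have ha : U.Homog 0 (letter (.inl .a)) := hasOPE_letter.homog (.inl .a)
  have hb : U.Homog 0 (letter (.inl .aStar)) := hasOPE_letter.homog (.inl .aStar)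
  have key : ∀ k n, ∀ v ∈ S, nprod ((-1) ^ (0 * 0)) (fieldDeriv^[k] (U.mode (letter (.inl .a))))
      (U.mode (letter (.inl .aStar))) n v ∈ S := by
    intro k n v hv
    rw [← U.mode_iterate_transl ha, ← U.mode_neg_one_mode (ha.iterate_transl k) hb,
      ← U.factorial_smul_mode_neg ha, show (-1 - k : ℤ) = -((k + 1 : ℕ) : ℤ) by push_cast; ring]
    exact (preserves_aPair h (k + 1)).smul _ n v hv
  intro m n v hv
  have := mode_mul_mode_mem (U.truncation (letter (.inl .a))) (U.truncation (letter (.inl .aStar)))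
    (fun k => by rw [← U.mode_iterate_transl ha]; exact U.truncation _) key (m + n + 1) m hv
  rw [show m + n + 1 - 1 - m = n by ring] at this
  -- For `m < 0` the normally ordered summand is the product wanted; otherwise it has the opposite
  -- order, and the commutator is a scalar.
  split at this
  · exact this
  · rw [mul_zero, pow_zero, one_smul] at this
    rw [letter_comm]
    exact S.add_mem (S.smul_mem _ this) (S.smul_mem _ hv)

/-- The product `a_(m) ψ_(n)` is the commutator of `Ψ⁺_(n)` with `a_(m) a*_(0)`. -/
theorem pairStable_a_psi (h : ∀ x, U.Preserves S (vec x)) :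
    PairStable S (.inl .a) (.inr .psi) := by
  intro m n v hv
  have hp := pairStable_a_aStar h
  have hP := h .PsiP
  rw [vec_eq] at hP
  have e1 := congrArg (U.mode (letter (.inl .a)) m)
    (letter_comm_quad (.inl .aStar) (.inl .a) (.inr .psi) 0 n v)
  have e2 := letter_comm_quad (.inl .a) (.inl .a) (.inr .psi) m n
    (U.mode (letter (.inl .aStar)) 0 v)
  have e3 : U.mode (letter (.inl .a)) m (U.mode (letter (.inr .psi)) n v) =
      U.mode (quad (.inl .a) (.inr .psi)) n
        (U.mode (letter (.inl .a)) m (U.mode (letter (.inl .aStar)) 0 v)) -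
      U.mode (letter (.inl .a)) m (U.mode (letter (.inl .aStar)) 0
        (U.mode (quad (.inl .a) (.inr .psi)) n v)) := by
    simp only [Letter.par, Letter.pairing, zero_mul, pow_zero, one_smul, mul_zero, zero_smul,
      add_zero, zero_add, map_add, map_smul] at e1 e2
    rw [e1, e2]
    module
  rw [e3]
  exact S.sub_mem (hP n _ (hp m 0 v hv)) (hp m 0 _ (hP n v hv))

/-- Mirror image of the previous case: `a*_(m) ψ*_(n)` is the commutator of `a*_(m) a_(0)` with
`Ψ⁻_(n)`. -/
theorem pairStable_aStar_psiStar (h : ∀ x, U.Preserves S (vec x)) :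
    PairStable S (.inl .aStar) (.inr .psiStar) := by
  intro m n v hv
  have hp := (pairStable_a_aStar h).symm
  have hP := h .PsiM
  rw [vec_eq] at hP
  have e1 := congrArg (U.mode (letter (.inl .aStar)) m)
    (letter_comm_quad (.inl .a) (.inl .aStar) (.inr .psiStar) 0 n v)
  have e2 := letter_comm_quad (.inl .aStar) (.inl .aStar) (.inr .psiStar) m n
    (U.mode (letter (.inl .a)) 0 v)
  have e3 : U.mode (letter (.inl .aStar)) m (U.mode (letter (.inr .psiStar)) n v) =
      U.mode (letter (.inl .aStar)) m (U.mode (letter (.inl .a)) 0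
        (U.mode (quad (.inl .aStar) (.inr .psiStar)) n v)) -
      U.mode (quad (.inl .aStar) (.inr .psiStar)) n
        (U.mode (letter (.inl .aStar)) m (U.mode (letter (.inl .a)) 0 v)) := by
    simp only [Letter.par, Letter.pairing, zero_mul, pow_zero, one_smul, mul_zero, zero_smul,
      add_zero, zero_add, map_add] at e1 e2
    rw [e1, e2]
    module
  rw [e3]
  exact S.sub_mem (hp m 0 _ (hP n v hv)) (hP n _ (hp m 0 v hv))

/-- As `[a_(0), a*_(-1)] = 1`, the anticommutator of `a_(0) ψ_(m)` and `a*_(-1) ψ*_(n)` is `ψ_(m)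
ψ*_(n)` plus a multiple of `a*_(-1) a_(0)`, and both remaining ingredients are already known to
preserve `S`. -/
theorem pairStable_psi_psiStar (h : ∀ x, U.Preserves S (vec x)) :
    PairStable S (.inr .psi) (.inr .psiStar) := by
  intro m n v hv
  have h1 := pairStable_a_psi h 0 m _ (pairStable_aStar_psiStar h (-1) n v hv)
  have h2 := pairStable_aStar_psiStar h (-1) n _ (pairStable_a_psi h 0 m v hv)
  have e1 : U.mode (letter (.inl .a)) 0 (U.mode (letter (.inr .psi)) m
      (U.mode (letter (.inl .aStar)) (-1) (U.mode (letter (.inr .psiStar)) n v))) =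
      U.mode (letter (.inl .aStar)) (-1) (U.mode (letter (.inl .a)) 0
        (U.mode (letter (.inr .psi)) m (U.mode (letter (.inr .psiStar)) n v))) +
      U.mode (letter (.inr .psi)) m (U.mode (letter (.inr .psiStar)) n v) := by
    have c1 := letter_comm (.inr .psi) (.inl .aStar) m (-1) (U.mode (letter (.inr .psiStar)) n v)
    have c2 := letter_comm (.inl .a) (.inl .aStar) 0 (-1)
      (U.mode (letter (.inr .psi)) m (U.mode (letter (.inr .psiStar)) n v))
    simp only [Letter.par, Letter.pairing, mul_zero, pow_zero, one_smul, ite_self, zero_smul,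
      add_zero, zero_add, if_true] at c1 c2
    rw [c1, c2]
  have e2 : U.mode (letter (.inl .aStar)) (-1) (U.mode (letter (.inr .psiStar)) n
      (U.mode (letter (.inl .a)) 0 (U.mode (letter (.inr .psi)) m v))) =
      -U.mode (letter (.inl .aStar)) (-1) (U.mode (letter (.inl .a)) 0
        (U.mode (letter (.inr .psi)) m (U.mode (letter (.inr .psiStar)) n v))) +
      (if n + m = -1 then (1 : ℂ) else 0) •
        U.mode (letter (.inl .aStar)) (-1) (U.mode (letter (.inl .a)) 0 v) := by
    have c1 := letter_comm (.inr .psiStar) (.inl .a) n 0 (U.mode (letter (.inr .psi)) m v)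
    have c2 := letter_comm (.inr .psiStar) (.inr .psi) n m v
    simp only [Letter.par, Letter.pairing, mul_zero, pow_zero, one_smul, ite_self, zero_smul,
      add_zero, mul_one, pow_one] at c1 c2
    rw [c1, c2, map_add, map_add, map_smul, map_smul, map_smul, map_smul]
    module
  have h3 := S.sub_mem (S.add_mem h1 h2) (S.smul_mem (if n + m = -1 then (1 : ℂ) else 0)
    ((pairStable_a_aStar h).symm (-1) 0 v hv))
  rw [e1, e2] at h3
  convert h3 using 1
  abel

/-- `𝒰⁰` is irreducible under the modes of the vectors `E`, `N`, `Ψ⁺`, `Ψ⁻`. -/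
theorem eq_U0_of_preserves (hS : S ≤ U0) (hne : S ≠ ⊥) (h : ∀ x, U.Preserves S (vec x)) :
    S = U0 := by
  refine eq_U0_of_pairs_mem hS hne fun k l hkl => ?_
  change PairStable S k l
  have h1 := pairStable_a_aStar h
  have h2 := pairStable_a_psi h
  have h3 := pairStable_aStar_psiStar h
  have h4 := pairStable_psi_psiStar h
  -- Among the sixteen pairs, those of total charge zero are the four already treated and their
  -- reversals.
  rcases k with (_ | _) | (_ | _) <;> rcases l with (_ | _) | (_ | _) <;>
    first
      | exact absurd hkl (by decide)
      | assumption
      | exact PairStable.symm (by assumption)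

end Stable

/-! ### The vacuum of `𝒰` is non-zero -/

namespace CurrentData

variable (D : CurrentData) {W : Type*} [AddCommGroup W] [Module ℂ W]

/-- The vacuum module is given by generators and relations and might collapse. A representation with
a non-zero vector killed by the non-negative modes excludes this, since `1` cannot lie in the left
ideal annihilating that vector. -/
theorem vac_ne_zero_of_rep (A : D.ι → ℤ → Module.End ℂ W)
    (hA : ∀ i j m n v, A i m (A j n v) = (-1 : ℂ) ^ (D.par i * D.par j) • A j n (A i m v) +
      ∑ k, D.bracket i j k • A k (m + n) v + (if m + n = -1 then D.pairing₀ i j else 0) • v +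
      (if m + n = 0 then m * D.pairing₁ i j else 0) • v)
    {w : W} (hw : w ≠ 0) (hA0 : ∀ i n, 0 ≤ n → A i n w = 0) : D.vac ≠ 0 := by
  let Φ : D.ModeAlgebra →ₐ[ℂ] Module.End ℂ W :=
    RingQuot.liftAlgHom ℂ ⟨FreeAlgebra.lift ℂ fun p : D.ι × ℤ => A p.1 p.2, by
      rintro _ _ ⟨i, j, m, n⟩
      simp only [map_mul, map_add, map_smul, map_sum, map_one, FreeAlgebra.lift_ι_apply]
      refine LinearMap.ext fun v => ?_
      simp only [Module.End.mul_apply, LinearMap.add_apply, LinearMap.smul_apply,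
        LinearMap.sum_apply, Module.End.one_apply]
      exact hA i j m n v⟩
  have hΦ : D.vacIdeal ≤ LinearMap.ker ((LinearMap.applyₗ w).comp Φ.toLinearMap) := by
    rw [vacIdeal, Submodule.span_le]
    rintro _ ⟨a, i, n, hn, rfl⟩
    change Φ (a * D.gen i n) w = 0
    rw [map_mul, Module.End.mul_apply, gen, RingQuot.liftAlgHom_mkAlgHom_apply,
      FreeAlgebra.lift_ι_apply, hA0 i n hn, map_zero]
  intro h
  have h1 : (1 : D.ModeAlgebra) ∈ D.vacIdeal := by
    rwa [vac, Submodule.mkQ_apply, Submodule.Quotient.mk_eq_zero] at h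
  have h2 : Φ 1 w = 0 := hΦ h1
  rw [map_one] at h2
  exact hw h2

/-- Creation operators `c` and annihilation operators `d` with the canonical (anti)commutation
relations show that the vacuum of a system of free fields is non-zero. -/
theorem vac_ne_zero_of_oscillators (hbr : ∀ i j k, D.bracket i j k = 0)
    (hp : ∀ i j, D.pairing₁ i j = 0)
    (hsymm : ∀ i j, (-1 : ℂ) ^ (D.par i * D.par j) * D.pairing₀ j i = -D.pairing₀ i j)
    (c d : D.ι → ℕ → Module.End ℂ W)
    (hc : ∀ i j m n v, c i m (c j n v) = (-1 : ℂ) ^ (D.par i * D.par j) • c j n (c i m v))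
    (hd : ∀ i j m n v, d i m (d j n v) = (-1 : ℂ) ^ (D.par i * D.par j) • d j n (d i m v))
    (hdc : ∀ i j m n v, d i m (c j n v) = (-1 : ℂ) ^ (D.par i * D.par j) • c j n (d i m v) +
      (if m = n then D.pairing₀ i j else 0) • v)
    {w : W} (hw : w ≠ 0) (hdw : ∀ i n, d i n w = 0) : D.vac ≠ 0 := by
  -- The mode `n ≥ 0` acts by `d n` and the mode `-1 - n` by `c n`, which matches the pairing
  -- `δ_(m+n,-1)`.
  refine D.vac_ne_zero_of_rep (fun i n => if 0 ≤ n then d i n.toNat else c i (-1 - n).toNat)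
    ?_ hw ?_
  · intro i j m n v
    simp only [hbr, hp, zero_smul, Finset.sum_const_zero, mul_zero, ite_self, add_zero]
    by_cases hm : 0 ≤ m <;> by_cases hn : 0 ≤ n
    · rw [if_pos hm, if_pos hn, if_neg (by omega), zero_smul, add_zero, hd]
    · rw [if_pos hm, if_neg hn, hdc]
      simp only [show m.toNat = (-1 - n).toNat ↔ m + n = -1 by omega]
    · rw [if_neg hm, if_pos hn, hdc j i, smul_add, smul_smul, mul_comm (D.par j),
        GeneratingFields.sign_sq, one_smul, add_assoc, smul_smul, ← add_smul]
      simp only [show n.toNat = (-1 - m).toNat ↔ m + n = -1 by omega]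
      split_ifs
      · rw [hsymm, neg_add_cancel, zero_smul, add_zero]
      · rw [mul_zero, add_zero, zero_smul, add_zero]
    · rw [if_neg hm, if_neg hn, if_neg (by omega), zero_smul, add_zero, hc]
  · intro i n hn
    simp only [if_pos hn, hdw]

end CurrentData

/-- The commutator is a derivation which kills all variables. -/
theorem pderiv_comm {σ : Type*} (i j : σ) (f : MvPolynomial σ ℂ) :
    MvPolynomial.pderiv i (MvPolynomial.pderiv j f) =
      MvPolynomial.pderiv j (MvPolynomial.pderiv i f) := by
  classical
  have h : ⁅MvPolynomial.pderiv (R := ℂ) i, MvPolynomial.pderiv j⁆ = 0 :=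
    MvPolynomial.derivation_ext fun k => by
      rw [Derivation.commutator_apply, MvPolynomial.pderiv_X, MvPolynomial.pderiv_X,
        Pi.single_apply, Pi.single_apply]
      split_ifs <;> simp
  have h2 := congrArg (fun D : Derivation ℂ (MvPolynomial σ ℂ) (MvPolynomial σ ℂ) => D f) h
  rw [Derivation.commutator_apply] at h2
  exact sub_eq_zero.1 h2

/-- Bosonic Fock space: multiplication by variables and partial derivatives on a polynomial ring. -/
theorem weylVA_vac_ne_zero : weylVA.vac ≠ 0 := by
  let dual : WeylGen → WeylGen | .a => .aStar | .aStar => .a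
  refine weylData.vac_ne_zero_of_oscillators (W := MvPolynomial (WeylGen × ℕ) ℂ) (w := 1)
    (fun _ _ _ => rfl) (fun _ _ => rfl) (fun i j => ?_)
    (fun i n => LinearMap.mulLeft ℂ (MvPolynomial.X (i, n)))
    (fun i n => weylData.pairing₀ i (dual i) • (MvPolynomial.pderiv (dual i, n)).toLinearMap)
    (fun i j m n v => ?_) (fun i j m n v => ?_) (fun i j m n v => ?_) one_ne_zero (fun i n => ?_)
  · cases i <;> cases j <;> simp
  · simp [mul_left_comm]
  · simp only [LinearMap.smul_apply, Derivation.coeFn_coe, map_smul, mul_zero, pow_zero, one_smul]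
    rw [pderiv_comm, smul_comm]
  · simp only [LinearMap.smul_apply, Derivation.coeFn_coe, LinearMap.mulLeft_apply,
      Derivation.leibniz, mul_zero, pow_zero, one_smul, MvPolynomial.pderiv_X, smul_eq_mul,
      smul_add, mul_smul_comm]
    congr 1
    rw [Pi.single_apply]
    cases i <;> cases j <;> simp [dual, eq_comm]
  · simp

/-- Fermionic Fock space: exterior multiplication and contraction on an exterior algebra. -/
theorem cliffordVA_vac_ne_zero : cliffordVA.vac ≠ 0 := by
  let dual : CliffordGen → CliffordGen | .psi => .psiStar | .psiStar => .psi
  refine cliffordData.vac_ne_zero_of_oscillators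
    (W := ExteriorAlgebra ℂ (CliffordGen × ℕ →₀ ℂ)) (w := 1)
    (fun _ _ _ => rfl) (fun _ _ => rfl) (fun i j => ?_)
    (fun i n => LinearMap.mulLeft ℂ (ExteriorAlgebra.ι ℂ (Finsupp.single (i, n) 1)))
    (fun i n => CliffordAlgebra.contractLeft (Finsupp.lapply (dual i, n)))
    (fun i j m n v => ?_) (fun i j m n v => ?_) (fun i j m n v => ?_) one_ne_zero (fun i n => ?_)
  · cases i <;> cases j <;> simp
  · simp only [LinearMap.mulLeft_apply, mul_one, pow_one, neg_smul, one_smul]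
    rw [← mul_assoc, ← mul_assoc, eq_neg_iff_add_eq_zero, ← add_mul,
      ExteriorAlgebra.ι_add_mul_swap, zero_mul]
  · simp only [mul_one, pow_one, neg_smul, one_smul]
    exact CliffordAlgebra.contractLeft_comm _ _ _
  · simp only [LinearMap.mulLeft_apply, mul_one, pow_one, neg_smul, one_smul]
    refine (CliffordAlgebra.contractLeft_ι_mul _ _ _).trans ?_
    rw [sub_eq_neg_add, Finsupp.lapply_apply, Finsupp.single_apply]
    congr 2
    cases i <;> cases j <;> simp [dual, eq_comm]
  · exact CliffordAlgebra.contractLeft_one (Q := (0 : QuadraticForm ℂ (CliffordGen × ℕ →₀ ℂ))) _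

theorem U_vac_ne_zero : U.vac ≠ 0 := by
  obtain ⟨f, hf⟩ := Module.Projective.exists_dual_ne_zero ℂ weylVA_vac_ne_zero
  obtain ⟨g, hg⟩ := Module.Projective.exists_dual_ne_zero ℂ cliffordVA_vac_ne_zero
  intro h
  have := congrArg (LinearMap.mul' ℂ ℂ ∘ₗ TensorProduct.map f g) h
  rw [U_vac, LinearMap.comp_apply, TensorProduct.map_tmul, LinearMap.mul'_apply, map_zero] at this
  exact mul_ne_zero hf hg this

/-! ### The conformal vector of `V¹(gl(1|1))` -/

section Sugawara

/-- The quadratic vector `x_(-1) y` of `V¹(gl(1|1))`. -/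
def affQuad (x y : Gl11) : (affineData 1).VacModule :=
  (affineData 1).x x (-1) ((affineData 1).state y)

/-- The conformal vector of `V¹(gl(1|1))`. -/
def sugawara : (affineData 1).VacModule :=
  affQuad .N .E - affQuad .PsiP .PsiM + (2⁻¹ : ℂ) • (affineData 1).x .E (-2) (affineData 1).vac +
    (2⁻¹ : ℂ) • affQuad .E .E

theorem x_zero_state (x y : Gl11) : (affineData 1).x x 0 ((affineData 1).state y) =
    ∑ k, Gl11.bracket x y k • (affineData 1).state k := by
  have := (affineData 1).hasOPE_state.zero x y
  rw [(affineData 1).mode_state, zero_smul, add_zero] at this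
  exact this

theorem x_one_state (x y : Gl11) :
    (affineData 1).x x 1 ((affineData 1).state y) = Gl11.form x y • (affineData 1).vac := by
  have := (affineData 1).hasOPE_state.one x y
  rw [(affineData 1).mode_state] at this
  rw [this]
  exact congrArg (· • (affineData 1).vac) (one_mul _)

theorem x_two_le_state (x y : Gl11) {n : ℤ} (hn : 2 ≤ n) :
    (affineData 1).x x n ((affineData 1).state y) = 0 := by
  have := (affineData 1).hasOPE_state.two_le x y n hn
  rwa [(affineData 1).mode_state] at this

theorem x_affQuad (x y z : Gl11) (n : ℤ) : (affineData 1).x x n (affQuad y z) =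
    (-1 : ℂ) ^ (x.par * y.par) •
        (affineData 1).x y (-1) ((affineData 1).x x n ((affineData 1).state z)) +
      ∑ k, Gl11.bracket x y k • (affineData 1).x k (n - 1) ((affineData 1).state z) +
      (if n = 1 then Gl11.form x y else 0) • (affineData 1).state z := by
  rw [affQuad, CurrentData.x_comm, ← sub_eq_add_neg]
  simp only [ite_self, zero_smul, add_zero, sub_eq_zero, one_mul]
  congr 2
  split_ifs with h
  · rw [h, Int.cast_one, one_mul]
  · rfl

theorem x_E_neg_two (x : Gl11) {n : ℤ} (hn : 0 ≤ n) :
    (affineData 1).x x n ((affineData 1).x .E (-2) (affineData 1).vac) =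
      (if n = 2 then 2 * Gl11.form x .E else 0) • (affineData 1).vac := by
  rw [CurrentData.x_comm, (affineData 1).x_vac x n hn, map_zero, smul_zero, zero_add,
    Finset.sum_eq_zero fun k _ => by cases x <;> cases k <;> exact zero_smul _ _]
  simp only [ite_self, zero_smul, zero_add, ← sub_eq_add_neg, sub_eq_zero, one_mul]
  split_ifs with h
  · rw [h, Int.cast_ofNat]
  · rfl

theorem affQuad_swap (x y : Gl11) (h : Gl11.bracket x y = 0) :
    affQuad x y = (-1 : ℂ) ^ (x.par * y.par) • affQuad y x := by
  rw [affQuad, CurrentData.state, CurrentData.x_comm,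
    Finset.sum_eq_zero fun k _ => by
      rw [show (affineData 1).bracket x y = 0 from h]
      exact zero_smul _ _]
  simp
  rfl

/-- With the next two lemmas this says that each `x` is primary of weight one for `sugawara`, which
is all that is needed of a conformal vector here. The term in `E_(-1) E` makes `x_(1)` come out as
`x` exactly. -/
theorem x_zero_sugawara (x : Gl11) : (affineData 1).x x 0 sugawara = 0 := by
  have h1 := affQuad_swap .PsiM .E (by funext k; cases k <;> rfl)
  have h2 := affQuad_swap .PsiP .E (by funext k; cases k <;> rfl)
  simp only [sugawara, map_add, map_sub, map_smul, x_affQuad, x_E_neg_two _ le_rfl,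
    x_zero_state, Gl11.sum_univ]
  cases x <;> simp [Gl11.bracket, Gl11.par, ← affQuad.eq_1, h1, h2]

theorem x_one_sugawara (x : Gl11) : (affineData 1).x x 1 sugawara = (affineData 1).state x := by
  simp only [sugawara, map_add, map_sub, map_smul, x_affQuad,
    x_E_neg_two _ zero_le_one, x_one_state, x_zero_state, Gl11.sum_univ, sub_self]
  cases x <;> simp [Gl11.bracket, Gl11.form, Gl11.par, ← CurrentData.state.eq_1]
  all_goals module

theorem x_two_le_sugawara (x : Gl11) {n : ℤ} (hn : 2 ≤ n) : (affineData 1).x x n sugawara = 0 := by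
  have h0 : 0 ≤ n := by omega
  simp only [sugawara, map_add, map_sub, map_smul, x_affQuad, x_E_neg_two _ h0,
    x_two_le_state _ _ hn, Gl11.sum_univ, if_neg (show n ≠ 1 by omega)]
  rcases (show n = 2 ∨ 2 ≤ n - 1 by omega) with rfl | h
  -- A third order pole could arise only for `x = N`, where `Ψ⁺_(-1) Ψ⁻` contributes `-1` and the
  -- term in `E_(-2)` contributes `1`.
  · rw [show (2 : ℤ) - 1 = 1 by norm_num]
    cases x <;> simp [Gl11.bracket, Gl11.form, Gl11.par, x_one_state]
  · simp only [x_two_le_state _ _ h, if_neg (show n ≠ 2 by omega)]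
    simp

theorem homog_sugawara : (universalAffine 1).Homog 0 sugawara := by
  have h : ∀ x y : Gl11, x.par = y.par → (universalAffine 1).Homog 0 (affQuad x y) := by
    intro x y hxy
    rw [affQuad, ← (affineData 1).mode_state]
    refine (((affineData 1).homog_state x).mode ((affineData 1).homog_state y) _).congr ?_
    change (-1 : ℂ) ^ (x.par + y.par) = _
    rw [hxy, pow_add, GeneratingFields.sign_sq, pow_zero]
  have hE : (universalAffine 1).Homog 0 ((affineData 1).x .E (-2) (affineData 1).vac) := by
    rw [← (affineData 1).mode_state]
    exact ((affineData 1).homog_state .E).mode (universalAffine 1).homog_vac _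
  have e : sugawara = affQuad .N .E + (-1 : ℂ) • affQuad .PsiP .PsiM +
      (2⁻¹ : ℂ) • (affineData 1).x .E (-2) (affineData 1).vac + (2⁻¹ : ℂ) • affQuad .E .E := by
    rw [sugawara]
    module
  rw [e]
  exact (((h .N .E rfl).add ((h .PsiP .PsiM rfl).smul _)).add (hE.smul _)).add
    ((h .E .E rfl).smul _)

/-- In the commutator of `x_(n)` with `sugawara_(1) = L(0)` only the product `x_(1) sugawara = x`
contributes; so `x_(n)` shifts the weight by `-n`. -/
theorem sugawara_comm (x : Gl11) (n : ℤ) (v : (affineData 1).VacModule) :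
    (universalAffine 1).mode sugawara 1 ((affineData 1).x x n v) =
      (affineData 1).x x n ((universalAffine 1).mode sugawara 1 v) -
        (n : ℂ) • (affineData 1).x x n v := by
  have h := (universalAffine 1).commutator ((affineData 1).homog_state x) homog_sugawara (N := 2)
    (fun j hj => by
      rw [show (universalAffine 1).mode _ _ = _ from (affineData 1).mode_state x j]
      exact x_two_le_sugawara x (by omega)) n 1 v
  simp only [show ∀ n, (universalAffine 1).mode ((affineData 1).state x) n = _
    from (affineData 1).mode_state x] at h
  rw [Finset.sum_range_succ, Finset.sum_range_one, Nat.cast_zero, x_zero_sugawara, Nat.cast_one,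
    x_one_sugawara, Ring.choose_one_right, mul_zero, pow_zero, one_smul, map_zero, Pi.zero_apply,
    LinearMap.zero_apply, smul_zero, zero_add, add_sub_cancel_right,
    show (universalAffine 1).mode ((affineData 1).state x) n = _
      from (affineData 1).mode_state x n] at h
  rw [h, add_sub_cancel_right]

/-- Up to a multiple of the vacuum, every vector is killed by a polynomial in `L(0)` with non-zero
constant term. -/
theorem exists_aeval_sugawara (v : (affineData 1).VacModule) :
    ∃ (r : ℂ) (p : Polynomial ℂ), p.eval 0 ≠ 0 ∧
      Polynomial.aeval ((universalAffine 1).mode sugawara 1) p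
        (v - r • (affineData 1).vac) = 0 := by
  -- The creation operators are the `x_(-1-k)`, which raise the weight by `k + 1 > 0`.
  refine exists_aeval_sub_smul_eq_zero (ι := Gl11 × ℕ)
    (c := fun q => (affineData 1).x q.1 (-1 - q.2)) (wt := fun q => q.2 + 1) (fun _ => Nat.succ_pos _)
    ?_ (fun q v => ?_) (fun S h0 hS => ?_) v
  · exact (universalAffine 1).mode_vac sugawara 1 zero_le_one
  · rw [sugawara_comm]
    push_cast
    module
  · refine (affineData 1).generates S h0 fun i n v hn hv => ?_
    have := hS (i, (-1 - n).toNat) v hv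
    rwa [show (-1 - ((-1 - n).toNat : ℤ)) = n by omega] at this

end Sugawara

/-! ### The isomorphism -/

theorem aeval_mem {V : Type*} [AddCommGroup V] [Module ℂ V] {L : Module.End ℂ V}
    {I : Submodule ℂ V} (h : ∀ v ∈ I, L v ∈ I) (p : Polynomial ℂ) {v : V} (hv : v ∈ I) :
    Polynomial.aeval L p v ∈ I := by
  induction p using Polynomial.induction_on' with
  | add p q hp hq =>
    rw [map_add, LinearMap.add_apply]
    exact I.add_mem hp hq
  | monomial n a =>
    rw [Polynomial.aeval_monomial, Algebra.algebraMap_eq_smul_one, smul_one_mul,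
      LinearMap.smul_apply]
    refine I.smul_mem _ ?_
    induction n with
    | zero => exact hv
    | succ n ih => rw [pow_succ', Module.End.mul_apply]; exact h _ ih

theorem map_aeval {V W : Type*} [AddCommGroup V] [Module ℂ V] [AddCommGroup W] [Module ℂ W]
    {f : V →ₗ[ℂ] W} {L : Module.End ℂ V} {L' : Module.End ℂ W} (h : ∀ v, f (L v) = L' (f v))
    (p : Polynomial ℂ) (v : V) : f (Polynomial.aeval L p v) = Polynomial.aeval L' p (f v) := by
  induction p using Polynomial.induction_on' with
  | add p q hp hq => rw [map_add, map_add, LinearMap.add_apply, map_add, hp, hq,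
      LinearMap.add_apply]
  | monomial n a =>
    rw [Polynomial.aeval_monomial, Polynomial.aeval_monomial, Algebra.algebraMap_eq_smul_one,
      Algebra.algebraMap_eq_smul_one, smul_one_mul, smul_one_mul, LinearMap.smul_apply,
      LinearMap.smul_apply, map_smul]
    congr 1
    induction n with
    | zero => rfl
    | succ n ih => rw [pow_succ', pow_succ', Module.End.mul_apply, Module.End.mul_apply, h, ih]

/-- The homomorphism `V¹(gl(1|1)) → 𝒰`. -/
def affineHom : (affineData 1).VacModule →ₗ[ℂ] M ⊗[ℂ] F := hasOPE_vec.hom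

theorem affineHom_vac : affineHom (universalAffine 1).vac = U.vac := hasOPE_vec.hom_vac

theorem affineHom_mode (a : (affineData 1).VacModule) (n : ℤ) (b : (affineData 1).VacModule) :
    affineHom ((universalAffine 1).mode a n b) = U.mode (affineHom a) n (affineHom b) :=
  hasOPE_vec.hom_mode a n b

theorem affineHom_parity (a : (affineData 1).VacModule) :
    affineHom ((universalAffine 1).parity a) = U.parity (affineHom a) :=
  hasOPE_vec.hom_parity a

theorem affineHom_state (x : Gl11) : affineHom ((affineData 1).state x) = vec x :=
  hasOPE_vec.hom_state x

/-- `E` is central in `gl(1|1)`, and the first order poles carry no scalar term. -/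
theorem vec_mem_U0 (x : Gl11) : vec x ∈ U0 := by
  change U.mode (vec .E) 0 (vec x) = 0
  rw [hasOPE_vec.zero, Gl11.sum_univ]
  cases x <;> simp [Gl11.bracket]

theorem range_affineHom_le : LinearMap.range affineHom ≤ U0 := by
  have h : U0.comap affineHom = ⊤ := by
    refine (affineData 1).generates _ ?_ fun i n v _ hv => ?_
    · exact (congrArg (· ∈ U0) hasOPE_vec.hom_vac).mpr isSubalgebra_U0.vac_mem
    · change hasOPE_vec.hom _ ∈ U0
      rw [hasOPE_vec.hom_x]
      exact isSubalgebra_U0.mode_mem _ (vec_mem_U0 i) n _ hv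
  rintro _ ⟨v, rfl⟩
  have hv : v ∈ U0.comap affineHom := by rw [h]; trivial
  exact hv

theorem preserves_map_affineHom {I : Submodule ℂ (affineData 1).VacModule}
    (hI : ∀ a n, ∀ b ∈ I, (universalAffine 1).mode a n b ∈ I) (x : Gl11) :
    U.Preserves (I.map affineHom) (vec x) := by
  rintro n _ ⟨v, hv, rfl⟩
  rw [← affineHom_state, ← affineHom_mode]
  exact Submodule.mem_map_of_mem (hI _ n v hv)

/-- Irreducibility of `𝒰⁰`, applied to an image which contains the non-zero vacuum. -/
theorem range_affineHom : LinearMap.range affineHom = U0 := by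
  refine eq_U0_of_preserves range_affineHom_le ?_ fun x => ?_
  · intro h
    have : affineHom (universalAffine 1).vac = 0 := LinearMap.range_eq_bot.1 h ▸ rfl
    rw [affineHom_vac] at this
    exact U_vac_ne_zero this
  · rw [← Submodule.map_top]
    exact preserves_map_affineHom (I := ⊤) (fun _ _ _ _ => Submodule.mem_top) x

theorem VertexSuperalgebra.IsIdeal.eq_top {V : Type*} [AddCommGroup V] [Module ℂ V]
    {A : VertexSuperalgebra V} {I : Submodule ℂ V} (hI : A.IsIdeal I) (h : A.vac ∈ I) : I = ⊤ := by
  refine eq_top_iff.2 fun b _ => ?_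
  have := hI.mode_mem_left _ h (-1) b
  rwa [A.vac_mode, if_pos rfl] at this

theorem isIdeal_ker_affineHom : (universalAffine 1).IsIdeal (LinearMap.ker affineHom) where
  parity_mem a ha := by
    rw [LinearMap.mem_ker] at ha ⊢
    rw [affineHom_parity, ha, map_zero]
  mode_mem_right a n b hb := by
    rw [LinearMap.mem_ker] at hb ⊢
    rw [affineHom_mode, hb, map_zero]
  mode_mem_left a ha n b := by
    rw [LinearMap.mem_ker] at ha ⊢
    rw [affineHom_mode, ha, map_zero, Pi.zero_apply, LinearMap.zero_apply]

/-- By irreducibility of `𝒰⁰` an ideal with non-zero image maps onto `𝒰⁰`, and then it contains some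
`u` over the vacuum. The weight-zero part of `u` is a multiple of the vacuum and again lies in the
ideal, so it only has to be seen that this multiple is not zero. -/
theorem le_ker_affineHom {I : Submodule ℂ (affineData 1).VacModule}
    (hI : (universalAffine 1).IsIdeal I) (hne : I ≠ ⊤) : I ≤ LinearMap.ker affineHom := by
  rw [LinearMap.le_ker_iff_map]
  by_contra hbot
  refine hne (hI.eq_top ?_)
  have hS : I.map affineHom = U0 := eq_U0_of_preserves
    (LinearMap.map_le_range.trans range_affineHom_le) hbot
    (preserves_map_affineHom hI.mode_mem_right)
  obtain ⟨u, hu, huv⟩ : U.vac ∈ I.map affineHom := by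
    rw [hS]
    exact isSubalgebra_U0.vac_mem
  obtain ⟨r, p, hp, h⟩ := exists_aeval_sugawara u
  set L := (universalAffine 1).mode sugawara 1 with hL
  set L' := U.mode (affineHom sugawara) 1 with hL'
  have hvac : Polynomial.aeval L p (affineData 1).vac = p.eval 0 • (affineData 1).vac :=
    aeval_of_map_eq_zero ((universalAffine 1).mode_vac sugawara 1 zero_le_one) p
  have hvac' : Polynomial.aeval L' p U.vac = p.eval 0 • U.vac :=
    aeval_of_map_eq_zero (U.mode_vac _ 1 zero_le_one) p
  have hmap : ∀ v, affineHom (Polynomial.aeval L p v) = Polynomial.aeval L' p (affineHom v) :=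
    map_aeval (affineHom_mode sugawara 1) p
  have hI' : Polynomial.aeval L p u ∈ I := aeval_mem (hI.mode_mem_right _ _) p hu
  -- In `V¹` this reads `p(L) u = r p(0) 1`. Applying `affineHom` gives `p(0) = r p(0)`, so `p(L) u
  -- = p(0) 1` is a non-zero multiple of the vacuum in `I`.
  rw [map_sub, sub_eq_zero, map_smul, hvac] at h
  have h2 := congrArg affineHom h
  rw [hmap, huv, hvac', map_smul, map_smul,
    show affineHom (affineData 1).vac = U.vac from affineHom_vac, smul_smul] at h2
  have h3 : p.eval 0 = r * p.eval 0 := smul_left_injective ℂ U_vac_ne_zero h2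
  rw [h, smul_smul, ← h3] at hI'
  have := I.smul_mem (p.eval 0)⁻¹ hI'
  rwa [smul_smul, inv_mul_cancel₀ hp, one_smul] at this

/-- The kernel is itself a proper ideal, since the vacuum of `𝒰` is non-zero, and it contains every
other one. In particular the sum of all proper ideals is proper. -/
theorem maxIdeal_eq_ker : (universalAffine 1).maxIdeal = LinearMap.ker affineHom := by
  refine le_antisymm (sSup_le fun I hI => le_ker_affineHom hI.1 hI.2) (le_sSup
    ⟨isIdeal_ker_affineHom, fun h => ?_⟩)
  have : (universalAffine 1).vac ∈ LinearMap.ker affineHom := by rw [h]; trivial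
  rw [LinearMap.mem_ker, affineHom_vac] at this
  exact U_vac_ne_zero this

/-- The linear isomorphism `V₁(gl(1|1)) ≃ 𝒰⁰`. -/
def affineEquiv : SimpleAffineSpace 1 ≃ₗ[ℂ] U0 :=
  (Submodule.quotEquivOfEq _ _ maxIdeal_eq_ker).trans
    (affineHom.quotKerEquivRange.trans (LinearEquiv.ofEq _ _ range_affineHom))

/-- The isomorphism `V₁(gl(1|1)) ≅ 𝒰⁰` of vertex superalgebras. -/
def affineIso : (simpleAffine 1).Iso (U.restrict U0 isSubalgebra_U0) where
  toLinearEquiv := affineEquiv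
  map_vac := Subtype.ext affineHom_vac
  map_parity a := by
    obtain ⟨a, rfl⟩ := Submodule.mkQ_surjective _ a
    exact Subtype.ext (affineHom_parity a)
  map_mode a n b := by
    obtain ⟨a, rfl⟩ := Submodule.mkQ_surjective _ a
    obtain ⟨b, rfl⟩ := Submodule.mkQ_surjective _ b
    exact Subtype.ext (affineHom_mode a n b)

end VertexAlg

end

/-- The kernel `𝒰⁰` of `E(0)` on `𝒰 = M ⊗ F` is a vertex subalgebra, and it is isomorphic, as a
vertex superalgebra, to the simple affine vertex superalgebra `V_1(gl(1|1))`; the isomorphism can be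
chosen to send `x(-1) 1` to `x` for `x = E, N, Ψ⁺, Ψ⁻`. -/
theorem mainTheorem8 :
    ∃ hU : VertexAlg.U.IsSubalgebra VertexAlg.U0,
      ∃ φ : (VertexAlg.simpleAffine 1).Iso (VertexAlg.U.restrict VertexAlg.U0 hU),
        ∀ x : VertexAlg.Gl11,
          ((φ.toLinearEquiv (VertexAlg.simpleAffineState 1 x) : VertexAlg.U0) :
            TensorProduct ℂ VertexAlg.M VertexAlg.F) = VertexAlg.vec x :=
  ⟨VertexAlg.isSubalgebra_U0, VertexAlg.affineIso, VertexAlg.affineHom_state⟩
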